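/- All graphs are finite and simple. A *b-coloring* of a graph $G$ with $k$ colors is a proper vertex coloring with $k$ color classes such that each color class contains a vertex (a *b-vertex*) that has a neighbor in every other color class. The *b-chromatic number* $b(G)$ is the largest $k$ such that $G$ has a b-coloring with $k$ colors; $\chi(G)$ is the chromatic number. $G$ is *b-perfect* if $\chi(H)=b(H)$ for every induced subgraph $H$ of $G$, and *b-imperfect* otherwise. Let $\mathcal F=\{F_1,\dots,F_{22}\}$ be the following graphs, where the vertices of a graph with $n$ vertices are $0,1,\dots,n-1$ and $ij$ denotes an edge between $i$ and $j$: - $F_{1}$ (5 vertices): $03,\ 13,\ 14,\ 24$ - $F_{2}$ (7 vertices): $04,\ 14,\ 25,\ 36,\ 56$ - $F_{3}$ (9 vertices): $06,\ 17,\ 28,\ 36,\ 47,\ 58$ - $F_{4}$ (6 vertices): $01,\ 02,\ 03,\ 04,\ 13,\ 15,\ 23,\ 24,\ 35$ - $F_{5}$ (7 vertices): $02,\ 03,\ 05,\ 13,\ 14,\ 25,\ 34,\ 35,\ 36,\ 46$ - $F_{6}$ (8 vertices): $02,\ 04,\ 13,\ 15,\ 24,\ 26,\ 35,\ 37,\ 46,\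 57$ - $F_{7}$ (8 vertices): $02,\ 04,\ 13,\ 15,\ 24,\ 26,\ 34,\ 35,\ 37,\ 46,\ 57$ - $F_{8}$ (8 vertices): $01,\ 04,\ 12,\ 14,\ 23,\ 24,\ 34,\ 45,\ 56,\ 57,\ 67$ - $F_{9}$ (10 vertices): $01,\ 06,\ 12,\ 16,\ 26,\ 34,\ 36,\ 45,\ 46,\ 56,\ 67,\ 78,\ 79,\ 89$ - $F_{10}$ (6 vertices): $01,\ 02,\ 04,\ 13,\ 15,\ 23,\ 24,\ 25,\ 35,\ 45$ - $F_{11}$ (7 vertices): $02,\ 03,\ 05,\ 12,\ 13,\ 14,\ 25,\ 26,\ 34,\ 35,\ 36,\ 46$ - $F_{12}$ (8 vertices): $01,\ 05,\ 12,\ 14,\ 15,\ 23,\ 26,\ 27,\ 36,\ 45,\ 56,\ 67$ - $F_{13}$ (8 vertices): $01,\ 04,\ 05,\ 12,\ 14,\ 16,\ 23,\ 25,\ 27,\ 36,\ 37,\ 45,\ 56,\ 67$ - $F_{14}$ (8 vertices): $01,\ 04,\ 06,\ 12,\ 15,\ 16,\ 23,\ 24,\ 27,\ 35,\ 37,\ 45,\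 46,\ 57,\ 67$ - $F_{15}$ (8 vertices): $01,\ 02,\ 04,\ 06,\ 13,\ 15,\ 17,\ 23,\ 25,\ 26,\ 34,\ 37,\ 45,\ 46,\ 57,\ 67$ - $F_{16}$ (6 vertices): $01,\ 02,\ 13,\ 24,\ 25,\ 34,\ 35,\ 45$ - $F_{17}$ (6 vertices): $01,\ 02,\ 13,\ 14,\ 24,\ 25,\ 34,\ 35,\ 45$ - $F_{18}$ (8 vertices): $01,\ 02,\ 04,\ 13,\ 16,\ 24,\ 25,\ 26,\ 34,\ 35,\ 36,\ 47,\ 67$ - $F_{19}$ (8 vertices): $01,\ 02,\ 04,\ 13,\ 15,\ 23,\ 26,\ 27,\ 36,\ 37,\ 46,\ 47,\ 56,\ 57$ - $F_{20}$ (8 vertices): $01,\ 03,\ 04,\ 12,\ 16,\ 23,\ 24,\ 25,\ 36,\ 37,\ 45,\ 47,\ 56,\ 67$ - $F_{21}$ (8 vertices): $01,\ 03,\ 04,\ 05,\ 12,\ 16,\ 23,\ 24,\ 25,\ 36,\ 37,\ 45,\ 47,\ 56,\ 67$ - $F_{22}$ (8 vertices): $01,\ 02,\ 04,\ 06,\ 13,\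 15,\ 16,\ 23,\ 27,\ 34,\ 37,\ 45,\ 47,\ 57,\ 67$ A graph is *$\mathcal F$-free* if none of its induced subgraphs is isomorphic to a member of $\mathcal F$. A *minimal counterexample* to the conjecture "a graph is b-perfect if and only if it is $\mathcal F$-free" is a b-imperfect $\mathcal F$-free graph that has the smallest number of vertices among all b-imperfect $\mathcal F$-free graphs and, among those with that number of vertices, the smallest number of edges. **Theorem.** Let $G$ be a minimal counterexample to this conjecture. Then $G$ contains no $C_5$, that is, no induced subgraph of $G$ is a chordless cycle on five vertices. -/

import Mathlib

namespace BPerfect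

universe u

section Coloring

variable {V : Type u} (G : SimpleGraph V)

/-- A vertex `v` is a b-vertex of the proper coloring `c` if it has a neighbor in every color
class other than its own. -/
def IsBVertex {G : SimpleGraph V} {k : ℕ} (c : G.Coloring (Fin k)) (v : V) : Prop :=
  ∀ j : Fin k, j ≠ c v → ∃ w, G.Adj v w ∧ c w = j

/-- A b-coloring with `k` colors: a proper coloring in which each of the `k` colors has a
b-vertex (in particular each of the `k` colors is used). -/
def IsBColoring {G : SimpleGraph V} {k : ℕ} (c : G.Coloring (Fin k)) : Prop :=
  ∀ i : Fin k, ∃ v, c v = i ∧ IsBVertex c v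

/-- `G` admits a b-coloring with exactly `k` colors. -/
def HasBColoring (k : ℕ) : Prop := ∃ c : G.Coloring (Fin k), IsBColoring c

/-- The b-chromatic number: the largest `k` such that `G` has a b-coloring with `k` colors. -/
noncomputable def bChromaticNumber : ℕ∞ := ⨆ k ∈ {k : ℕ | HasBColoring G k}, (k : ℕ∞)

/-- `G` is b-perfect if every induced subgraph `H` satisfies `χ(H) = b(H)`. -/
def IsBPerfect : Prop :=
  ∀ s : Set V, (G.induce s).chromaticNumber = bChromaticNumber (G.induce s)

end Coloring

/-! The forbidden graphs `F₁, …, F₂₂`. -/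

/-- The graph on `Fin n` whose edges are the listed pairs. -/
def ofEdges (n : ℕ) (l : List (Fin n × Fin n)) : SimpleGraph (Fin n) :=
  SimpleGraph.fromRel fun i j => (i, j) ∈ l

def F1 : SimpleGraph (Fin 5) := ofEdges 5
  [(0, 3), (1, 3), (1, 4), (2, 4)]

def F2 : SimpleGraph (Fin 7) := ofEdges 7
  [(0, 4), (1, 4), (2, 5), (3, 6), (5, 6)]

def F3 : SimpleGraph (Fin 9) := ofEdges 9
  [(0, 6), (1, 7), (2, 8), (3, 6), (4, 7), (5, 8)]

def F4 : SimpleGraph (Fin 6) := ofEdges 6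
  [(0, 1), (0, 2), (0, 3), (0, 4), (1, 3), (1, 5), (2, 3), (2, 4), (3, 5)]

def F5 : SimpleGraph (Fin 7) := ofEdges 7
  [(0, 2), (0, 3), (0, 5), (1, 3), (1, 4), (2, 5), (3, 4), (3, 5), (3, 6),
   (4, 6)]

def F6 : SimpleGraph (Fin 8) := ofEdges 8
  [(0, 2), (0, 4), (1, 3), (1, 5), (2, 4), (2, 6), (3, 5), (3, 7), (4, 6),
   (5, 7)]

def F7 : SimpleGraph (Fin 8) := ofEdges 8
  [(0, 2), (0, 4), (1, 3), (1, 5), (2, 4), (2, 6), (3, 4), (3, 5), (3, 7),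
   (4, 6), (5, 7)]

def F8 : SimpleGraph (Fin 8) := ofEdges 8
  [(0, 1), (0, 4), (1, 2), (1, 4), (2, 3), (2, 4), (3, 4), (4, 5), (5, 6),
   (5, 7), (6, 7)]

def F9 : SimpleGraph (Fin 10) := ofEdges 10
  [(0, 1), (0, 6), (1, 2), (1, 6), (2, 6), (3, 4), (3, 6), (4, 5), (4, 6),
   (5, 6), (6, 7), (7, 8), (7, 9), (8, 9)]

def F10 : SimpleGraph (Fin 6) := ofEdges 6
  [(0, 1), (0, 2), (0, 4), (1, 3), (1, 5), (2, 3), (2, 4), (2, 5), (3, 5),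
   (4, 5)]

def F11 : SimpleGraph (Fin 7) := ofEdges 7
  [(0, 2), (0, 3), (0, 5), (1, 2), (1, 3), (1, 4), (2, 5), (2, 6), (3, 4),
   (3, 5), (3, 6), (4, 6)]

def F12 : SimpleGraph (Fin 8) := ofEdges 8
  [(0, 1), (0, 5), (1, 2), (1, 4), (1, 5), (2, 3), (2, 6), (2, 7), (3, 6),
   (4, 5), (5, 6), (6, 7)]

def F13 : SimpleGraph (Fin 8) := ofEdges 8
  [(0, 1), (0, 4), (0, 5), (1, 2), (1, 4), (1, 6), (2, 3), (2, 5), (2, 7),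
   (3, 6), (3, 7), (4, 5), (5, 6), (6, 7)]

def F14 : SimpleGraph (Fin 8) := ofEdges 8
  [(0, 1), (0, 4), (0, 6), (1, 2), (1, 5), (1, 6), (2, 3), (2, 4), (2, 7),
   (3, 5), (3, 7), (4, 5), (4, 6), (5, 7), (6, 7)]

def F15 : SimpleGraph (Fin 8) := ofEdges 8
  [(0, 1), (0, 2), (0, 4), (0, 6), (1, 3), (1, 5), (1, 7), (2, 3), (2, 5),
   (2, 6), (3, 4), (3, 7), (4, 5), (4, 6), (5, 7), (6, 7)]

def F16 : SimpleGraph (Fin 6) := ofEdges 6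
  [(0, 1), (0, 2), (1, 3), (2, 4), (2, 5), (3, 4), (3, 5), (4, 5)]

def F17 : SimpleGraph (Fin 6) := ofEdges 6
  [(0, 1), (0, 2), (1, 3), (1, 4), (2, 4), (2, 5), (3, 4), (3, 5), (4, 5)]

def F18 : SimpleGraph (Fin 8) := ofEdges 8
  [(0, 1), (0, 2), (0, 4), (1, 3), (1, 6), (2, 4), (2, 5), (2, 6), (3, 4),
   (3, 5), (3, 6), (4, 7), (6, 7)]

def F19 : SimpleGraph (Fin 8) := ofEdges 8
  [(0, 1), (0, 2), (0, 4), (1, 3), (1, 5), (2, 3), (2, 6), (2, 7), (3, 6),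
   (3, 7), (4, 6), (4, 7), (5, 6), (5, 7)]

def F20 : SimpleGraph (Fin 8) := ofEdges 8
  [(0, 1), (0, 3), (0, 4), (1, 2), (1, 6), (2, 3), (2, 4), (2, 5), (3, 6),
   (3, 7), (4, 5), (4, 7), (5, 6), (6, 7)]

def F21 : SimpleGraph (Fin 8) := ofEdges 8
  [(0, 1), (0, 3), (0, 4), (0, 5), (1, 2), (1, 6), (2, 3), (2, 4), (2, 5),
   (3, 6), (3, 7), (4, 5), (4, 7), (5, 6), (6, 7)]

def F22 : SimpleGraph (Fin 8) := ofEdges 8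
  [(0, 1), (0, 2), (0, 4), (0, 6), (1, 3), (1, 5), (1, 6), (2, 3), (2, 7),
   (3, 4), (3, 7), (4, 5), (4, 7), (5, 7), (6, 7)]

/-- The family `𝓕 = {F₁, …, F₂₂}`. -/
def family : List (Σ n : ℕ, SimpleGraph (Fin n)) :=
  [⟨5, F1⟩, ⟨7, F2⟩, ⟨9, F3⟩, ⟨6, F4⟩, ⟨7, F5⟩, ⟨8, F6⟩, ⟨8, F7⟩,
   ⟨8, F8⟩, ⟨10, F9⟩, ⟨6, F10⟩, ⟨7, F11⟩, ⟨8, F12⟩, ⟨8, F13⟩, ⟨8, F14⟩,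
   ⟨8, F15⟩, ⟨6, F16⟩, ⟨6, F17⟩, ⟨8, F18⟩, ⟨8, F19⟩, ⟨8, F20⟩, ⟨8, F21⟩,
   ⟨8, F22⟩]

/-- `G` is `𝓕`-free: no member of `𝓕` is isomorphic to an induced subgraph of `G`. -/
def IsFamilyFree {V : Type u} (G : SimpleGraph V) : Prop :=
  ∀ F ∈ family, ¬ F.2.IsIndContained G

/-- A counterexample to "a graph is b-perfect if and only if it is `𝓕`-free": an `𝓕`-free graph
that is not b-perfect. -/
def IsCounterexample {V : Type u} (G : SimpleGraph V) : Prop :=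
  IsFamilyFree G ∧ ¬ IsBPerfect G

/-- A counterexample with the smallest number of vertices among all finite counterexamples and,
among those, with the smallest number of edges. -/
def IsMinimalCounterexample {V : Type u} (G : SimpleGraph V) : Prop :=
  IsCounterexample G ∧
    ∀ (W : Type u) [Finite W] (H : SimpleGraph W), IsCounterexample H →
      Nat.card V < Nat.card W ∨
        (Nat.card V = Nat.card W ∧ Nat.card G.edgeSet ≤ Nat.card H.edgeSet)

end BPerfect

/-! ### Forbidden induced subgraphs as adjacency patterns. -/

namespace BPerfect

universe u

variable {V : Type u} {G : SimpleGraph V}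

/-! Suppose that a minimal counterexample has a chordless 5-cycle `c`. Forbidding `F1` (the path
P5), `F16` and `F17` leaves four kinds of vertices: bags (copies of cycle vertices), ears (adjacent
to `c i` and the two ends of the opposite edge), hubs (complete to the cycle) and far vertices
(anticomplete to it). Further members of the family fix almost all adjacencies between these
classes. The cycle is chosen with the most ears (`Frame`); an exchange argument
(`bag_one_bag_three`) then shows that nonconsecutive bags are anticomplete.

Minimality supplies a proper coloring with `m` colors and a b-coloring with `k > m` colors. A proper
induced subgraph is still `m`-colorable, so it cannot inherit the b-coloring with all `k` colors;
and `k ≥ 4` because a 5-cycle needs three colors. This is all that `Critical` records. Its main tool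
is `ne_and_not_seesAll`: a vertex whose neighborhood lies in that of a nonneighbor is no b-vertex.
Together with `far_of_seesAll`, which restricts far b-vertices, it confines the b-vertices to a few
places.

Two consecutive ear positions exclude every other position, and so do two positions at distance two.
Up to rotation and reflection there remain: no ear, ears at `c 0` only, ears at `c 0` and `c 1`,
ears at `c 0` and `c 2`. In each case either at most three colors have b-vertices, or a proper
induced subgraph inherits the b-coloring.

Some of these cases need hubs and far vertices to be absent. If no ear has a far neighbor, bags and
ears together form a module `N`, since hubs are complete and far vertices anticomplete to it. By
`eq_univ_of_module`, a proper such module could be replaced by a clique with one vertex for each of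
its b-colors, giving a smaller counterexample; hence `N` is everything. -/

instance decidableRelOfEdges (n : ℕ) (l : List (Fin n × Fin n)) :
    DecidableRel (ofEdges n l).Adj := by
  unfold ofEdges; infer_instance

instance : DecidableRel F1.Adj := by unfold F1; infer_instance
instance : DecidableRel F2.Adj := by unfold F2; infer_instance
instance : DecidableRel F3.Adj := by unfold F3; infer_instance
instance : DecidableRel F4.Adj := by unfold F4; infer_instance
instance : DecidableRel F5.Adj := by unfold F5; infer_instance
instance : DecidableRel F6.Adj := by unfold F6; infer_instance
instance : DecidableRel F7.Adj := by unfold F7; infer_instance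
instance : DecidableRel F8.Adj := by unfold F8; infer_instance
instance : DecidableRel F9.Adj := by unfold F9; infer_instance
instance : DecidableRel F10.Adj := by unfold F10; infer_instance
instance : DecidableRel F11.Adj := by unfold F11; infer_instance
instance : DecidableRel F12.Adj := by unfold F12; infer_instance
instance : DecidableRel F13.Adj := by unfold F13; infer_instance
instance : DecidableRel F14.Adj := by unfold F14; infer_instance
instance : DecidableRel F15.Adj := by unfold F15; infer_instance
instance : DecidableRel F16.Adj := by unfold F16; infer_instance
instance : DecidableRel F17.Adj := by unfold F17; infer_instance
instance : DecidableRel F18.Adj := by unfold F18; infer_instance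
instance : DecidableRel F19.Adj := by unfold F19; infer_instance
instance : DecidableRel F20.Adj := by unfold F20; infer_instance
instance : DecidableRel F21.Adj := by unfold F21; infer_instance
instance : DecidableRel F22.Adj := by unfold F22; infer_instance

/-- A map into an `𝓕`-free graph cannot preserve and reflect the adjacency of a member of `𝓕`,
provided that it separates the false twins of that member. -/
theorem IsFamilyFree.false_of_map (h : IsFamilyFree G) {n : ℕ} {F : SimpleGraph (Fin n)}
    (hF : (⟨n, F⟩ : Σ n : ℕ, SimpleGraph (Fin n)) ∈ family) (f : Fin n → V)
    (hadj : ∀ p q, p < q → (G.Adj (f p) (f q) ↔ F.Adj p q))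
    (htwin : ∀ p q, p < q → (∀ r, F.Adj p r ↔ F.Adj q r) → f p ≠ f q) : False := by
  have hadj' : ∀ p q, G.Adj (f p) (f q) ↔ F.Adj p q := by
    intro p q
    rcases lt_trichotomy p q with hpq | rfl | hpq
    · exact hadj p q hpq
    · simp
    · rw [G.adj_comm, F.adj_comm]; exact hadj q p hpq
  have hne : ∀ p q, p < q → f p ≠ f q := fun p q hpq hf =>
    htwin p q hpq (fun r => by rw [← hadj', ← hadj', hf]) hf
  refine h ⟨n, F⟩ hF ⟨⟨⟨f, fun p q hpq => ?_⟩, hadj' _ _⟩⟩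
  rcases lt_trichotomy p q with hlt | heq | hlt
  · exact absurd hpq (hne p q hlt)
  · exact heq
  · exact absurd hpq.symm (hne q p hlt)

/-- `F1` is the path P5, here `a d b e c`. This lemma and its analogues turn a forbidden subgraph
into a propositional statement about adjacency, so that case analyses can be left to `grind`.
Inequalities appear only for false twins; every other pair is separated by the pattern itself. -/
theorem F1_elim (h : IsFamilyFree G) (a b c d e : V) :
    ¬ (¬ G.Adj a b ∧ ¬ G.Adj a c ∧ G.Adj a d ∧ ¬ G.Adj a e ∧ ¬ G.Adj b c ∧ G.Adj b d ∧
      G.Adj b e ∧ ¬ G.Adj c d ∧ G.Adj c e ∧ ¬ G.Adj d e) := by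
  intro H
  refine h.false_of_map (F := F1) (by simp [family]) ![a, b, c, d, e] (fun p q hpq => ?_)
    (fun p q hpq hk => ?_)
  · fin_cases p <;> fin_cases q <;> first
    | exact absurd hpq (by decide)
    | exact iff_of_true (by simp [H]) (by decide)
    | exact iff_of_false (by simp [H]) (by decide)
  · exact absurd hk ((by decide +kernel : ∀ p q : Fin 5, p < q → ¬ ∀ r, (F1.Adj p r ↔ F1.Adj q r))
    p q hpq)

theorem F2_elim (h : IsFamilyFree G) (a b c d e f g : V) :
    ¬ (¬ G.Adj a b ∧ ¬ G.Adj a c ∧ ¬ G.Adj a d ∧ G.Adj a e ∧ ¬ G.Adj a f ∧ ¬ G.Adj a g ∧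
      ¬ G.Adj b c ∧ ¬ G.Adj b d ∧ G.Adj b e ∧ ¬ G.Adj b f ∧ ¬ G.Adj b g ∧ ¬ G.Adj c d ∧
      ¬ G.Adj c e ∧ G.Adj c f ∧ ¬ G.Adj c g ∧ ¬ G.Adj d e ∧ ¬ G.Adj d f ∧ G.Adj d g ∧
      ¬ G.Adj e f ∧ ¬ G.Adj e g ∧ G.Adj f g ∧ a ≠ b) := by
  intro H
  refine h.false_of_map (F := F2) (by simp [family]) ![a, b, c, d, e, f, g] (fun p q hpq => ?_)
    (fun p q hpq hk => ?_)
  · fin_cases p <;> fin_cases q <;> first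
    | exact absurd hpq (by decide)
    | exact iff_of_true (by simp [H]) (by decide)
    | exact iff_of_false (by simp [H]) (by decide)
  · obtain ⟨rfl, rfl⟩ := (by decide +kernel : ∀ p q : Fin 7, p < q →
      (∀ r, (F2.Adj p r ↔ F2.Adj q r)) → (p = 0 ∧ q = 1)) p q hpq hk
    simp [H]

theorem F4_elim (h : IsFamilyFree G) (a b c d e f : V) :
    ¬ (G.Adj a b ∧ G.Adj a c ∧ G.Adj a d ∧ G.Adj a e ∧ ¬ G.Adj a f ∧ ¬ G.Adj b c ∧ G.Adj b d ∧
      ¬ G.Adj b e ∧ G.Adj b f ∧ G.Adj c d ∧ G.Adj c e ∧ ¬ G.Adj c f ∧ ¬ G.Adj d e ∧ G.Adj d f ∧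
      ¬ G.Adj e f) := by
  intro H
  refine h.false_of_map (F := F4) (by simp [family]) ![a, b, c, d, e, f] (fun p q hpq => ?_)
    (fun p q hpq hk => ?_)
  · fin_cases p <;> fin_cases q <;> first
    | exact absurd hpq (by decide)
    | exact iff_of_true (by simp [H]) (by decide)
    | exact iff_of_false (by simp [H]) (by decide)
  · exact absurd hk ((by decide +kernel : ∀ p q : Fin 6, p < q → ¬ ∀ r, (F4.Adj p r ↔ F4.Adj q r))
    p q hpq)

theorem F5_elim (h : IsFamilyFree G) (a b c d e f g : V) :
    ¬ (¬ G.Adj a b ∧ G.Adj a c ∧ G.Adj a d ∧ ¬ G.Adj a e ∧ G.Adj a f ∧ ¬ G.Adj a g ∧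
      ¬ G.Adj b c ∧ G.Adj b d ∧ G.Adj b e ∧ ¬ G.Adj b f ∧ ¬ G.Adj b g ∧ ¬ G.Adj c d ∧
      ¬ G.Adj c e ∧ G.Adj c f ∧ ¬ G.Adj c g ∧ G.Adj d e ∧ G.Adj d f ∧ G.Adj d g ∧ ¬ G.Adj e f ∧
      G.Adj e g ∧ ¬ G.Adj f g ∧ b ≠ g) := by
  intro H
  refine h.false_of_map (F := F5) (by simp [family]) ![a, b, c, d, e, f, g] (fun p q hpq => ?_)
    (fun p q hpq hk => ?_)
  · fin_cases p <;> fin_cases q <;> first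
    | exact absurd hpq (by decide)
    | exact iff_of_true (by simp [H]) (by decide)
    | exact iff_of_false (by simp [H]) (by decide)
  · obtain ⟨rfl, rfl⟩ := (by decide +kernel : ∀ p q : Fin 7, p < q →
      (∀ r, (F5.Adj p r ↔ F5.Adj q r)) → (p = 1 ∧ q = 6)) p q hpq hk
    simp [H]

theorem F8_elim (h : IsFamilyFree G) (a b c d e f g i : V) :
    ¬ (G.Adj a b ∧ ¬ G.Adj a c ∧ ¬ G.Adj a d ∧ G.Adj a e ∧ ¬ G.Adj a f ∧ ¬ G.Adj a g ∧
      ¬ G.Adj a i ∧ G.Adj b c ∧ ¬ G.Adj b d ∧ G.Adj b e ∧ ¬ G.Adj b f ∧ ¬ G.Adj b g ∧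
      ¬ G.Adj b i ∧ G.Adj c d ∧ G.Adj c e ∧ ¬ G.Adj c f ∧ ¬ G.Adj c g ∧ ¬ G.Adj c i ∧ G.Adj d e ∧
      ¬ G.Adj d f ∧ ¬ G.Adj d g ∧ ¬ G.Adj d i ∧ G.Adj e f ∧ ¬ G.Adj e g ∧ ¬ G.Adj e i ∧
      G.Adj f g ∧ G.Adj f i ∧ G.Adj g i) := by
  intro H
  refine h.false_of_map (F := F8) (by simp [family]) ![a, b, c, d, e, f, g, i] (fun p q hpq => ?_)
    (fun p q hpq hk => ?_)
  · fin_cases p <;> fin_cases q <;> first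
    | exact absurd hpq (by decide)
    | exact iff_of_true (by simp [H]) (by decide)
    | exact iff_of_false (by simp [H]) (by decide)
  · exact absurd hk ((by decide +kernel : ∀ p q : Fin 8, p < q → ¬ ∀ r, (F8.Adj p r ↔ F8.Adj q r))
    p q hpq)

theorem F10_elim (h : IsFamilyFree G) (a b c d e f : V) :
    ¬ (G.Adj a b ∧ G.Adj a c ∧ ¬ G.Adj a d ∧ G.Adj a e ∧ ¬ G.Adj a f ∧ ¬ G.Adj b c ∧ G.Adj b d ∧
      ¬ G.Adj b e ∧ G.Adj b f ∧ G.Adj c d ∧ G.Adj c e ∧ G.Adj c f ∧ ¬ G.Adj d e ∧ G.Adj d f ∧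
      G.Adj e f) := by
  intro H
  refine h.false_of_map (F := F10) (by simp [family]) ![a, b, c, d, e, f] (fun p q hpq => ?_)
    (fun p q hpq hk => ?_)
  · fin_cases p <;> fin_cases q <;> first
    | exact absurd hpq (by decide)
    | exact iff_of_true (by simp [H]) (by decide)
    | exact iff_of_false (by simp [H]) (by decide)
  · exact absurd hk ((by decide +kernel : ∀ p q : Fin 6, p < q → ¬ ∀ r, (F10.Adj p r ↔ F10.Adj q r))
    p q hpq)

theorem F11_elim (h : IsFamilyFree G) (a b c d e f g : V) :
    ¬ (¬ G.Adj a b ∧ G.Adj a c ∧ G.Adj a d ∧ ¬ G.Adj a e ∧ G.Adj a f ∧ ¬ G.Adj a g ∧ G.Adj b c ∧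
      G.Adj b d ∧ G.Adj b e ∧ ¬ G.Adj b f ∧ ¬ G.Adj b g ∧ ¬ G.Adj c d ∧ ¬ G.Adj c e ∧ G.Adj c f ∧
      G.Adj c g ∧ G.Adj d e ∧ G.Adj d f ∧ G.Adj d g ∧ ¬ G.Adj e f ∧ G.Adj e g ∧ ¬ G.Adj f g ∧
      b ≠ g) := by
  intro H
  refine h.false_of_map (F := F11) (by simp [family]) ![a, b, c, d, e, f, g] (fun p q hpq => ?_)
    (fun p q hpq hk => ?_)
  · fin_cases p <;> fin_cases q <;> first
    | exact absurd hpq (by decide)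
    | exact iff_of_true (by simp [H]) (by decide)
    | exact iff_of_false (by simp [H]) (by decide)
  · obtain ⟨rfl, rfl⟩ := (by decide +kernel : ∀ p q : Fin 7, p < q →
      (∀ r, (F11.Adj p r ↔ F11.Adj q r)) → (p = 1 ∧ q = 6)) p q hpq hk
    simp [H]

theorem F13_elim (h : IsFamilyFree G) (a b c d e f g i : V) :
    ¬ (G.Adj a b ∧ ¬ G.Adj a c ∧ ¬ G.Adj a d ∧ G.Adj a e ∧ G.Adj a f ∧ ¬ G.Adj a g ∧
      ¬ G.Adj a i ∧ G.Adj b c ∧ ¬ G.Adj b d ∧ G.Adj b e ∧ ¬ G.Adj b f ∧ G.Adj b g ∧ ¬ G.Adj b i ∧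
      G.Adj c d ∧ ¬ G.Adj c e ∧ G.Adj c f ∧ ¬ G.Adj c g ∧ G.Adj c i ∧ ¬ G.Adj d e ∧ ¬ G.Adj d f ∧
      G.Adj d g ∧ G.Adj d i ∧ G.Adj e f ∧ ¬ G.Adj e g ∧ ¬ G.Adj e i ∧ G.Adj f g ∧ ¬ G.Adj f i ∧
      G.Adj g i ∧ b ≠ f ∧ c ≠ g) := by
  intro H
  refine h.false_of_map (F := F13) (by simp [family]) ![a, b, c, d, e, f, g, i] (fun p q hpq => ?_)
    (fun p q hpq hk => ?_)
  · fin_cases p <;> fin_cases q <;> first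
    | exact absurd hpq (by decide)
    | exact iff_of_true (by simp [H]) (by decide)
    | exact iff_of_false (by simp [H]) (by decide)
  · obtain ⟨rfl, rfl⟩ | ⟨rfl, rfl⟩ := (by decide +kernel : ∀ p q : Fin 8, p < q →
      (∀ r, (F13.Adj p r ↔ F13.Adj q r)) → (p = 1 ∧ q = 5) ∨
          (p = 2 ∧ q = 6)) p q hpq hk <;> simp [H]

theorem F16_elim (h : IsFamilyFree G) (a b c d e f : V) :
    ¬ (G.Adj a b ∧ G.Adj a c ∧ ¬ G.Adj a d ∧ ¬ G.Adj a e ∧ ¬ G.Adj a f ∧ ¬ G.Adj b c ∧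
      G.Adj b d ∧ ¬ G.Adj b e ∧ ¬ G.Adj b f ∧ ¬ G.Adj c d ∧ G.Adj c e ∧ G.Adj c f ∧ G.Adj d e ∧
      G.Adj d f ∧ G.Adj e f) := by
  intro H
  refine h.false_of_map (F := F16) (by simp [family]) ![a, b, c, d, e, f] (fun p q hpq => ?_)
    (fun p q hpq hk => ?_)
  · fin_cases p <;> fin_cases q <;> first
    | exact absurd hpq (by decide)
    | exact iff_of_true (by simp [H]) (by decide)
    | exact iff_of_false (by simp [H]) (by decide)
  · exact absurd hk ((by decide +kernel : ∀ p q : Fin 6, p < q → ¬ ∀ r, (F16.Adj p r ↔ F16.Adj q r))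
    p q hpq)

theorem F17_elim (h : IsFamilyFree G) (a b c d e f : V) :
    ¬ (G.Adj a b ∧ G.Adj a c ∧ ¬ G.Adj a d ∧ ¬ G.Adj a e ∧ ¬ G.Adj a f ∧ ¬ G.Adj b c ∧
      G.Adj b d ∧ G.Adj b e ∧ ¬ G.Adj b f ∧ ¬ G.Adj c d ∧ G.Adj c e ∧ G.Adj c f ∧ G.Adj d e ∧
      G.Adj d f ∧ G.Adj e f) := by
  intro H
  refine h.false_of_map (F := F17) (by simp [family]) ![a, b, c, d, e, f] (fun p q hpq => ?_)
    (fun p q hpq hk => ?_)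
  · fin_cases p <;> fin_cases q <;> first
    | exact absurd hpq (by decide)
    | exact iff_of_true (by simp [H]) (by decide)
    | exact iff_of_false (by simp [H]) (by decide)
  · exact absurd hk ((by decide +kernel : ∀ p q : Fin 6, p < q → ¬ ∀ r, (F17.Adj p r ↔ F17.Adj q r))
    p q hpq)

theorem F18_elim (h : IsFamilyFree G) (a b c d e f g i : V) :
    ¬ (G.Adj a b ∧ G.Adj a c ∧ ¬ G.Adj a d ∧ G.Adj a e ∧ ¬ G.Adj a f ∧ ¬ G.Adj a g ∧
      ¬ G.Adj a i ∧ ¬ G.Adj b c ∧ G.Adj b d ∧ ¬ G.Adj b e ∧ ¬ G.Adj b f ∧ G.Adj b g ∧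
      ¬ G.Adj b i ∧ ¬ G.Adj c d ∧ G.Adj c e ∧ G.Adj c f ∧ G.Adj c g ∧ ¬ G.Adj c i ∧ G.Adj d e ∧
      G.Adj d f ∧ G.Adj d g ∧ ¬ G.Adj d i ∧ ¬ G.Adj e f ∧ ¬ G.Adj e g ∧ G.Adj e i ∧ ¬ G.Adj f g ∧
      ¬ G.Adj f i ∧ G.Adj g i) := by
  intro H
  refine h.false_of_map (F := F18) (by simp [family]) ![a, b, c, d, e, f, g, i] (fun p q hpq => ?_)
    (fun p q hpq hk => ?_)
  · fin_cases p <;> fin_cases q <;> first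
    | exact absurd hpq (by decide)
    | exact iff_of_true (by simp [H]) (by decide)
    | exact iff_of_false (by simp [H]) (by decide)
  · exact absurd hk ((by decide +kernel : ∀ p q : Fin 8, p < q → ¬ ∀ r, (F18.Adj p r ↔ F18.Adj q r))
    p q hpq)

theorem F19_elim (h : IsFamilyFree G) (a b c d e f g i : V) :
    ¬ (G.Adj a b ∧ G.Adj a c ∧ ¬ G.Adj a d ∧ G.Adj a e ∧ ¬ G.Adj a f ∧ ¬ G.Adj a g ∧
      ¬ G.Adj a i ∧ ¬ G.Adj b c ∧ G.Adj b d ∧ ¬ G.Adj b e ∧ G.Adj b f ∧ ¬ G.Adj b g ∧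
      ¬ G.Adj b i ∧ G.Adj c d ∧ ¬ G.Adj c e ∧ ¬ G.Adj c f ∧ G.Adj c g ∧ G.Adj c i ∧ ¬ G.Adj d e ∧
      ¬ G.Adj d f ∧ G.Adj d g ∧ G.Adj d i ∧ ¬ G.Adj e f ∧ G.Adj e g ∧ G.Adj e i ∧ G.Adj f g ∧
      G.Adj f i ∧ ¬ G.Adj g i ∧ g ≠ i) := by
  intro H
  refine h.false_of_map (F := F19) (by simp [family]) ![a, b, c, d, e, f, g, i] (fun p q hpq => ?_)
    (fun p q hpq hk => ?_)
  · fin_cases p <;> fin_cases q <;> first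
    | exact absurd hpq (by decide)
    | exact iff_of_true (by simp [H]) (by decide)
    | exact iff_of_false (by simp [H]) (by decide)
  · obtain ⟨rfl, rfl⟩ := (by decide +kernel : ∀ p q : Fin 8, p < q →
      (∀ r, (F19.Adj p r ↔ F19.Adj q r)) → (p = 6 ∧ q = 7)) p q hpq hk
    simp [H]

theorem F20_elim (h : IsFamilyFree G) (a b c d e f g i : V) :
    ¬ (G.Adj a b ∧ ¬ G.Adj a c ∧ G.Adj a d ∧ G.Adj a e ∧ ¬ G.Adj a f ∧ ¬ G.Adj a g ∧
      ¬ G.Adj a i ∧ G.Adj b c ∧ ¬ G.Adj b d ∧ ¬ G.Adj b e ∧ ¬ G.Adj b f ∧ G.Adj b g ∧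
      ¬ G.Adj b i ∧ G.Adj c d ∧ G.Adj c e ∧ G.Adj c f ∧ ¬ G.Adj c g ∧ ¬ G.Adj c i ∧ ¬ G.Adj d e ∧
      ¬ G.Adj d f ∧ G.Adj d g ∧ G.Adj d i ∧ G.Adj e f ∧ ¬ G.Adj e g ∧ G.Adj e i ∧ G.Adj f g ∧
      ¬ G.Adj f i ∧ G.Adj g i) := by
  intro H
  refine h.false_of_map (F := F20) (by simp [family]) ![a, b, c, d, e, f, g, i] (fun p q hpq => ?_)
    (fun p q hpq hk => ?_)
  · fin_cases p <;> fin_cases q <;> first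
    | exact absurd hpq (by decide)
    | exact iff_of_true (by simp [H]) (by decide)
    | exact iff_of_false (by simp [H]) (by decide)
  · exact absurd hk ((by decide +kernel : ∀ p q : Fin 8, p < q → ¬ ∀ r, (F20.Adj p r ↔ F20.Adj q r))
    p q hpq)

theorem F21_elim (h : IsFamilyFree G) (a b c d e f g i : V) :
    ¬ (G.Adj a b ∧ ¬ G.Adj a c ∧ G.Adj a d ∧ G.Adj a e ∧ G.Adj a f ∧ ¬ G.Adj a g ∧ ¬ G.Adj a i ∧
      G.Adj b c ∧ ¬ G.Adj b d ∧ ¬ G.Adj b e ∧ ¬ G.Adj b f ∧ G.Adj b g ∧ ¬ G.Adj b i ∧ G.Adj c d ∧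
      G.Adj c e ∧ G.Adj c f ∧ ¬ G.Adj c g ∧ ¬ G.Adj c i ∧ ¬ G.Adj d e ∧ ¬ G.Adj d f ∧ G.Adj d g ∧
      G.Adj d i ∧ G.Adj e f ∧ ¬ G.Adj e g ∧ G.Adj e i ∧ G.Adj f g ∧ ¬ G.Adj f i ∧ G.Adj g i ∧
      a ≠ c) := by
  intro H
  refine h.false_of_map (F := F21) (by simp [family]) ![a, b, c, d, e, f, g, i] (fun p q hpq => ?_)
    (fun p q hpq hk => ?_)
  · fin_cases p <;> fin_cases q <;> first
    | exact absurd hpq (by decide)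
    | exact iff_of_true (by simp [H]) (by decide)
    | exact iff_of_false (by simp [H]) (by decide)
  · obtain ⟨rfl, rfl⟩ := (by decide +kernel : ∀ p q : Fin 8, p < q →
      (∀ r, (F21.Adj p r ↔ F21.Adj q r)) → (p = 0 ∧ q = 2)) p q hpq hk
    simp [H]

theorem F22_elim (h : IsFamilyFree G) (a b c d e f g i : V) :
    ¬ (G.Adj a b ∧ G.Adj a c ∧ ¬ G.Adj a d ∧ G.Adj a e ∧ ¬ G.Adj a f ∧ G.Adj a g ∧ ¬ G.Adj a i ∧
      ¬ G.Adj b c ∧ G.Adj b d ∧ ¬ G.Adj b e ∧ G.Adj b f ∧ G.Adj b g ∧ ¬ G.Adj b i ∧ G.Adj c d ∧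
      ¬ G.Adj c e ∧ ¬ G.Adj c f ∧ ¬ G.Adj c g ∧ G.Adj c i ∧ G.Adj d e ∧ ¬ G.Adj d f ∧
      ¬ G.Adj d g ∧ G.Adj d i ∧ G.Adj e f ∧ ¬ G.Adj e g ∧ G.Adj e i ∧ ¬ G.Adj f g ∧ G.Adj f i ∧
      G.Adj g i) := by
  intro H
  refine h.false_of_map (F := F22) (by simp [family]) ![a, b, c, d, e, f, g, i] (fun p q hpq => ?_)
    (fun p q hpq hk => ?_)
  · fin_cases p <;> fin_cases q <;> first
    | exact absurd hpq (by decide)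
    | exact iff_of_true (by simp [H]) (by decide)
    | exact iff_of_false (by simp [H]) (by decide)
  · exact absurd hk ((by decide +kernel : ∀ p q : Fin 8, p < q → ¬ ∀ r, (F22.Adj p r ↔ F22.Adj q r))
    p q hpq)

end BPerfect

/-! ### Vertices around a chordless 5-cycle. -/

namespace BPerfect

universe u

variable {V : Type u} {G : SimpleGraph V}

/-- The five vertices `c 0, …, c 4` induce a chordless cycle, in this order. -/
def IsC5 (G : SimpleGraph V) (c : Fin 5 → V) : Prop :=
  ∀ i, G.Adj (c i) (c (i + 1)) ∧ ¬ G.Adj (c i) (c (i + 2))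

/-- The vertices attached to the cycle like `c i`, among them `c i` itself. -/
def Bag (G : SimpleGraph V) (c : Fin 5 → V) (i : Fin 5) (v : V) : Prop :=
  G.Adj v (c (i + 1)) ∧ G.Adj v (c (i + 4)) ∧ ¬ G.Adj v (c i) ∧ ¬ G.Adj v (c (i + 2)) ∧
    ¬ G.Adj v (c (i + 3))

/-- The vertices adjacent exactly to `c i` and to the two ends of the opposite edge. -/
def Ear (G : SimpleGraph V) (c : Fin 5 → V) (i : Fin 5) (v : V) : Prop :=
  G.Adj v (c i) ∧ G.Adj v (c (i + 2)) ∧ G.Adj v (c (i + 3)) ∧ ¬ G.Adj v (c (i + 1)) ∧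
    ¬ G.Adj v (c (i + 4))

/-- The vertices adjacent to the whole cycle. -/
def Hub (G : SimpleGraph V) (c : Fin 5 → V) (v : V) : Prop := ∀ i, G.Adj v (c i)

/-- The vertices with no neighbor on the cycle. -/
def Far (G : SimpleGraph V) (c : Fin 5 → V) (v : V) : Prop := ∀ i, ¬ G.Adj v (c i)

/-- The cycle `c`, started at `c i`. -/
def rot (c : Fin 5 → V) (i : Fin 5) : Fin 5 → V := fun j => c (i + j)

/-- The cycle `c`, traversed backwards from `c 0`. -/
def rev (c : Fin 5 → V) : Fin 5 → V := fun j => c (-j)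

variable {c : Fin 5 → V} {i j : Fin 5} {u v w x y z o p q d s t : V}

theorem IsC5.rot (hc : IsC5 G c) (i : Fin 5) : IsC5 G (rot c i) := fun j => by
  simpa [BPerfect.rot, add_assoc] using hc (i + j)

theorem IsC5.rev (hc : IsC5 G c) : IsC5 G (rev c) := fun j => by
  have h1 := hc (-(j + 1))
  have h2 := hc (-(j + 2))
  have e1 : ∀ j : Fin 5, -(j + 1) + 1 = -j := by decide
  have e2 : ∀ j : Fin 5, -(j + 2) + 2 = -j := by decide
  rw [e1] at h1
  rw [e2] at h2
  exact ⟨h1.1.symm, fun h => h2.2 h.symm⟩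

theorem bag_rot : Bag G (rot c i) j v ↔ Bag G c (i + j) v := by simp [Bag, rot, add_assoc]

theorem bag_rot_zero : Bag G (rot c i) 0 v ↔ Bag G c i v := by simp [bag_rot]

theorem ear_rot : Ear G (rot c i) j v ↔ Ear G c (i + j) v := by simp [Ear, rot, add_assoc]

theorem ear_rot_zero : Ear G (rot c i) 0 v ↔ Ear G c i v := by simp [ear_rot]

theorem hub_rot : Hub G (rot c i) v ↔ Hub G c v :=
  ⟨fun h j => by simpa [rot] using h (j - i), fun h j => h _⟩

theorem far_rot : Far G (rot c i) v ↔ Far G c v :=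
  ⟨fun h j => by simpa [rot] using h (j - i), fun h j => h _⟩

theorem neg_add_fin_five (i : Fin 5) : -(i + 1) = -i + 4 ∧ -(i + 4) = -i + 1 ∧
    -(i + 2) = -i + 3 ∧ -(i + 3) = -i + 2 := by
  revert i; decide

theorem bag_rev : Bag G (rev c) i v ↔ Bag G c (-i) v := by
  obtain ⟨h1, h2, h3, h4⟩ := neg_add_fin_five i
  simp only [Bag, rev, h1, h2, h3, h4]; tauto

theorem ear_rev : Ear G (rev c) i v ↔ Ear G c (-i) v := by
  obtain ⟨h1, h2, h3, h4⟩ := neg_add_fin_five i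
  simp only [Ear, rev, h1, h2, h3, h4]; tauto

theorem far_rev : Far G (rev c) v ↔ Far G c v :=
  ⟨fun h j => by simpa [rev] using h (-j), fun h j => h _⟩

theorem IsC5.bag_self (hc : IsC5 G c) (i : Fin 5) : Bag G c i (c i) := by
  have h1 := (hc (i + 4)).1
  have h2 := (hc (i + 3)).2
  have e1 : ∀ i : Fin 5, i + 4 + 1 = i := by decide
  have e2 : ∀ i : Fin 5, i + 3 + 2 = i := by decide
  rw [e1] at h1
  rw [e2] at h2
  exact ⟨(hc i).1, h1.symm, G.irrefl, (hc i).2, fun h => h2 h.symm⟩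

theorem IsC5.lits (hc : IsC5 G c) :
    G.Adj (c 0) (c 1) ∧ G.Adj (c 1) (c 2) ∧ G.Adj (c 2) (c 3) ∧ G.Adj (c 3) (c 4) ∧
    G.Adj (c 4) (c 0) ∧ ¬ G.Adj (c 0) (c 2) ∧ ¬ G.Adj (c 1) (c 3) ∧ ¬ G.Adj (c 2) (c 4) ∧
    ¬ G.Adj (c 3) (c 0) ∧ ¬ G.Adj (c 4) (c 1) :=
  ⟨(hc 0).1, (hc 1).1, (hc 2).1, (hc 3).1, (hc 4).1, (hc 0).2, (hc 1).2, (hc 2).2, (hc 3).2,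
    (hc 4).2⟩

theorem IsC5.ne_zero_two (hc : IsC5 G c) : c 0 ≠ c 2 := fun h =>
  hc.lits.2.2.2.2.2.2.2.2.1 (h ▸ hc.lits.2.2.1.symm)

theorem bag_zero : Bag G c 0 v ↔ G.Adj v (c 1) ∧ G.Adj v (c 4) ∧ ¬ G.Adj v (c 0) ∧
    ¬ G.Adj v (c 2) ∧ ¬ G.Adj v (c 3) := Iff.rfl

theorem bag_one : Bag G c 1 v ↔ G.Adj v (c 2) ∧ G.Adj v (c 0) ∧ ¬ G.Adj v (c 1) ∧
    ¬ G.Adj v (c 3) ∧ ¬ G.Adj v (c 4) := Iff.rfl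

theorem bag_two : Bag G c 2 v ↔ G.Adj v (c 3) ∧ G.Adj v (c 1) ∧ ¬ G.Adj v (c 2) ∧
    ¬ G.Adj v (c 4) ∧ ¬ G.Adj v (c 0) := Iff.rfl

theorem bag_three : Bag G c 3 v ↔ G.Adj v (c 4) ∧ G.Adj v (c 2) ∧ ¬ G.Adj v (c 3) ∧
    ¬ G.Adj v (c 0) ∧ ¬ G.Adj v (c 1) := Iff.rfl

theorem bag_four : Bag G c 4 v ↔ G.Adj v (c 0) ∧ G.Adj v (c 3) ∧ ¬ G.Adj v (c 4) ∧
    ¬ G.Adj v (c 1) ∧ ¬ G.Adj v (c 2) := Iff.rfl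

theorem ear_zero : Ear G c 0 v ↔ G.Adj v (c 0) ∧ G.Adj v (c 2) ∧ G.Adj v (c 3) ∧
    ¬ G.Adj v (c 1) ∧ ¬ G.Adj v (c 4) := Iff.rfl

theorem ear_one : Ear G c 1 v ↔ G.Adj v (c 1) ∧ G.Adj v (c 3) ∧ G.Adj v (c 4) ∧
    ¬ G.Adj v (c 2) ∧ ¬ G.Adj v (c 0) := Iff.rfl

theorem ear_two : Ear G c 2 v ↔ G.Adj v (c 2) ∧ G.Adj v (c 4) ∧ G.Adj v (c 0) ∧
    ¬ G.Adj v (c 3) ∧ ¬ G.Adj v (c 1) := Iff.rfl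

theorem ear_three : Ear G c 3 v ↔ G.Adj v (c 3) ∧ G.Adj v (c 0) ∧ G.Adj v (c 1) ∧
    ¬ G.Adj v (c 4) ∧ ¬ G.Adj v (c 2) := Iff.rfl

/-- One neighbor on the cycle, or two consecutive ones, gives a P5; three consecutive ones give
`F16` and four give `F17`. What survives is two nonconsecutive neighbors, three nonconsecutive ones,
or all five. -/
theorem attachment_zero (h : IsFamilyFree G) (hc : IsC5 G c) (hv : G.Adj v (c 0)) :
    Bag G c 1 v ∨ Bag G c 4 v ∨ Ear G c 0 v ∨ Ear G c 2 v ∨ Ear G c 3 v ∨ Hub G c v := by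
  have := F1_elim h (c 2) (c 4) v (c 3) (c 0)
  have := F1_elim h (c 1) (c 3) v (c 2) (c 4)
  have := F16_elim h (c 3) (c 4) (c 2) (c 0) (c 1) v
  have := F16_elim h (c 2) (c 3) (c 1) (c 4) (c 0) v
  have := F16_elim h (c 1) (c 2) (c 0) (c 3) (c 4) v
  have := F17_elim h (c 4) (c 0) (c 3) (c 1) v (c 2)
  have := F17_elim h (c 3) (c 2) (c 4) (c 1) v (c 0)
  have := F17_elim h (c 2) (c 1) (c 3) (c 0) v (c 4)
  have := F17_elim h (c 1) (c 0) (c 2) (c 4) v (c 3)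
  have := hc.lits
  have hub : G.Adj v (c 0) → G.Adj v (c 1) → G.Adj v (c 2) → G.Adj v (c 3) → G.Adj v (c 4) →
      Hub G c v := fun h0 h1 h2 h3 h4 i => by fin_cases i <;> assumption
  rw [bag_one, bag_four, ear_zero, ear_two, ear_three]
  clear h
  grind [SimpleGraph.adj_comm]

/-- Putting `u` in the place of `c 0` gives another chordless 5-cycle, on which an adjacent `v`
would have three consecutive neighbors. -/
theorem not_adj_of_bag_zero (h : IsFamilyFree G) (hc : IsC5 G c) (hu : Bag G c 0 u)
    (hv : Bag G c 0 v) :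
    ¬ G.Adj u v := by
  have := F16_elim h (c 2) (c 3) (c 1) (c 4) u v
  have := hc.lits
  clear h
  grind [bag_zero, SimpleGraph.adj_comm]

theorem adj_of_bag_zero_one (h : IsFamilyFree G) (hc : IsC5 G c) (hu : Bag G c 0 u)
    (hv : Bag G c 1 v) :
    G.Adj u v := by
  have := F1_elim h (c 2) (c 0) u v (c 4)
  have := hc.lits
  clear h
  grind [bag_zero, bag_one, SimpleGraph.adj_comm]

theorem adj_of_ear_zero_bag_zero (h : IsFamilyFree G) (hc : IsC5 G c) (hy : Ear G c 0 y)
    (hv : Bag G c 0 v) :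
    G.Adj y v := by
  have := F1_elim h (c 1) (c 4) y v (c 3)
  have := hc.lits
  clear h
  grind [ear_zero, bag_zero, SimpleGraph.adj_comm]

theorem not_adj_of_ear_zero_bag_one (h : IsFamilyFree G) (hc : IsC5 G c) (hy : Ear G c 0 y)
    (hv : Bag G c 1 v) :
    ¬ G.Adj y v := by
  have := F17_elim h (c 4) (c 0) (c 3) v y (c 2)
  have := hc.lits
  clear h
  grind [ear_zero, bag_one, SimpleGraph.adj_comm]

theorem adj_of_ear_zero_ear_one (h : IsFamilyFree G) (hc : IsC5 G c) (hy : Ear G c 0 y)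
    (hz : Ear G c 1 z) :
    G.Adj y z := by
  have := F1_elim h (c 2) (c 0) z y (c 4)
  have := hc.lits
  clear h
  grind [ear_zero, ear_one, SimpleGraph.adj_comm]

theorem not_adj_of_ear_zero_ear_two (h : IsFamilyFree G) (hc : IsC5 G c) (hy : Ear G c 0 y)
    (hz : Ear G c 2 z) :
    ¬ G.Adj y z := by
  have := F10_elim h (c 3) (c 4) y (c 0) (c 2) z
  have := hc.lits
  clear h
  grind [ear_zero, ear_two, SimpleGraph.adj_comm]

theorem adj_of_hub_bag_zero (h : IsFamilyFree G) (hc : IsC5 G c) (hd : Hub G c d)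
    (hv : Bag G c 0 v) :
    G.Adj d v := by
  have := F17_elim h v (c 1) (c 4) (c 2) d (c 3)
  have := hc.lits
  clear h
  grind [bag_zero, Hub, SimpleGraph.adj_comm]

theorem adj_of_hub_ear_zero (h : IsFamilyFree G) (hc : IsC5 G c) (hd : Hub G c d)
    (hy : Ear G c 0 y) :
    G.Adj d y := by
  have := F10_elim h (c 0) y d (c 2) (c 4) (c 3)
  have := hc.lits
  clear h
  grind [ear_zero, Hub, SimpleGraph.adj_comm]

theorem not_adj_of_far_bag_zero (h : IsFamilyFree G) (hc : IsC5 G c) (ho : Far G c o)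
    (hv : Bag G c 0 v) :
    ¬ G.Adj o v := by
  have := F1_elim h (c 2) (c 4) o (c 3) v
  have := hc.lits
  clear h
  grind [bag_zero, Far, SimpleGraph.adj_comm]

/-- The neighborhoods of ears at `c 0` in the bag of `c 2` are nested: an induced matching would
give the P5 `y s (c 1) t z`, or `F17` if the ears are adjacent. This later forces all b-vertices
among incomplete ears into one color. -/
theorem no_matching_ear_zero_bag_two (h : IsFamilyFree G) (hc : IsC5 G c) (hy : Ear G c 0 y)
    (hz : Ear G c 0 z)
    (hs : Bag G c 2 s) (ht : Bag G c 2 t) (hst : ¬ G.Adj s t) (hys : G.Adj y s) (hzt : G.Adj z t)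
    (hyt : ¬ G.Adj y t) :
    G.Adj z s := by
  have := F1_elim h y (c 1) z s t
  have := F17_elim h (c 1) (c 0) s z y (c 3)
  have := hc.lits
  clear h
  grind [ear_zero, bag_two, SimpleGraph.adj_comm]

/-- With the next lemma this ensures that the exchange in `bag_one_bag_three` destroys no ear. -/
theorem not_adj_bag_zero_bag_two_of_ear (h : IsFamilyFree G) (hc : IsC5 G c) (hy : Ear G c 0 y)
    (hs : Bag G c 0 s)
    (ht : Bag G c 2 t) :
    ¬ G.Adj s t := by
  have := F10_elim h (c 1) (c 2) t (c 3) s y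
  have := F20_elim h (c 0) (c 4) s y (c 1) t (c 3) (c 2)
  have := adj_of_ear_zero_bag_zero h hc hy hs
  have := hc.lits
  clear h
  grind [ear_zero, bag_zero, bag_two, SimpleGraph.adj_comm]

theorem adj_ear_zero_bag_three_of_adj (h : IsFamilyFree G) (hc : IsC5 G c) (hy : Ear G c 0 y)
    (hs : Bag G c 1 s)
    (ht : Bag G c 3 t) (hst : G.Adj s t) :
    G.Adj y t := by
  have := F1_elim h (c 3) (c 0) t y s
  have := not_adj_of_ear_zero_bag_one h hc hy hs
  have := hc.lits
  clear h
  grind [ear_zero, bag_one, bag_three, SimpleGraph.adj_comm]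

/-- Used in contrapositive form: an ear that misses a vertex of the bag of `c 2` forces the bag of
`c 3` to be a singleton. -/
theorem adj_ear_zero_of_bag_two_bag_three (h : IsFamilyFree G) (hc : IsC5 G c) (hy : Ear G c 0 y)
    (hs : Bag G c 2 s)
    (ht : Bag G c 3 t) (hst : G.Adj s t) (hne : t ≠ c 3) :
    G.Adj y s := by
  have := F1_elim h (c 0) (c 2) s y t
  have := F19_elim h (c 0) (c 1) y (c 2) (c 4) s (c 3) t
  have := hc.lits
  clear h
  grind [ear_zero, bag_two, bag_three, SimpleGraph.adj_comm]

theorem adj_ear_zero_bag_two_of_adj (h : IsFamilyFree G) (hc : IsC5 G c) (hy : Ear G c 0 y)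
    (hz : Ear G c 0 z)
    (hyz : G.Adj y z) (ht : Bag G c 2 t) :
    G.Adj y t := by
  have := F16_elim h (c 1) t (c 0) (c 3) y z
  have := F17_elim h (c 1) (c 0) t y z (c 3)
  have := hc.lits
  clear h
  grind [ear_zero, bag_two, SimpleGraph.adj_comm]

/-- Otherwise `c 1`, `t`, `c 3`, `y`, `o` is an induced P5. Hence an ear incomplete to this bag has
no far neighbor. -/
theorem adj_ear_zero_bag_two_of_far (h : IsFamilyFree G) (hc : IsC5 G c) (hy : Ear G c 0 y)
    (ho : Far G c o)
    (hyo : G.Adj y o) (hot : ¬ G.Adj o t) (ht : Bag G c 2 t) :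
    G.Adj y t := by
  have := F1_elim h (c 1) (c 3) o t y
  have := hc.lits
  clear h
  grind [ear_zero, bag_two, Far, SimpleGraph.adj_comm]

/-- A second vertex `t` of the bag, the cycle and the two ears would form `F20` or `F21`, according
to whether `t` misses or sees `z`. -/
theorem bag_zero_eq_of_ear_zero_ear_two (h : IsFamilyFree G) (hc : IsC5 G c) (hy : Ear G c 0 y)
    (hz : Ear G c 2 z)
    (ht : Bag G c 0 t) :
    t = c 0 := by
  have := F20_elim h (c 1) t y (c 0) (c 2) (c 3) (c 4) z
  have := F21_elim h (c 0) (c 1) t y (c 4) z (c 2) (c 3)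
  have := adj_of_ear_zero_bag_zero h hc hy ht
  have := not_adj_of_ear_zero_ear_two h hc hy hz
  have := hc.lits
  clear h
  grind [ear_zero, ear_two, bag_zero, SimpleGraph.adj_comm]

theorem not_adj_far_of_ear_zero_ear_two (h : IsFamilyFree G) (hc : IsC5 G c) (hy : Ear G c 0 y)
    (hz : Ear G c 2 z)
    (ho : Far G c o) :
    ¬ G.Adj y o := by
  have := F1_elim h (c 4) (c 2) o z y
  have := F18_elim h (c 3) (c 4) (c 2) (c 0) y (c 1) z o
  have := not_adj_of_ear_zero_ear_two h hc hy hz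
  have := hc.lits
  clear h
  grind [ear_zero, ear_two, Far, SimpleGraph.adj_comm]

theorem adj_ear_zero_bag_three_of_ear_one (h : IsFamilyFree G) (hc : IsC5 G c) (hy : Ear G c 0 y)
    (hz : Ear G c 1 z)
    (ht : Bag G c 3 t) :
    G.Adj y t := by
  have := F10_elim h (c 2) t (c 3) (c 4) y z
  have := F17_elim h t (c 2) (c 4) y (c 3) z
  have := adj_of_ear_zero_ear_one h hc hy hz
  have := hc.lits
  clear h
  grind [ear_zero, ear_one, bag_three, SimpleGraph.adj_comm]

theorem not_ear_zero_one_two (h : IsFamilyFree G) (hc : IsC5 G c) (hx : Ear G c 0 x)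
    (hy : Ear G c 1 y)
    (hz : Ear G c 2 z) (hyz : G.Adj y z) :
    False := by
  have := F10_elim h (c 0) x (c 4) (c 3) z y
  have := adj_of_ear_zero_ear_one h hc hx hy
  have := not_adj_of_ear_zero_ear_two h hc hx hz
  have := hc.lits
  clear h
  grind [ear_zero, ear_one, ear_two, SimpleGraph.adj_comm]

theorem not_ear_zero_one_three (h : IsFamilyFree G) (hc : IsC5 G c) (hx : Ear G c 0 x)
    (hy : Ear G c 1 y)
    (hz : Ear G c 3 z) (hyz : ¬ G.Adj y z) (hxz : ¬ G.Adj x z) :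
    False := by
  have := F22_elim h (c 0) (c 1) (c 4) y x (c 2) z (c 3)
  have := adj_of_ear_zero_ear_one h hc hx hy
  have := hc.lits
  clear h
  grind [ear_zero, ear_one, ear_three, SimpleGraph.adj_comm]

/-- `F2` is the disjoint union of a P3 and a P4, and the cycle contains a P4. So the far vertices
induce a disjoint union of cliques. -/
theorem adj_of_far_of_adj_of_adj (h : IsFamilyFree G) (hc : IsC5 G c) (hx : Far G c x)
    (hy : Far G c y)
    (hz : Far G c z) (hxy : G.Adj x y) (hyz : G.Adj y z) (hxz : x ≠ z) :
    G.Adj x z := by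
  have := F2_elim h x z (c 0) (c 2) y (c 4) (c 3)
  have := hc.lits
  clear h
  grind [Far, SimpleGraph.adj_comm]

theorem adj_ear_zero_far (h : IsFamilyFree G) (hc : IsC5 G c) (hy : Ear G c 0 y) (ho : Far G c o)
    (hp : Far G c p) (hop : G.Adj o p) (hyo : G.Adj y o) :
    G.Adj y p := by
  have := F1_elim h (c 1) y p (c 0) o
  have := hc.lits
  clear h
  grind [ear_zero, Far, SimpleGraph.adj_comm]

/-- If `d` misses `p`, then `F5` appears when `d` sees `q`, and `F8` when it does not. The argument
needs a third far vertex: a hub may split a far clique of two vertices unless an ear is attached to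
it. -/
theorem adj_hub_far_of_triangle (h : IsFamilyFree G) (hc : IsC5 G c) (hd : Hub G c d)
    (ho : Far G c o)
    (hp : Far G c p) (hq : Far G c q) (hop : G.Adj o p) (hoq : G.Adj o q) (hpq : G.Adj p q)
    (hdo : G.Adj d o) :
    G.Adj d p := by
  have := F5_elim h o (c 0) p d (c 1) q (c 2)
  have := F8_elim h (c 0) (c 1) (c 2) (c 3) d o p q
  have := hc.ne_zero_two
  have := hc.lits
  clear h
  grind [Hub, Far, SimpleGraph.adj_comm]

theorem adj_hub_far_of_ear_zero (h : IsFamilyFree G) (hc : IsC5 G c) (hd : Hub G c d)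
    (ho : Far G c o)
    (hp : Far G c p) (hy : Ear G c 0 y) (hop : G.Adj o p) (hyo : G.Adj y o) (hyp : G.Adj y p)
    (hdo : G.Adj d o) :
    G.Adj d p := by
  have := F4_elim h y (c 0) o d p (c 1)
  have := adj_of_hub_ear_zero h hc hd hy
  have := hc.lits
  clear h
  grind [Hub, Far, ear_zero, SimpleGraph.adj_comm]

end BPerfect

/-! ### Adjacency between the classes for a cycle with the most ears. -/

namespace BPerfect

universe u

variable {V : Type u} {G : SimpleGraph V}
variable {c : Fin 5 → V} {i j : Fin 5} {a b u v w x y z o p q d s t : V}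

/-- Two adjacent vertices `o`, `p` and two nonadjacent vertices `s`, `t` that are joined by no
edge: if `a`, `b` see all four of them, while `v` sees `s`, `t` only, then `v` misses `b`. -/
theorem not_adj_of_common_neighbors (h : IsFamilyFree G) (hst : ¬ G.Adj s t) (hst' : s ≠ t)
    (hop : G.Adj o p) (hos : ¬ G.Adj o s) (hot : ¬ G.Adj o t) (hps : ¬ G.Adj p s)
    (hpt : ¬ G.Adj p t) (ha : G.Adj a o ∧ G.Adj a p ∧ G.Adj a s ∧ G.Adj a t)
    (hb : G.Adj b o ∧ G.Adj b p ∧ G.Adj b s ∧ G.Adj b t)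
    (hv : ¬ G.Adj v o ∧ ¬ G.Adj v p ∧ G.Adj v s ∧ G.Adj v t)
    (hab : ¬ G.Adj a b) (hav : ¬ G.Adj a v) : ¬ G.Adj b v := by
  have := F11_elim h o s a b v p t
  clear h
  grind [SimpleGraph.adj_comm]

/-- Serves the last step of `not_seesAll_of_module`: there `x` has a color that `a` is supposed to
miss, and this lemma makes `x` a neighbor of `a`. If `x` missed `a`, the pattern would contain `F11`
or `F13`. -/
theorem adj_of_common_neighbors (h : IsFamilyFree G) (hst : ¬ G.Adj s t) (hst' : s ≠ t)
    (hop : G.Adj o p) (hos : ¬ G.Adj o s) (hot : ¬ G.Adj o t) (hps : ¬ G.Adj p s)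
    (hpt : ¬ G.Adj p t) (ha : G.Adj a o ∧ G.Adj a p ∧ G.Adj a s ∧ G.Adj a t)
    (hb : G.Adj b o ∧ G.Adj b p ∧ G.Adj b s ∧ G.Adj b t)
    (hv : ¬ G.Adj v o ∧ ¬ G.Adj v p ∧ G.Adj v s ∧ G.Adj v t)
    (hx : (G.Adj x o ↔ G.Adj x p) ∧ G.Adj x s ∧ G.Adj x t)
    (hab : ¬ G.Adj a b) (hab' : a ≠ b) (hav : ¬ G.Adj a v) (hxb : ¬ G.Adj x b) (hxv : G.Adj x v) :
    G.Adj x a := by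
  have := not_adj_of_common_neighbors h hst hst' hop hos hot hps hpt ha hb hv hab hav
  have := F11_elim h o s a x v p t
  have := F13_elim h o a s v p b t x
  clear h
  grind [SimpleGraph.adj_comm]

theorem adj_of_common_neighbor (h : IsFamilyFree G) (hos : ¬ G.Adj o s) (ha : G.Adj a o ∧ G.Adj a s)
    (hv : ¬ G.Adj v o ∧ G.Adj v s) (hx : ¬ G.Adj x o ∧ ¬ G.Adj x s) (hav : ¬ G.Adj a v)
    (hxv : G.Adj x v) : G.Adj x a := by
  have := F1_elim h o s x a v
  clear h
  grind [SimpleGraph.adj_comm]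

/-- The vertices that are adjacent exactly to two consecutive vertices and the vertex opposite
to them. -/
def earSet (G : SimpleGraph V) (c : Fin 5 → V) : Set V := {v | ∃ i, Ear G c i v}

/-- A chordless 5-cycle of an `𝓕`-free graph with as many ears as possible. -/
structure Frame (G : SimpleGraph V) (c : Fin 5 → V) : Prop where
  free : IsFamilyFree G
  cyc : IsC5 G c
  max : ∀ c', IsC5 G c' → (earSet G c').ncard ≤ (earSet G c).ncard

namespace Frame

/-- Rotation only renumbers the positions of ears, so the maximum is kept. With `rev`, this lets
every fact proved at position 0 be used at all positions and in both directions. -/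
theorem rot (hF : Frame G c) (i : Fin 5) : Frame G (rot c i) := by
  have : earSet G (BPerfect.rot c i) = earSet G c := by
    ext v
    refine ⟨fun ⟨j, hj⟩ => ⟨i + j, ear_rot.1 hj⟩, fun ⟨j, hj⟩ => ⟨j - i, ear_rot.2 ?_⟩⟩
    simpa using hj
  exact ⟨hF.free, hF.cyc.rot i, fun c' hc' => this ▸ hF.max c' hc'⟩

theorem rev (hF : Frame G c) : Frame G (rev c) := by
  have : earSet G (BPerfect.rev c) = earSet G c := by
    ext v
    refine ⟨fun ⟨j, hj⟩ => ⟨-j, ear_rev.1 hj⟩, fun ⟨j, hj⟩ => ⟨-j, ear_rev.2 ?_⟩⟩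
    simpa using hj
  exact ⟨hF.free, hF.cyc.rev, fun c' hc' => this ▸ hF.max c' hc'⟩

/-- The cycle `c`, traversed backwards from `c i`. -/
theorem mirror (hF : Frame G c) (i : Fin 5) : Frame G (BPerfect.rev (BPerfect.rot c i)) :=
  (hF.rot i).rev

theorem bag_mirror : Bag G (BPerfect.rev (BPerfect.rot c i)) j v ↔ Bag G c (i - j) v := by
  rw [bag_rev, bag_rot, sub_eq_add_neg]

theorem ear_mirror : Ear G (BPerfect.rev (BPerfect.rot c i)) j v ↔ Ear G c (i - j) v := by
  rw [ear_rev, ear_rot, sub_eq_add_neg]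

theorem far_mirror : Far G (BPerfect.rev (BPerfect.rot c i)) v ↔ Far G c v := by
  rw [far_rev, far_rot]

theorem ear_mirror_zero : Ear G (BPerfect.rev (BPerfect.rot c i)) 0 v ↔ Ear G c i v := by
  rw [ear_mirror, sub_zero]

theorem bag_mirror_zero : Bag G (BPerfect.rev (BPerfect.rot c i)) 0 v ↔ Bag G c i v := by
  rw [bag_mirror, sub_zero]

theorem bag_mirror_one : Bag G (BPerfect.rev (BPerfect.rot c i)) 1 v ↔ Bag G c (i + 4) v := by
  rw [bag_rev, bag_rot]; rfl

theorem bag_mirror_two : Bag G (BPerfect.rev (BPerfect.rot c i)) 2 v ↔ Bag G c (i + 3) v := by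
  rw [bag_rev, bag_rot]; rfl

theorem bag_mirror_three : Bag G (BPerfect.rev (BPerfect.rot c i)) 3 v ↔ Bag G c (i + 2) v := by
  rw [bag_rev, bag_rot]; rfl

theorem bag_bag (hF : Frame G c) (hu : Bag G c i u) (hv : Bag G c i v) : ¬ G.Adj u v :=
  not_adj_of_bag_zero hF.free (hF.cyc.rot i) (bag_rot_zero.2 hu) (bag_rot_zero.2 hv)

theorem bag_succ (hF : Frame G c) (hu : Bag G c i u) (hv : Bag G c (i + 1) v) : G.Adj u v :=
  adj_of_bag_zero_one hF.free (hF.cyc.rot i) (bag_rot_zero.2 hu) (bag_rot.2 hv)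

theorem ear_bag (hF : Frame G c) (hy : Ear G c i y) (hv : Bag G c i v) : G.Adj y v :=
  adj_of_ear_zero_bag_zero hF.free (hF.cyc.rot i) (ear_rot_zero.2 hy) (bag_rot_zero.2 hv)

theorem ear_bag_succ (hF : Frame G c) (hy : Ear G c i y) (hv : Bag G c (i + 1) v) :
    ¬ G.Adj y v :=
  not_adj_of_ear_zero_bag_one hF.free (hF.cyc.rot i) (ear_rot_zero.2 hy) (bag_rot.2 hv)

theorem ear_bag_pred (hF : Frame G c) (hy : Ear G c i y) (hv : Bag G c (i + 4) v) :
    ¬ G.Adj y v :=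
  not_adj_of_ear_zero_bag_one hF.free (hF.mirror i).cyc (ear_mirror_zero.2 hy)
    (bag_mirror_one.2 hv)

theorem ear_succ (hF : Frame G c) (hy : Ear G c i y) (hz : Ear G c (i + 1) z) : G.Adj y z :=
  adj_of_ear_zero_ear_one hF.free (hF.cyc.rot i) (ear_rot_zero.2 hy) (ear_rot.2 hz)

theorem ear_two (hF : Frame G c) (hy : Ear G c i y) (hz : Ear G c (i + 2) z) : ¬ G.Adj y z :=
  not_adj_of_ear_zero_ear_two hF.free (hF.cyc.rot i) (ear_rot_zero.2 hy) (ear_rot.2 hz)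

theorem hub_bag (hF : Frame G c) (hd : Hub G c d) (hv : Bag G c i v) : G.Adj d v :=
  adj_of_hub_bag_zero hF.free (hF.cyc.rot i) (hub_rot.2 hd) (bag_rot_zero.2 hv)

theorem hub_ear (hF : Frame G c) (hd : Hub G c d) (hy : Ear G c i y) : G.Adj d y :=
  adj_of_hub_ear_zero hF.free (hF.cyc.rot i) (hub_rot.2 hd) (ear_rot_zero.2 hy)

theorem far_bag (hF : Frame G c) (ho : Far G c o) (hv : Bag G c i v) : ¬ G.Adj o v :=
  not_adj_of_far_bag_zero hF.free (hF.cyc.rot i) (far_rot.2 ho) (bag_rot_zero.2 hv)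

theorem cases (hF : Frame G c) (v : V) :
    (∃ i, Bag G c i v) ∨ (∃ i, Ear G c i v) ∨ Hub G c v ∨ Far G c v := by
  by_cases hv : ∃ i, G.Adj v (c i)
  · obtain ⟨i, hi⟩ := hv
    have hi' : G.Adj v (BPerfect.rot c i 0) := by simpa [BPerfect.rot] using hi
    rcases attachment_zero hF.free (hF.cyc.rot i) hi' with h | h | h | h | h | h
    · exact .inl ⟨_, bag_rot.1 h⟩
    · exact .inl ⟨_, bag_rot.1 h⟩
    · exact .inr (.inl ⟨_, ear_rot.1 h⟩)
    · exact .inr (.inl ⟨_, ear_rot.1 h⟩)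
    · exact .inr (.inl ⟨_, ear_rot.1 h⟩)
    · exact .inr (.inr (.inl (hub_rot.1 h)))
  · push Not at hv
    exact .inr (.inr (.inr hv))

/-- The number of ears is maximal, so an edge between the bags of `c 1` and `c 3` is impossible:
exchanging `c 3` would turn its end in the bag of `c 1` into an ear and keep all ears. -/
theorem bag_one_bag_three [Finite V] (hF : Frame G c) (hs : Bag G c 1 s) (ht : Bag G c 3 t) :
    ¬ G.Adj s t := by
  intro hst
  let e : Fin 5 → V := ![c 0, c 1, c 2, t, c 4]
  have hc := hF.cyc.lits
  have he : IsC5 G e := by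
    rw [bag_three] at ht
    intro i
    fin_cases i <;> simp [e, hc, ht, G.adj_comm (c 1) t, G.adj_comm (c 2) t]
  -- Each old ear has the same adjacency to `t` as to `c 3`, hence remains an ear at the same
  -- position; ears at `c 1` and `c 3` cannot exist because of the edge `s t`. The gain is `s`, a
  -- new ear at `e 0`.
  have hsub : earSet G c ⊂ earSet G e := by
    refine (Set.ssubset_iff_of_subset ?_).2 ⟨s, ⟨0, ?_⟩, ?_⟩
    · have key : ∀ v, (G.Adj v t ↔ G.Adj v (c 3)) → ∀ i, Ear G c i v → Ear G e i v := by
        intro v hv i hi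
        have : ∀ j, G.Adj v (e j) ↔ G.Adj v (c j) := by
          intro j; fin_cases j <;> simp [e, hv]
        simpa only [Ear, this] using hi
      rintro v ⟨i, hi⟩
      refine ⟨i, key v ?_ i hi⟩
      fin_cases i
      · exact iff_of_true (adj_ear_zero_bag_three_of_adj hF.free hF.cyc hi hs ht hst)
          (ear_zero.1 hi).2.2.1
      · exact absurd hst (not_adj_bag_zero_bag_two_of_ear hF.free (hF.cyc.rot 1)
          (ear_rot_zero.2 hi) (bag_rot_zero.2 hs) (bag_rot.2 ht))
      · exact iff_of_false (hF.ear_bag_succ hi ht) (BPerfect.ear_two.1 hi).2.2.2.1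
      · exact absurd hst.symm (not_adj_bag_zero_bag_two_of_ear hF.free (hF.mirror 3).cyc
          (ear_mirror_zero.2 hi) (bag_mirror_zero.2 ht) (bag_mirror_two.2 hs))
      · exact iff_of_false (hF.ear_bag_pred hi ht) (hi : Ear G c 4 v).2.2.2.2
    · rw [bag_one] at hs
      rw [ear_zero]
      simp [e, hs, hst]
    · rintro ⟨i, hi⟩
      rw [bag_one] at hs
      have h0 := hs.2.2.1
      have h1 := hs.2.2.2
      fin_cases i
      · exact h1.1 (ear_zero.1 hi).2.2.1
      · exact h0 (ear_one.1 hi).1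
      · exact h1.2 (BPerfect.ear_two.1 hi).2.1
      · exact h0 (ear_three.1 hi).2.2.1
      · exact h1.2 (hi : Ear G c 4 s).1
  exact absurd (hF.max e he) (not_le.2 (Set.ncard_lt_ncard hsub (Set.toFinite _)))

theorem bag_two [Finite V] (hF : Frame G c) (hu : Bag G c i u) (hv : Bag G c (i + 2) v) :
    ¬ G.Adj u v := by
  refine (hF.rot (i - 1)).bag_one_bag_three (bag_rot.2 ?_) (bag_rot.2 ?_)
  · simpa using hu
  · have : ∀ i : Fin 5, i - 1 + 3 = i + 2 := by decide
    rwa [this i]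

/-- Maximality of the number of ears enters here through `bag_two`: among the bags only the two
consecutive ones survive. These lists of possible neighbors drive all later domination arguments. -/
theorem nbr_bag [Finite V] (hF : Frame G c) (hv : Bag G c i v) (hw : G.Adj v w) :
    Bag G c (i + 1) w ∨ Bag G c (i + 4) w ∨ Hub G c w ∨ Ear G c i w ∨ Ear G c (i + 2) w ∨
      Ear G c (i + 3) w := by
  rcases hF.cases w with ⟨j, hj⟩ | ⟨j, hj⟩ | hd | ho
  · obtain ⟨l, rfl⟩ : ∃ l, j = i + l := ⟨j - i, by simp⟩
    fin_cases l
    · exact absurd hw (hF.bag_bag hv (by simpa using hj))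
    · exact .inl hj
    · exact absurd hw (hF.bag_two hv hj)
    · refine absurd hw.symm (hF.bag_two hj ?_)
      have : ∀ i : Fin 5, i + 3 + 2 = i := by decide
      exact (this i).symm ▸ hv
    · exact .inr (.inl hj)
  · obtain ⟨l, rfl⟩ : ∃ l, j = i + l := ⟨j - i, by simp⟩
    fin_cases l
    · exact .inr (.inr (.inr (.inl (by simpa using hj))))
    · refine absurd hw.symm (hF.ear_bag_pred hj ?_)
      have : ∀ i : Fin 5, i + 1 + 4 = i := by decide
      exact (this i).symm ▸ hv
    · exact .inr (.inr (.inr (.inr (.inl hj))))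
    · exact .inr (.inr (.inr (.inr (.inr hj))))
    · refine absurd hw.symm (hF.ear_bag_succ hj ?_)
      have : ∀ i : Fin 5, i + 4 + 1 = i := by decide
      exact (this i).symm ▸ hv
  · exact .inr (.inr (.inl hd))
  · exact absurd hw.symm (hF.far_bag ho hv)

theorem nbr_ear (hF : Frame G c) (hv : Ear G c i v) (hw : G.Adj v w) :
    Bag G c i w ∨ Bag G c (i + 2) w ∨ Bag G c (i + 3) w ∨ Hub G c w ∨ Far G c w ∨ Ear G c i w ∨
      Ear G c (i + 1) w ∨ Ear G c (i + 4) w := by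
  rcases hF.cases w with ⟨j, hj⟩ | ⟨j, hj⟩ | hd | ho
  · obtain ⟨l, rfl⟩ : ∃ l, j = i + l := ⟨j - i, by simp⟩
    fin_cases l
    · exact .inl (by simpa using hj)
    · exact absurd hw (hF.ear_bag_succ hv hj)
    · exact .inr (.inl hj)
    · exact .inr (.inr (.inl hj))
    · exact absurd hw (hF.ear_bag_pred hv hj)
  · obtain ⟨l, rfl⟩ : ∃ l, j = i + l := ⟨j - i, by simp⟩
    fin_cases l
    · exact .inr (.inr (.inr (.inr (.inr (.inl (by simpa using hj))))))
    · exact .inr (.inr (.inr (.inr (.inr (.inr (.inl hj))))))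
    · exact absurd hw (hF.ear_two hv hj)
    · refine absurd hw.symm (hF.ear_two hj ?_)
      have : ∀ i : Fin 5, i + 3 + 2 = i := by decide
      exact (this i).symm ▸ hv
    · exact .inr (.inr (.inr (.inr (.inr (.inr (.inr hj))))))
  · exact .inr (.inr (.inr (.inl hd)))
  · exact .inr (.inr (.inr (.inr (.inl ho))))

theorem nbr_far (hF : Frame G c) (hv : Far G c v) (hw : G.Adj v w) :
    Far G c w ∨ Hub G c w ∨ ∃ i, Ear G c i w := by
  rcases hF.cases w with ⟨j, hj⟩ | h | hd | ho
  · exact absurd hw (hF.far_bag hv hj)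
  · exact .inr (.inr h)
  · exact .inr (.inl hd)
  · exact .inl ho

theorem far_trans (hF : Frame G c) (hx : Far G c x) (hy : Far G c y) (hz : Far G c z)
    (hxy : G.Adj x y) (hyz : G.Adj y z) (hxz : x ≠ z) : G.Adj x z :=
  adj_of_far_of_adj_of_adj hF.free hF.cyc hx hy hz hxy hyz hxz

theorem ear_far (hF : Frame G c) (hy : Ear G c i y) (ho : Far G c o) (hp : Far G c p)
    (hop : G.Adj o p) (hyo : G.Adj y o) : G.Adj y p :=
  adj_ear_zero_far hF.free (hF.cyc.rot i) (ear_rot_zero.2 hy) (far_rot.2 ho) (far_rot.2 hp) hop hyo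

/-- Hubs treat a far clique uniformly as soon as it has a third vertex or an ear attached to it. -/
theorem hub_far (hF : Frame G c) (hd : Hub G c d) (ho : Far G c o) (hp : Far G c p)
    (hop : G.Adj o p)
    (h : (∃ q, Far G c q ∧ G.Adj o q ∧ q ≠ p) ∨ ∃ i y, Ear G c i y ∧ G.Adj y o)
    (hdo : G.Adj d o) : G.Adj d p := by
  rcases h with ⟨q, hq, hoq, hqp⟩ | ⟨i, y, hy, hyo⟩
  · exact adj_hub_far_of_triangle hF.free hF.cyc hd ho hp hq hop hoq
      (hF.far_trans hp ho hq hop.symm hoq hqp.symm) hdo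
  · exact adj_hub_far_of_ear_zero hF.free (hF.cyc.rot i) (hub_rot.2 hd) (far_rot.2 ho)
      (far_rot.2 hp) (ear_rot_zero.2 hy) hop hyo (hF.ear_far hy ho hp hop hyo) hdo

/-- `F10` excludes the first position and `F22` the second. The remaining position `i + 4` is
excluded by the first part, applied one step earlier. -/
theorem not_three_ears (hF : Frame G c) (hx : Ear G c i x) (hy : Ear G c (i + 1) y) :
    (¬ ∃ z, Ear G c (i + 2) z) ∧ ¬ ∃ z, Ear G c (i + 3) z := by
  refine ⟨fun ⟨z, hz⟩ => ?_, fun ⟨z, hz⟩ => ?_⟩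
  · refine not_ear_zero_one_two hF.free (hF.cyc.rot i) (ear_rot_zero.2 hx) (ear_rot.2 hy)
      (ear_rot.2 hz) (hF.ear_succ hy ?_)
    have : ∀ i : Fin 5, i + 1 + 1 = i + 2 := by decide
    rwa [this i]
  · refine not_ear_zero_one_three hF.free (hF.cyc.rot i) (ear_rot_zero.2 hx) (ear_rot.2 hy)
      (ear_rot.2 hz) (hF.ear_two hy ?_) fun h => hF.ear_two hz ?_ h.symm
    · have : ∀ i : Fin 5, i + 1 + 2 = i + 3 := by decide
      rwa [this i]
    · have : ∀ i : Fin 5, i + 3 + 2 = i := by decide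
      rwa [this i]

theorem ear_bag_of_far (hF : Frame G c) (hy : Ear G c i y) (ho : Far G c o) (hyo : G.Adj y o) :
    (∀ t, Bag G c (i + 2) t → G.Adj y t) ∧ ∀ t, Bag G c (i + 3) t → G.Adj y t :=
  ⟨fun _ ht => adj_ear_zero_bag_two_of_far hF.free (hF.cyc.rot i) (ear_rot_zero.2 hy)
    (far_rot.2 ho) hyo (hF.far_bag ho ht) (bag_rot.2 ht),
  fun _ ht => adj_ear_zero_bag_two_of_far hF.free (hF.mirror i).cyc (ear_mirror_zero.2 hy)
    (far_mirror.2 ho) hyo (hF.far_bag ho ht) (bag_mirror_two.2 ht)⟩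

theorem ear_bag_of_adj (hF : Frame G c) (hy : Ear G c i y) (hz : Ear G c i z) (hyz : G.Adj y z) :
    (∀ t, Bag G c (i + 2) t → G.Adj y t) ∧ ∀ t, Bag G c (i + 3) t → G.Adj y t :=
  ⟨fun _ ht => adj_ear_zero_bag_two_of_adj hF.free (hF.cyc.rot i) (ear_rot_zero.2 hy)
    (ear_rot_zero.2 hz) hyz (bag_rot.2 ht),
  fun _ ht => adj_ear_zero_bag_two_of_adj hF.free (hF.mirror i).cyc (ear_mirror_zero.2 hy)
    (ear_mirror_zero.2 hz) hyz (bag_mirror_two.2 ht)⟩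

theorem bag_three_eq (hF : Frame G c) (hy : Ear G c 0 y) (hs : Bag G c 2 s) (ht : Bag G c 3 t)
    (hys : ¬ G.Adj y s) : t = c 3 := by
  by_contra hne
  exact hys (adj_ear_zero_of_bag_two_bag_three hF.free hF.cyc hy hs ht (hF.bag_succ hs ht) hne)

theorem bag_eq_of_ear_two (hF : Frame G c) (hy : Ear G c i y) (hz : Ear G c (i + 2) z)
    (ht : Bag G c i t) : t = c i := by
  simpa [BPerfect.rot] using bag_zero_eq_of_ear_zero_ear_two hF.free (hF.cyc.rot i)
    (ear_rot_zero.2 hy) (ear_rot.2 hz) (bag_rot_zero.2 ht)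

theorem ear_two_far (hF : Frame G c) (hy : Ear G c i y) (hz : Ear G c (i + 2) z)
    (ho : Far G c o) : ¬ G.Adj y o ∧ ¬ G.Adj z o := by
  refine ⟨not_adj_far_of_ear_zero_ear_two hF.free (hF.cyc.rot i) (ear_rot_zero.2 hy)
    (ear_rot.2 hz) (far_rot.2 ho), not_adj_far_of_ear_zero_ear_two (z := y) hF.free
    (hF.mirror (i + 2)).cyc (ear_mirror_zero.2 hz) (ear_mirror.2 ?_) (far_mirror.2 ho)⟩
  simpa using hy

theorem ear_zero_bag_three (hF : Frame G c) (hy : Ear G c 0 y) (hz : Ear G c 1 z)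
    (ht : Bag G c 3 t) : G.Adj y t :=
  adj_ear_zero_bag_three_of_ear_one hF.free hF.cyc hy hz ht

theorem ear_matching (hF : Frame G c) (hy : Ear G c 0 y) (hz : Ear G c 0 z) (hs : Bag G c 2 s)
    (ht : Bag G c 2 t) (hys : G.Adj y s) (hzt : G.Adj z t) (hyt : ¬ G.Adj y t) : G.Adj z s :=
  no_matching_ear_zero_bag_two hF.free hF.cyc hy hz hs ht (hF.bag_bag hs ht) hys hzt hyt

end Frame

end BPerfect

/-! ### Critical b-colorings and b-vertices away from the cycle. -/

namespace BPerfect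

universe u

variable {V : Type u} {G : SimpleGraph V} {κ : Type*} {col : V → κ}
variable {c : Fin 5 → V} {i j : Fin 5} {a b u v w x y z o p q d s t : V}

/-- Inside `S`, the vertex `v` has a neighbor of every color but its own. -/
def SeesAll (G : SimpleGraph V) (col : V → κ) (S : Set V) (v : V) : Prop :=
  ∀ l, l ≠ col v → ∃ w ∈ S, G.Adj v w ∧ col w = l

/-- A b-coloring with at least four colors that restricts to a b-coloring with the same colors
on no proper induced subgraph. -/
structure Critical (G : SimpleGraph V) (col : V → κ) : Prop where
  proper : ∀ ⦃u v⦄, G.Adj u v → col u ≠ col v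
  exists_seesAll : ∀ j, ∃ v, col v = j ∧ SeesAll G col Set.univ v
  critical : ∀ S : Set V, S ≠ Set.univ → ¬ ∀ j, ∃ v ∈ S, col v = j ∧ SeesAll G col S v
  four : ∀ i j l : κ, ∃ m, m ≠ i ∧ m ≠ j ∧ m ≠ l

namespace Critical

/-- If `u` and `v` had the same color, `u` could be deleted: `v` replaces it both as a b-vertex and
as a neighbor. So the colors differ, and a b-vertex `u` would have a neighbor colored like `v`,
which is also a neighbor of `v`, against properness. -/
theorem ne_and_not_seesAll (hK : Critical G col) (huv : u ≠ v) (hadj : ¬ G.Adj u v)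
    (hN : ∀ w, G.Adj u w → G.Adj v w) : col u ≠ col v ∧ ¬ SeesAll G col Set.univ u := by
  have hne : col u ≠ col v := by
    intro hcol
    refine hK.critical {u}ᶜ (fun h => (h.symm ▸ Set.mem_univ u : u ∈ ({u}ᶜ : Set V)) rfl) ?_
    intro j
    obtain ⟨x, hx, hxb⟩ := hK.exists_seesAll j
    by_cases hxu : x = u
    · subst hxu
      refine ⟨v, huv.symm, hcol ▸ hx, fun l hl => ?_⟩
      obtain ⟨w, -, hw, hwl⟩ := hxb l (hcol ▸ hl)
      exact ⟨w, hw.ne', hN w hw, hwl⟩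
    · refine ⟨x, hxu, hx, fun l hl => ?_⟩
      obtain ⟨w, -, hw, hwl⟩ := hxb l hl
      by_cases hwu : w = u
      · subst hwu
        exact ⟨v, huv.symm, (hN x hw.symm).symm, hcol ▸ hwl⟩
      · exact ⟨w, hwu, hw, hwl⟩
  refine ⟨hne, fun hb => ?_⟩
  obtain ⟨w, -, hw, hwl⟩ := hb (col v) hne.symm
  exact hK.proper (hN w hw) hwl.symm

end Critical

/-- The vertices outside all bags. -/
def outer (G : SimpleGraph V) (c : Fin 5 → V) : Set V :=
  {v | Hub G c v ∨ (∃ i, Ear G c i v) ∨ Far G c v}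

theorem IsC5.zero_notMem_outer (hc : IsC5 G c) : c 0 ∉ outer G c := by
  have hl := hc.lits
  rintro (h | ⟨i, h⟩ | h)
  · exact G.irrefl (h 0)
  · fin_cases i
    · exact G.irrefl h.1
    · exact hl.2.2.2.2.2.2.2.2.1 h.2.1.symm
    · exact hl.2.2.2.2.2.1 h.1
    · exact hl.2.2.2.2.2.2.2.2.1 h.1.symm
    · exact hl.2.2.2.2.2.1 h.2.2.1
  · exact h 1 hl.1

theorem IsC5.outer_ne_univ (hc : IsC5 G c) : outer G c ≠ Set.univ := fun h =>
  hc.zero_notMem_outer (h ▸ Set.mem_univ _)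

namespace Frame

/-- Supplies domination for `ne_and_not_seesAll`: a bag vertex missed by an ear with a far neighbor
is no b-vertex and has another color than that ear. -/
theorem bag_dominated [Finite V] (hF : Frame G c) (ho : Far G c o) (ha : Ear G c j a)
    (hao : G.Adj a o) (hv : Bag G c i v) (hav : ¬ G.Adj a v) (hw : G.Adj v w) : G.Adj a w := by
  have key : ∀ (c : Fin 5 → V) (i), Frame G c → Far G c o → Ear G c 0 a → Bag G c i v →
      G.Adj a w := by
    intro c i hF ho ha hv
    have hfar := hF.ear_bag_of_far ha ho hao
    fin_cases i
    · exact absurd (hF.ear_bag ha hv) hav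
    · rcases hF.nbr_bag hv hw with h | h | h | h | h | h
      · exact hfar.1 w h
      · exact hF.ear_bag ha h
      · exact (hF.hub_ear h ha).symm
      · exact hF.ear_succ ha h
      · exact absurd hao (hF.ear_two_far h ha ho).2
      · exact (hF.ear_succ h ha).symm
    · exact absurd (hfar.1 v hv) hav
    · exact absurd (hfar.2 v hv) hav
    · rcases hF.nbr_bag hv hw with h | h | h | h | h | h
      · exact hF.ear_bag ha h
      · exact hfar.2 w h
      · exact (hF.hub_ear h ha).symm
      · exact (hF.ear_succ h ha).symm
      · exact hF.ear_succ ha h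
      · exact absurd hao (hF.ear_two_far ha h ho).1
  exact key _ (i - j) (hF.rot j) (far_rot.2 ho) (ear_rot_zero.2 ha)
    (bag_rot.2 (by simpa using hv))

/-- Ears at consecutive positions are adjacent, and a pair at distance two leaves neither ear a far
neighbor. -/
theorem ear_same (hF : Frame G c) (ho : Far G c o) (hz : Ear G c j z) (hzo : G.Adj z o)
    (hv : Ear G c i v) (hvz : ¬ G.Adj v z) : Ear G c j v := by
  have key : ∀ (c : Fin 5 → V) (i), Frame G c → Far G c o → Ear G c 0 z → Ear G c i v →
      Ear G c 0 v := by
    intro c i hF ho hz hv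
    fin_cases i
    · exact hv
    · exact absurd (hF.ear_succ hz hv).symm hvz
    · exact absurd hzo (hF.ear_two_far hz hv ho).1
    · exact absurd hzo (hF.ear_two_far hv hz ho).2
    · exact absurd (hF.ear_succ hv hz) hvz
  exact ear_rot_zero.1 (key _ (i - j) (hF.rot j) (far_rot.2 ho) (ear_rot_zero.2 hz)
    (ear_rot.2 (by simpa using hv)))

theorem ear_bag_of_ear (hF : Frame G c) (ho : Far G c o) (hz : Ear G c j z) (hzo : G.Adj z o)
    (hv : Ear G c j v) (hx : Bag G c i x) (hvx : G.Adj v x) : G.Adj z x := by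
  have hfar := hF.ear_bag_of_far hz ho hzo
  obtain ⟨l, rfl⟩ : ∃ l, i = j + l := ⟨i - j, by simp⟩
  fin_cases l
  · exact hF.ear_bag hz (by simpa using hx)
  · exact absurd hvx (hF.ear_bag_succ hv hx)
  · exact hfar.1 x hx
  · exact hfar.2 x hx
  · exact absurd hvx (hF.ear_bag_pred hv hx)

/-- If the clique of vertices away from the cycle that contains `o` is a module with at least two
vertices, then `o` is not a b-vertex: otherwise the coloring would remain a b-coloring after
the deletion of all bags. -/
theorem not_seesAll_of_module [Finite V] (hF : Frame G c) (hK : Critical G col) (ho : Far G c o)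
    (hp : Far G c p) (hop : G.Adj o p)
    (hhub : ∀ q, Far G c q → G.Adj o q → ∀ d, Hub G c d → (G.Adj d o ↔ G.Adj d q)) :
    ¬ SeesAll G col Set.univ o := by
  intro hb
  have hom : ∀ q, Far G c q → G.Adj o q → ∀ z, (Hub G c z ∨ ∃ i, Ear G c i z) →
      (G.Adj z o ↔ G.Adj z q) := by
    rintro q hq hoq z (hz | ⟨i, hz⟩)
    · exact hhub q hq hoq z hz
    · exact ⟨hF.ear_far hz ho hq hoq, hF.ear_far hz hq ho hoq.symm⟩
  have hnb : ∀ l, l ≠ col o → (∃ q, Far G c q ∧ G.Adj o q ∧ col q = l) ∨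
      ∃ z, (Hub G c z ∨ ∃ i, Ear G c i z) ∧ G.Adj z o ∧ col z = l := by
    intro l hl
    obtain ⟨w, -, hw, hwl⟩ := hb l hl
    rcases hF.nbr_far ho hw with h | h | h
    · exact .inl ⟨w, h, hw, hwl⟩
    · exact .inr ⟨w, .inl h, hw.symm, hwl⟩
    · exact .inr ⟨w, .inr h, hw.symm, hwl⟩
  refine hK.critical (outer G c) hF.cyc.outer_ne_univ fun j => ?_
  -- Colors of the clique of `o`: its members share the outside neighbors of `o`, and all neighbors
  -- of `o` are outside the bags, so each member remains a b-vertex.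
  by_cases hj : ∃ q, Far G c q ∧ (q = o ∨ G.Adj o q) ∧ col q = j
  · obtain ⟨q, hq, hqo, rfl⟩ := hj
    refine ⟨q, .inr (.inr hq), rfl, fun l hl => ?_⟩
    by_cases hlo : l = col o
    · have hoq := hqo.resolve_left (fun h => hl (h ▸ hlo))
      exact ⟨o, .inr (.inr ho), hoq.symm, hlo.symm⟩
    · rcases hnb l hlo with ⟨w, hw, how, rfl⟩ | ⟨z, hz, hzo, rfl⟩
      · refine ⟨w, .inr (.inr hw), ?_, rfl⟩
        rcases hqo with rfl | hoq
        · exact how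
        · exact hF.far_trans hq ho hw hoq.symm how fun h => hl (h ▸ rfl)
      · refine ⟨z, hz.elim .inl fun h => .inr (.inl h), ?_, rfl⟩
        rcases hqo with rfl | hoq
        · exact hzo.symm
        · exact ((hom q hq hoq z hz).1 hzo).symm
  · push Not at hj
    have hjo : j ≠ col o := (hj o ho (.inl rfl)).symm
    rcases hnb j hjo with ⟨w, hw, how, hwj⟩ | ⟨a, ha, hao, haj⟩
    · exact absurd hwj (hj w hw (.inr how))
    have hao' := (hom p hp hop a ha).1 hao
    -- For a color not in the clique there are two candidates: the given b-vertex `v`, and the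
    -- neighbor `a` of `o` with the same color, which is complete to the clique.
    obtain ⟨v, rfl, hvb⟩ := hK.exists_seesAll j
    rcases hF.cases v with ⟨i, hv⟩ | hv
    · exfalso
      have hav : ¬ G.Adj a v := fun h => hK.proper h haj
      rcases ha with ha | ⟨l, ha⟩
      · exact hav (hF.hub_bag ha hv)
      · refine (hK.ne_and_not_seesAll (u := v) (v := a) ?_ (fun h => hav h.symm)
          fun w hw => hF.bag_dominated ho ha hao hv hav hw).1 haj.symm
        rintro rfl
        exact hF.far_bag ho hv hao.symm
    by_cases hfar : Far G c v
    · refine ⟨v, .inr (.inr hfar), rfl, fun l hl => ?_⟩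
      obtain ⟨w, -, hw, hwl⟩ := hvb l hl
      refine ⟨w, ?_, hw, hwl⟩
      rcases hF.nbr_far hfar hw with h | h | h
      · exact .inr (.inr h)
      · exact .inl h
      · exact .inr (.inl h)
    have hv' : Hub G c v ∨ ∃ i, Ear G c i v := by tauto
    -- If `v` sees `o`, a color that `v` saw only in a bag is found again on a neighbor of `o`.
    -- Otherwise `a` replaces `v` as b-vertex.
    by_cases hvo : G.Adj v o
    · refine ⟨v, hv'.elim .inl fun h => .inr (.inl h), rfl, fun l hl => ?_⟩
      obtain ⟨x, -, hx, hxl⟩ := hvb l hl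
      rcases hF.cases x with ⟨i, hxi⟩ | h
      · by_cases hlo : l = col o
        · exact ⟨o, .inr (.inr ho), hvo, hlo.symm⟩
        rcases hnb l hlo with ⟨w, hw, how, hwl⟩ | ⟨z, hz, hzo, hzl⟩
        · exact ⟨w, .inr (.inr hw), (hom w hw how v hv').1 hvo, hwl⟩
        · by_cases hvz : G.Adj v z
          · exact ⟨z, hz.elim .inl fun h => .inr (.inl h), hvz, hzl⟩
          · exfalso
            have hzx : ¬ G.Adj z x := fun h => hK.proper h (hzl.trans hxl.symm)
            rcases hz with hz | ⟨m, hz⟩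
            · exact hzx (hF.hub_bag hz hxi)
            · rcases hv' with hv' | ⟨m', hv'⟩
              · exact hvz (hF.hub_ear hv' hz)
              · exact hzx (hF.ear_bag_of_ear ho hz hzo (hF.ear_same ho hz hzo hv' hvz) hxi hx)
      · exact ⟨x, by rcases h with h | h | h <;> simp [outer, h], hx, hxl⟩
    · refine ⟨a, ha.elim .inl fun h => .inr (.inl h), haj, fun l hl => ?_⟩
      by_contra hcon
      have hmiss : ∀ w, (Hub G c w ∨ (∃ i, Ear G c i w) ∨ Far G c w) → G.Adj a w → col w ≠ l :=
        fun w hw haw hwl => hcon ⟨w, hw, haw, hwl⟩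
      have hlo : l ≠ col o := (hmiss o (.inr (.inr ho)) hao).symm
      rcases hnb l hlo with ⟨w, hw, how, hwl⟩ | ⟨z, hz, hzo, hzl⟩
      · exact hmiss w (.inr (.inr hw)) ((hom w hw how a ha).1 hao) hwl
      have haz : ¬ G.Adj a z := fun h => hmiss z (hz.elim .inl fun h => .inr (.inl h)) h hzl
      have hazne : a ≠ z := by rintro rfl; exact hl hzl.symm
      obtain ⟨x, -, hx, hxl⟩ := hvb l (haj ▸ hl)
      have hav : ¬ G.Adj a v := fun h => hK.proper h haj
      have hzx : ¬ G.Adj z x := fun h => hK.proper h (hzl.trans hxl.symm)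
      have hzo' := (hom p hp hop z hz).1 hzo
      have hvo' : ¬ G.Adj v p := fun h => hvo ((hom p hp hop v hv').2 h)
      -- `a`, `z` and `v` are all hubs or all ears at one position, so two nonadjacent cycle
      -- vertices `s`, `t` are common neighbors. With `o` and `p` they form the pattern of the
      -- common-neighbor lemmas, which make `x` adjacent to `a`.
      obtain ⟨s, t, hst, hst', hs, ht, has, hat, hzs, hzt, hvs, hvt, hxst⟩ : ∃ s t, ¬ G.Adj s t ∧
          s ≠ t ∧ (∀ q, Far G c q → ¬ G.Adj q s) ∧ (∀ q, Far G c q → ¬ G.Adj q t) ∧ G.Adj a s ∧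
          G.Adj a t ∧ G.Adj z s ∧ G.Adj z t ∧ G.Adj v s ∧ G.Adj v t ∧
          (Far G c x ∨ ((Hub G c x ∨ ∃ i, Ear G c i x) ∧ G.Adj x s ∧ G.Adj x t)) := by
        rcases ha with ha | ⟨m, ha⟩
        · have hz' : Hub G c z := hz.resolve_right fun ⟨_, h⟩ => haz (hF.hub_ear ha h)
          have hv'' : Hub G c v := hv'.resolve_right fun ⟨_, h⟩ => hav (hF.hub_ear ha h)
          refine ⟨c 0, c 2, (hF.cyc 0).2, hF.cyc.ne_zero_two, fun q hq => hq 0, fun q hq => hq 2,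
            ha 0, ha 2, hz' 0, hz' 2, hv'' 0, hv'' 2, ?_⟩
          rcases hF.cases x with ⟨i, h⟩ | ⟨i, h⟩ | h | h
          · exact absurd (hF.hub_bag hz' h) hzx
          · exact absurd (hF.hub_ear hz' h) hzx
          · exact .inr ⟨.inl h, h 0, h 2⟩
          · exact .inl h
        · have ear : ∀ w, (Hub G c w ∨ ∃ i, Ear G c i w) → ¬ G.Adj w a → Ear G c m w := by
            rintro w (hw | ⟨i, hw⟩) hwa
            · exact absurd (hF.hub_ear hw ha) hwa
            · exact hF.ear_same ho ha hao hw hwa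
          have hz' := ear z hz fun h => haz h.symm
          have hv'' := ear v hv' fun h => hav h.symm
          refine ⟨c m, c (m + 2), (hF.cyc m).2, fun h => ?_, fun q hq => hq _, fun q hq => hq _,
            ha.1, ha.2.1, hz'.1, hz'.2.1, hv''.1, hv''.2.1, ?_⟩
          · have := (hF.cyc.bag_self m).2.2.2.2
            have h3 := (hF.cyc (m + 2)).1
            rw [← h, add_assoc] at h3
            exact this h3
          rcases hF.cases x with ⟨i, h⟩ | ⟨i, h⟩ | h | h
          · exact absurd (hF.ear_bag_of_ear ho hz' hzo hv'' h hx) hzx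
          · have := hF.ear_same ho hz' hzo h fun h => hzx h.symm
            exact .inr ⟨.inr ⟨m, this⟩, this.1, this.2.1⟩
          · exact absurd (hF.hub_ear h hz').symm hzx
          · exact .inl h
      rcases hxst with hx' | ⟨hx', hxs, hxt⟩
      · refine hmiss x (.inr (.inr hx')) (adj_of_common_neighbor hF.free (hs o ho) ⟨hao, has⟩
          ⟨hvo, hvs⟩ ⟨fun h => ?_, hs x hx'⟩ hav hx.symm).symm hxl
        exact hmiss x (.inr (.inr hx')) ((hom x hx' h.symm a ha).1 hao) hxl
      · exact hmiss x (hx'.elim .inl fun h => .inr (.inl h))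
          (adj_of_common_neighbors hF.free hst hst' hop (hs o ho) (ht o ho) (hs p hp) (ht p hp)
            ⟨hao, hao', has, hat⟩ ⟨hzo, hzo', hzs, hzt⟩ ⟨hvo, hvo', hvs, hvt⟩
            ⟨hom p hp hop x hx', hxs, hxt⟩ haz hazne hav (fun h => hzx h.symm) hx.symm).symm hxl

theorem three_colors (hF : Frame G c) (hK : Critical G col) (l m : κ) :
    ∃ i, col (c i) ≠ l ∧ col (c i) ≠ m := by
  by_contra! h
  have h' : ∀ i, col (c i) = l ∨ col (c i) = m := fun i => or_iff_not_imp_left.2 (h i)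
  have hc := hF.cyc.lits
  have h01 := hK.proper hc.1
  have h12 := hK.proper hc.2.1
  have h23 := hK.proper hc.2.2.1
  have h34 := hK.proper hc.2.2.2.1
  have h40 := hK.proper hc.2.2.2.2.1
  have := h' 0
  have := h' 1
  have := h' 2
  have := h' 3
  have := h' 4
  grind

/-- A b-vertex away from the cycle has an ear as a neighbor and no neighbor away from the cycle. -/
theorem far_of_seesAll [Finite V] (hF : Frame G c) (hK : Critical G col) (ho : Far G c o)
    (hb : SeesAll G col Set.univ o) :
    (∀ p, Far G c p → ¬ G.Adj o p) ∧ ∃ i y, Ear G c i y ∧ G.Adj y o := by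
  by_cases hear : ∃ i y, Ear G c i y ∧ G.Adj y o
  · refine ⟨fun p hp hop => ?_, hear⟩
    refine hF.not_seesAll_of_module hK ho hp hop (fun q hq hoq d hd => ⟨?_, ?_⟩) hb
    · exact hF.hub_far hd ho hq hoq (.inr hear)
    · obtain ⟨i, y, hy, hyo⟩ := hear
      exact hF.hub_far hd hq ho hoq.symm (.inr ⟨i, y, hy, hF.ear_far hy ho hq hoq hyo⟩)
  · exfalso
    -- Hubs never carry a color of the cycle. Without ears around `o`, the cycle colors other than
    -- that of `o`, at least two, occur on far neighbors, so the clique of `o` has three vertices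
    -- and hubs treat it uniformly.
    have hsee : ∀ i, col (c i) ≠ col o → ∃ q, Far G c q ∧ G.Adj o q ∧ col q = col (c i) := by
      intro i hi
      obtain ⟨w, -, hw, hwl⟩ := hb _ hi
      rcases hF.nbr_far ho hw with h | h | ⟨j, h⟩
      · exact ⟨w, h, hw, hwl⟩
      · exact absurd hwl (hK.proper (h i))
      · exact absurd ⟨j, w, h, hw.symm⟩ hear
    obtain ⟨i, hi, -⟩ := hF.three_colors hK (col o) (col o)
    obtain ⟨p, hp, hop, hpi⟩ := hsee i hi
    obtain ⟨j, hjo, hjp⟩ := hF.three_colors hK (col o) (col p)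
    obtain ⟨q, hq, hoq, hqj⟩ := hsee j hjo
    have hqp : q ≠ p := by rintro rfl; exact hjp hqj.symm
    refine hF.not_seesAll_of_module hK ho hp hop (fun r hr hor d hd => ⟨?_, ?_⟩) hb
    · refine hF.hub_far hd ho hr hor (.inl ?_)
      by_cases hrp : r = p
      · exact ⟨q, hq, hoq, hrp ▸ hqp⟩
      · exact ⟨p, hp, hop, fun h => hrp h.symm⟩
    · refine hF.hub_far hd hr ho hor.symm (.inl ?_)
      by_cases hrp : r = p
      · subst hrp
        exact ⟨q, hq, hF.far_trans hr ho hq hor.symm hoq hqp.symm, hoq.ne'⟩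
      · exact ⟨p, hp, hF.far_trans hr ho hp hor.symm hop hrp, hop.ne'⟩

end Frame

end BPerfect

/-! ### No ears, and ears at one position. -/

namespace BPerfect

universe u

variable {V : Type u} {G : SimpleGraph V} {κ : Type*} {col : V → κ}
variable {c : Fin 5 → V} {i j : Fin 5} {a b u v w x y z o p q d s t : V}

namespace Frame

theorem exists_consecutive_of_four : ∀ a b c d : Fin 5, [a, b, c, d].Nodup →
    ∃ i, i ∈ [a, b, c, d] ∧ i + 1 ∈ [a, b, c, d] ∧ i + 4 ∈ [a, b, c, d] := by
  decide

/-- The graph is a blow-up of the 5-cycle, and a bag containing a b-vertex is a singleton because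
its vertices are twins. Four colors need b-vertices in four bags, so some bag with a b-vertex lies
between two singletons, and that b-vertex sees only two colors. -/
theorem false_of_no_ear [Finite V] (hF : Frame G c) (hK : Critical G col)
    (hcov : ∀ v, ∃ i, Bag G c i v) (hno : ∀ i v, ¬ Ear G c i v) : False := by
  have hub : ∀ v, ¬ Hub G c v := fun v h => by
    obtain ⟨i, hi⟩ := hcov v
    exact G.irrefl (hF.hub_bag h hi)
  have nb : ∀ {i v w}, Bag G c i v → G.Adj v w → Bag G c (i + 1) w ∨ Bag G c (i + 4) w := by
    intro i v w hv hw
    rcases hF.nbr_bag hv hw with h | h | h | h | h | h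
    · exact .inl h
    · exact .inr h
    · exact absurd h (hub w)
    all_goals exact absurd h (hno _ w)
  have uniq : ∀ {i u v}, Bag G c i v → SeesAll G col Set.univ v → Bag G c i u → u = v := by
    intro i u v hv hb hu
    by_contra hne
    refine (hK.ne_and_not_seesAll (u := v) (v := u) (Ne.symm hne) (hF.bag_bag hv hu)
      fun w hw => ?_).2 hb
    rcases nb hv hw with h | h
    · exact hF.bag_succ hu h
    · have e : ∀ i : Fin 5, i + 4 + 1 = i := by decide
      exact (hF.bag_succ h ((e i).symm ▸ hu)).symm
  choose f hf hb using hK.exists_seesAll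
  choose g hg using hcov
  have inj : ∀ j l, j ≠ l → g (f j) ≠ g (f l) := by
    intro j l hjl h
    have : f j = f l := uniq (hg (f l)) (hb l) (h ▸ hg (f j))
    exact hjl ((hf j).symm.trans ((congrArg col this).trans (hf l)))
  obtain ⟨j₀, -⟩ := hK.four (col (c 0)) (col (c 0)) (col (c 0))
  obtain ⟨j₁, h₁, -⟩ := hK.four j₀ j₀ j₀
  obtain ⟨j₂, h₂, h₂', -⟩ := hK.four j₀ j₁ j₁
  obtain ⟨j₃, h₃, h₃', h₃''⟩ := hK.four j₀ j₁ j₂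
  obtain ⟨i, hi, hi1, hi4⟩ := exists_consecutive_of_four (g (f j₀)) (g (f j₁)) (g (f j₂))
    (g (f j₃)) (by simp [inj j₀ j₁ h₁.symm, inj j₀ j₂ h₂.symm, inj j₀ j₃ h₃.symm,
      inj j₁ j₂ h₂'.symm, inj j₁ j₃ h₃'.symm, inj j₂ j₃ h₃''.symm])
  have ex : ∀ i ∈ [g (f j₀), g (f j₁), g (f j₂), g (f j₃)],
      ∃ v, Bag G c i v ∧ SeesAll G col Set.univ v := by
    intro i hi
    simp only [List.mem_cons, List.not_mem_nil, or_false] at hi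
    rcases hi with rfl | rfl | rfl | rfl
    all_goals exact ⟨_, hg _, hb _⟩
  obtain ⟨v, hv, hvb⟩ := ex i hi
  obtain ⟨u, hu, hub⟩ := ex _ hi1
  obtain ⟨w, hw, hwb⟩ := ex _ hi4
  obtain ⟨m, hmv, hmu, hmw⟩ := hK.four (col v) (col u) (col w)
  obtain ⟨x, -, hx, hxm⟩ := hvb m hmv
  rcases nb hv hx with h | h
  · exact hmu ((uniq hu hub h) ▸ hxm.symm)
  · exact hmw ((uniq hw hwb h) ▸ hxm.symm)

/-- The adjacencies between the classes of vertices, spelled out for the five positions. -/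
structure Table (G : SimpleGraph V) (c : Fin 5 → V) : Prop where
  a01 : ∀ u v, Bag G c 0 u → Bag G c 1 v → G.Adj u v
  a12 : ∀ u v, Bag G c 1 u → Bag G c 2 v → G.Adj u v
  a23 : ∀ u v, Bag G c 2 u → Bag G c 3 v → G.Adj u v
  a34 : ∀ u v, Bag G c 3 u → Bag G c 4 v → G.Adj u v
  a40 : ∀ u v, Bag G c 4 u → Bag G c 0 v → G.Adj u v
  y0 : ∀ y v, Ear G c 0 y → Bag G c 0 v → G.Adj y v
  dB : ∀ d i v, Hub G c d → Bag G c i v → G.Adj d v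
  dY : ∀ d i y, Hub G c d → Ear G c i y → G.Adj d y
  nb0 : ∀ v w, Bag G c 0 v → G.Adj v w →
    Bag G c 1 w ∨ Bag G c 4 w ∨ Hub G c w ∨ Ear G c 0 w ∨ Ear G c 2 w ∨ Ear G c 3 w
  nb1 : ∀ v w, Bag G c 1 v → G.Adj v w →
    Bag G c 2 w ∨ Bag G c 0 w ∨ Hub G c w ∨ Ear G c 1 w ∨ Ear G c 3 w ∨ Ear G c 4 w
  nb2 : ∀ v w, Bag G c 2 v → G.Adj v w →
    Bag G c 3 w ∨ Bag G c 1 w ∨ Hub G c w ∨ Ear G c 2 w ∨ Ear G c 4 w ∨ Ear G c 0 w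
  nb3 : ∀ v w, Bag G c 3 v → G.Adj v w →
    Bag G c 4 w ∨ Bag G c 2 w ∨ Hub G c w ∨ Ear G c 3 w ∨ Ear G c 0 w ∨ Ear G c 1 w
  nb4 : ∀ v w, Bag G c 4 v → G.Adj v w →
    Bag G c 0 w ∨ Bag G c 3 w ∨ Hub G c w ∨ Ear G c 4 w ∨ Ear G c 1 w ∨ Ear G c 2 w
  nbY : ∀ v w, Ear G c 0 v → G.Adj v w →
    Bag G c 0 w ∨ Bag G c 2 w ∨ Bag G c 3 w ∨ Hub G c w ∨ Far G c w ∨ Ear G c 0 w ∨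
      Ear G c 1 w ∨ Ear G c 4 w

theorem table [Finite V] (hF : Frame G c) : Table G c where
  a01 _ _ := hF.bag_succ
  a12 _ _ := hF.bag_succ
  a23 _ _ := hF.bag_succ
  a34 _ _ := hF.bag_succ
  a40 _ _ := hF.bag_succ
  y0 _ _ := hF.ear_bag
  dB _ _ _ := hF.hub_bag
  dY _ _ _ := hF.hub_ear
  nb0 _ _ := hF.nbr_bag
  nb1 _ _ := hF.nbr_bag
  nb2 _ _ := hF.nbr_bag
  nb3 _ _ := hF.nbr_bag
  nb4 _ _ := hF.nbr_bag
  nbY _ _ := hF.nbr_ear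

/-- Ears at `c 0` only, all of them complete to the bag of `c 3`, one of them also to the bag
of `c 2`. -/
theorem false_of_ear_zero_of_complete [Finite V] (hF : Frame G c) (hK : Critical G col)
    (hy : Ear G c 0 y) (hno : ∀ i v, i ≠ 0 → ¬ Ear G c i v)
    (h3 : ∀ y t, Ear G c 0 y → Bag G c 3 t → G.Adj y t) (hy2 : ∀ t, Bag G c 2 t → G.Adj y t) :
    False := by
  have hP := hK.proper
  have hS : ∀ u v, G.Adj u v → G.Adj v u := fun _ _ h => h.symm
  have b0 := hF.cyc.bag_self 0
  have b2 := hF.cyc.bag_self 2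
  have b3 := hF.cyc.bag_self 3
  have e1 : ∀ v, ¬ Ear G c 1 v := fun v => hno 1 v (by decide)
  have e2 : ∀ v, ¬ Ear G c 2 v := fun v => hno 2 v (by decide)
  have e3 : ∀ v, ¬ Ear G c 3 v := fun v => hno 3 v (by decide)
  have e4 : ∀ v, ¬ Ear G c 4 v := fun v => hno 4 v (by decide)
  obtain ⟨a01, a12, a23, a34, a40, y0, dB, dY, nb0, nb1, nb2, nb3, nb4, nbY⟩ := hF.table
  have y2 : ∀ y, Ear G c 0 y → G.Adj y (c 2) := fun _ h => h.2.1
  have far : ∀ o, Far G c o → ¬ SeesAll G col Set.univ o := by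
    intro o ho hb
    have hfar := (hF.far_of_seesAll hK ho hb).1
    have key : ∀ i, (i = 2 ∨ i = 3) → col (c i) = col o := by
      intro i hi
      by_contra hne
      obtain ⟨w, -, hw, hwl⟩ := hb _ hne
      rcases hF.nbr_far ho hw with h | h | ⟨j, h⟩
      · exact hfar w h hw
      · exact hP (h i) hwl
      · obtain rfl : j = 0 := by_contra fun hj => hno j w hj h
        rcases hi with rfl | rfl
        · exact hP h.2.1 hwl
        · exact hP h.2.2.1 hwl
    exact hP (hF.cyc 2).1 ((key 2 (.inl rfl)).trans (key 3 (.inr rfl)).symm)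
  have dom := fun u v => @Critical.ne_and_not_seesAll _ _ _ _ u v hK
  -- The ear `y` dominates the bags of `c 4` and `c 1`. Below, `c 2` dominates its own bag, and the
  -- bags of `c 0` and `c 3` consist of twins.
  have n4 : ∀ v, Bag G c 4 v → ¬ SeesAll G col Set.univ v := by
    intro v hv
    refine (dom v y ?_ (fun h => hF.ear_bag_pred hy hv h.symm) (by grind)).2
    rintro rfl; grind
  have n1 : ∀ v, Bag G c 1 v → ¬ SeesAll G col Set.univ v := by
    intro v hv
    refine (dom v y ?_ (fun h => hF.ear_bag_succ hy hv h.symm) (by grind)).2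
    rintro rfl; grind
  have u0 : ∀ u v, Bag G c 0 v → SeesAll G col Set.univ v → Bag G c 0 u → u = v := by
    intro u v hv hb hu
    by_contra hne
    exact (dom v u (Ne.symm hne) (hF.bag_bag hv hu) (by grind)).2 hb
  have u3 : ∀ u v, Bag G c 3 v → SeesAll G col Set.univ v → Bag G c 3 u → u = v := by
    intro u v hv hb hu
    by_contra hne
    exact (dom v u (Ne.symm hne) (hF.bag_bag hv hu) (by grind)).2 hb
  have u2 : ∀ v, Bag G c 2 v → SeesAll G col Set.univ v → v = c 2 := by
    intro v hv hb
    by_contra hne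
    exact (dom v (c 2) hne (hF.bag_bag hv b2) (by grind)).2 hb
  have nY : ∀ v, Ear G c 0 v → SeesAll G col Set.univ v → ∀ t, Bag G c 2 t → G.Adj v t := by
    intro v hv hb t ht
    by_contra hvt
    have hE : ∀ w, Ear G c 0 w → ¬ G.Adj v w := fun w hw h =>
      hvt ((hF.ear_bag_of_adj hv hw h).1 t ht)
    have hO : ∀ w, Far G c w → ¬ G.Adj v w := fun w hw h =>
      hvt ((hF.ear_bag_of_far hv hw h).1 t ht)
    refine (dom v y ?_ (hE y hy) (by grind)).2 hb
    rintro rfl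
    exact hvt (hy2 t ht)
  have loc : ∀ v, SeesAll G col Set.univ v → (v = c 0 ∧ ∀ u, Bag G c 0 u → u = c 0) ∨ v = c 2 ∨
      (v = c 3 ∧ ∀ u, Bag G c 3 u → u = c 3) ∨
      (Ear G c 0 v ∧ ∀ t, Bag G c 2 t → G.Adj v t) ∨ Hub G c v := by
    intro v hb
    rcases hF.cases v with ⟨i, h⟩ | ⟨i, h⟩ | h | h
    · fin_cases i
      · have := u0 _ _ h hb b0
        exact .inl ⟨this.symm, fun u hu => (u0 _ _ h hb hu).trans this.symm⟩
      · exact absurd hb (n1 v h)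
      · exact .inr (.inl (u2 v h hb))
      · have := u3 _ _ h hb b3
        exact .inr (.inr (.inl ⟨this.symm, fun u hu => (u3 _ _ h hb hu).trans this.symm⟩))
      · exact absurd hb (n4 v h)
    · obtain rfl : i = 0 := by_contra fun hj => hno i v hj h
      exact .inr (.inr (.inr (.inl ⟨h, nY v h hb⟩)))
    · exact .inr (.inr (.inr (.inr h)))
    · exact absurd hb (far v h)
  -- Otherwise the b-vertices of the colors of `c 2` and `c 3` are these vertices themselves and the
  -- bag of `c 3` is a singleton; then no neighbor of `c 2` can have the color of `c 0`.
  have hc0 : col (c 0) = col (c 2) ∨ col (c 0) = col (c 3) := by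
    by_contra! hne
    obtain ⟨v, hv, hvb⟩ := hK.exists_seesAll (col (c 2))
    have hv2 : v = c 2 := by
      have := loc v hvb
      grind
    obtain ⟨w, hw, hwb⟩ := hK.exists_seesAll (col (c 3))
    have hw3 : ∀ u, Bag G c 3 u → u = c 3 := by
      have := loc w hwb
      grind
    subst hv2
    obtain ⟨x, -, hx, hxl⟩ := hvb _ hne.1
    have := nb2 _ _ b2 hx
    grind
  -- Any other color would have a b-vertex that is a hub or a complete ear, but these see all three
  -- bags.
  have hQ : ∀ a, (Bag G c 0 a ∨ Bag G c 2 a ∨ Bag G c 3 a) →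
      col a = col (c 2) ∨ col a = col (c 3) := by
    intro a ha
    obtain ⟨v, hv, hvb⟩ := hK.exists_seesAll (col a)
    have := loc v hvb
    grind
  have hR : ∀ j, j ≠ col (c 2) → j ≠ col (c 3) → ∃ z, col z = j ∧ SeesAll G col Set.univ z ∧
      ((Ear G c 0 z ∧ ∀ t, Bag G c 2 t → G.Adj z t) ∨ Hub G c z) := by
    intro j h2 h3
    obtain ⟨v, hv, hvb⟩ := hK.exists_seesAll j
    refine ⟨v, hv, hvb, ?_⟩
    have := loc v hvb
    grind
  have hne : outer G c ∪ {c 2, c 3} ≠ Set.univ := by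
    intro h
    have h0 : c 0 ∈ outer G c ∪ {c 2, c 3} := h ▸ Set.mem_univ _
    rcases h0 with h0 | h0 | h0
    · exact hF.cyc.zero_notMem_outer h0
    · exact hF.cyc.ne_zero_two h0
    · have := hF.cyc.lits
      rw [Set.mem_singleton_iff] at h0
      grind
  have hmem : ∀ z, ((Ear G c 0 z ∧ ∀ t, Bag G c 2 t → G.Adj z t) ∨ Hub G c z) →
      z ∈ outer G c ∪ {c 2, c 3} := by
    rintro z (h | h)
    · exact .inl (.inr (.inl ⟨0, h.1⟩))
    · exact .inl (.inl h)
  have m2 : c 2 ∈ outer G c ∪ {c 2, c 3} := .inr (.inl rfl)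
  have m3 : c 3 ∈ outer G c ∪ {c 2, c 3} := .inr (.inr rfl)
  -- All bags are deleted except for `c 2` and `c 3`, which serve as b-vertices of their colors. By
  -- `hQ` the b-ears lose no other color.
  refine hK.critical _ hne fun j => ?_
  by_cases hj2 : j = col (c 2)
  · refine ⟨c 2, m2, hj2.symm, fun l hl => ?_⟩
    by_cases hl3 : l = col (c 3)
    · exact ⟨c 3, m3, (hF.cyc 2).1, hl3.symm⟩
    · obtain ⟨z, hz, -, hzl⟩ := hR l hl hl3
      exact ⟨z, hmem z hzl, by grind, hz⟩
  by_cases hj3 : j = col (c 3)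
  · refine ⟨c 3, m3, hj3.symm, fun l hl => ?_⟩
    by_cases hl2 : l = col (c 2)
    · exact ⟨c 2, m2, (hF.cyc 2).1.symm, hl2.symm⟩
    · obtain ⟨z, hz, -, hzl⟩ := hR l hl2 hl
      exact ⟨z, hmem z hzl, by grind, hz⟩
  obtain ⟨v, hv, hvb, hvl⟩ := hR j hj2 hj3
  refine ⟨v, hmem v hvl, hv, fun l hl => ?_⟩
  by_cases hl2 : l = col (c 2)
  · exact ⟨c 2, m2, by grind, hl2.symm⟩
  by_cases hl3 : l = col (c 3)
  · exact ⟨c 3, m3, by grind, hl3.symm⟩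
  obtain ⟨z, hz, -, hzl⟩ := hR l hl2 hl3
  obtain ⟨x, -, hx, hxl⟩ := hvb l hl
  rcases hvl with ⟨hv0, -⟩ | hv'
  · have hxo : x ∈ outer G c := by
      rcases nbY _ _ hv0 hx with h | h | h | h | h | h | h | h
      · exact ((hQ x (.inl h)).elim (fun e => hl2 (hxl.symm.trans e))
          fun e => hl3 (hxl.symm.trans e)).elim
      · exact ((hQ x (.inr (.inl h))).elim (fun e => hl2 (hxl.symm.trans e))
          fun e => hl3 (hxl.symm.trans e)).elim
      · exact ((hQ x (.inr (.inr h))).elim (fun e => hl2 (hxl.symm.trans e))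
          fun e => hl3 (hxl.symm.trans e)).elim
      · exact .inl h
      · exact .inr (.inr h)
      all_goals exact .inr (.inl ⟨_, h⟩)
    exact ⟨x, .inl hxo, hx, hxl⟩
  -- A hub that loses a bag vertex `x` sees instead the b-vertex `z` of that color: `z` is no hub,
  -- as it would see `x`, hence an ear.
  rcases hF.cases x with ⟨i, hi⟩ | h
  · refine ⟨z, hmem z hzl, ?_, hz⟩
    rcases hzl with h | h
    · exact dY v 0 z hv' h.1
    · exact absurd (hz.trans hxl.symm) (hP (dB z i x h hi))
  · exact ⟨x, .inl (by rcases h with h | h | h <;> simp [outer, h]), hx, hxl⟩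

/-- Ears at `c 0` only, all of them complete to the bag of `c 3`. -/
theorem false_of_ear_zero [Finite V] (hF : Frame G c) (hK : Critical G col)
    (hmod : (∀ i y o, Ear G c i y → Far G c o → ¬ G.Adj y o) →
      ∀ v, (∃ i, Bag G c i v) ∨ ∃ i, Ear G c i v)
    (hy : Ear G c 0 y) (hno : ∀ i v, i ≠ 0 → ¬ Ear G c i v)
    (h3 : ∀ y t, Ear G c 0 y → Bag G c 3 t → G.Adj y t) : False := by
  have hplus : ∀ y, Ear G c 0 y → ∃ t, Bag G c 2 t ∧ ¬ G.Adj y t := by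
    intro y hy
    by_contra! h
    exact hF.false_of_ear_zero_of_complete hK hy hno h3 h
  have hP := hK.proper
  have hS : ∀ u v, G.Adj u v → G.Adj v u := fun _ _ h => h.symm
  have b0 := hF.cyc.bag_self 0
  have b1 := hF.cyc.bag_self 1
  have b2 := hF.cyc.bag_self 2
  have b3 := hF.cyc.bag_self 3
  have e1 : ∀ v, ¬ Ear G c 1 v := fun v => hno 1 v (by decide)
  have e2 : ∀ v, ¬ Ear G c 2 v := fun v => hno 2 v (by decide)
  have e3 : ∀ v, ¬ Ear G c 3 v := fun v => hno 3 v (by decide)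
  have e4 : ∀ v, ¬ Ear G c 4 v := fun v => hno 4 v (by decide)
  have y2 : ∀ y, Ear G c 0 y → G.Adj y (c 2) := fun _ h => h.2.1
  -- Incomplete ears have no far neighbors, so the module argument applies.
  have hcov : ∀ v, (∃ i, Bag G c i v) ∨ Ear G c 0 v := by
    intro v
    have hfar : ∀ i y o, Ear G c i y → Far G c o → ¬ G.Adj y o := by
      intro i y o hy ho hyo
      obtain rfl : i = 0 := by_contra fun hj => hno i y hj hy
      obtain ⟨t, ht, hyt⟩ := hplus y hy
      exact hyt ((hF.ear_bag_of_far hy ho hyo).1 t ht)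
    rcases hmod hfar v with h | ⟨i, h⟩
    · exact .inl h
    · obtain rfl : i = 0 := by_contra fun hj => hno i v hj h
      exact .inr h
  obtain ⟨a01, a12, a23, a34, a40, y0, dB, dY, nb0, nb1, nb2, nb3, nb4, nbY⟩ := hF.table
  have hub : ∀ v, ¬ Hub G c v := by
    intro v hv
    rcases hcov v with ⟨i, h⟩ | h
    · exact G.irrefl (dB v i v hv h)
    · exact G.irrefl (dY v 0 v hv h)
  have far : ∀ v, ¬ Far G c v := by
    intro v hv
    rcases hcov v with ⟨i, h⟩ | h
    · exact hv _ h.1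
    · exact hv _ h.1
  have stable : ∀ y z, Ear G c 0 y → Ear G c 0 z → ¬ G.Adj y z := by
    intro y z hy hz h
    obtain ⟨t, ht, hyt⟩ := hplus y hy
    exact hyt ((hF.ear_bag_of_adj hy hz h).1 t ht)
  have s3 : ∀ t, Bag G c 3 t → t = c 3 := by
    intro t ht
    obtain ⟨s, hs, hys⟩ := hplus y hy
    exact hF.bag_three_eq hy hs ht hys
  have dom := fun u v => @Critical.ne_and_not_seesAll _ _ _ _ u v hK
  have n4 : ∀ v, Bag G c 4 v → ¬ SeesAll G col Set.univ v := by
    intro v hv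
    refine (dom v y ?_ (fun h => hF.ear_bag_pred hy hv h.symm) (by grind)).2
    rintro rfl; grind
  have u0 : ∀ v, Bag G c 0 v → SeesAll G col Set.univ v → v = c 0 := by
    intro v hv hb
    by_contra hne
    exact (dom v (c 0) hne (hF.bag_bag hv b0) (by grind)).2 hb
  have u1 : ∀ v, Bag G c 1 v → SeesAll G col Set.univ v → v = c 1 := by
    intro v hv hb
    by_contra hne
    exact (dom v (c 1) hne (hF.bag_bag hv b1) (by grind)).2 hb
  have u2 : ∀ v, Bag G c 2 v → SeesAll G col Set.univ v → v = c 2 := by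
    intro v hv hb
    by_contra hne
    exact (dom v (c 2) hne (hF.bag_bag hv b2) (by grind)).2 hb
  -- Two b-ears of different colors would each see the color of the other in the bag of `c 2`,
  -- against the nestedness of their neighborhoods there.
  have uY : ∀ y z, Ear G c 0 y → Ear G c 0 z → SeesAll G col Set.univ y →
      SeesAll G col Set.univ z → col y = col z := by
    intro y z hy hz hyb hzb
    by_contra hne
    obtain ⟨s, -, hs, hsl⟩ := hyb _ (Ne.symm hne)
    obtain ⟨t, -, ht, htl⟩ := hzb _ hne
    have hys : Bag G c 2 s := by
      have := nbY _ _ hy hs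
      grind
    have hzt : Bag G c 2 t := by
      have := nbY _ _ hz ht
      grind
    exact hP (hF.ear_matching hy hz hys hzt hs ht fun h => hP h htl.symm) hsl.symm
  have h02 : SeesAll G col Set.univ (c 2) → col (c 0) = col (c 2) ∨ col (c 0) = col (c 3) := by
    intro hb
    by_contra! hne
    obtain ⟨x, -, hx, hxl⟩ := hb _ hne.1
    have := nb2 _ _ b2 hx
    grind
  have h1y : ∀ y, Ear G c 0 y → SeesAll G col Set.univ y →
      col (c 1) = col y ∨ col (c 1) = col (c 3) := by
    intro y hy hb
    by_contra! hne
    obtain ⟨x, -, hx, hxl⟩ := hb _ hne.1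
    have := nbY _ _ hy hx
    grind
  -- All b-vertices have one of three colors: that of `c 3`, a color `α` shared by `c 0` and `c 2`,
  -- and a color `β` shared by `c 1` and the ears. A fourth color is then impossible.
  obtain ⟨α, hα⟩ : ∃ α, ∀ v, (v = c 0 ∨ v = c 2) → SeesAll G col Set.univ v →
      col v = α ∨ col v = col (c 3) := by
    by_cases hb : SeesAll G col Set.univ (c 2)
    · exact ⟨col (c 2), by grind⟩
    · exact ⟨col (c 0), by grind⟩
  obtain ⟨β, hβ⟩ : ∃ β, ∀ v, (v = c 1 ∨ Ear G c 0 v) → SeesAll G col Set.univ v →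
      col v = β ∨ col v = col (c 3) := by
    by_cases hb : ∃ y, Ear G c 0 y ∧ SeesAll G col Set.univ y
    · obtain ⟨y, hy, hyb⟩ := hb
      exact ⟨col y, by grind⟩
    · exact ⟨col (c 1), by grind⟩
  obtain ⟨m, hmα, hmβ, hm3⟩ := hK.four α β (col (c 3))
  obtain ⟨v, rfl, hvb⟩ := hK.exists_seesAll m
  rcases hcov v with ⟨i, h⟩ | h
  · fin_cases i
    · exact (hα v (.inl (u0 v h hvb)) hvb).elim hmα hm3
    · exact (hβ v (.inl (u1 v h hvb)) hvb).elim hmβ hm3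
    · exact (hα v (.inr (u2 v h hvb)) hvb).elim hmα hm3
    · exact hm3 (s3 v h ▸ rfl)
    · exact n4 v h hvb
  · exact (hβ v (.inr h) hvb).elim hmβ hm3

end Frame

end BPerfect

/-! ### Ears at one position concluded, and ears at two consecutive positions. -/

namespace BPerfect

universe u

variable {V : Type u} {G : SimpleGraph V} {κ : Type*} {col : V → κ}
variable {c : Fin 5 → V} {i j : Fin 5} {a b u v w x y z o p q d s t : V}

namespace Frame

/-- Ears at `c 0` only. -/
theorem false_of_ear_zero_only [Finite V] (hF : Frame G c) (hK : Critical G col)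
    (hmod : (∀ i y o, Ear G c i y → Far G c o → ¬ G.Adj y o) →
      ∀ v, (∃ i, Bag G c i v) ∨ ∃ i, Ear G c i v)
    (hy : Ear G c 0 y) (hno : ∀ i v, i ≠ 0 → ¬ Ear G c i v) : False := by
  by_cases h3 : ∀ y t, Ear G c 0 y → Bag G c 3 t → G.Adj y t
  · exact hF.false_of_ear_zero hK hmod hy hno h3
  push Not at h3
  obtain ⟨z, t, hz, ht, hzt⟩ := h3
  -- An ear incomplete to the bag of `c 3` makes the bag of `c 2` a singleton. In the mirror image
  -- every ear is then complete to the required bag.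
  refine (hF.mirror 0).false_of_ear_zero (y := y) hK (fun h v => ?_) (ear_mirror_zero.2 hy)
    (fun i v hi h => hno _ v ?_ (ear_mirror.1 h)) fun y s hy hs => ?_
  · rcases hmod (fun i y o hy ho => h (0 - i) y o (ear_mirror.2 (by simpa using hy))
      (far_mirror.2 ho)) v with ⟨i, h⟩ | ⟨i, h⟩
    · exact .inl ⟨0 - i, bag_mirror.2 (by simpa using h)⟩
    · exact .inr ⟨0 - i, ear_mirror.2 (by simpa using h)⟩
  · have : ∀ i : Fin 5, i ≠ 0 → 0 - i ≠ 0 := by decide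
    exact this i hi
  · have := (hF.mirror 0).bag_three_eq (ear_mirror_zero.2 hz) (bag_mirror_two.2 ht) hs hzt
    have hs' : s = c 2 := this
    exact hs' ▸ (ear_mirror_zero.1 hy).2.1

theorem _root_.BPerfect.bag_ne_ear (hv : Bag G c i v) (hy : Ear G c j y) : v ≠ y := by
  rintro rfl
  have key : ∀ (c : Fin 5 → V) (i), Ear G c 0 v → ¬ Bag G c i v := by
    intro c i hy hv
    have hy := ear_zero.1 hy
    fin_cases i
    · exact (bag_zero.1 hv).2.2.2.1 hy.2.1
    · exact (bag_one.1 hv).2.2.2.1 hy.2.2.1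
    · exact (BPerfect.bag_two.1 hv).2.2.1 hy.2.1
    · exact (bag_three.1 hv).2.2.1 hy.2.2.1
    · exact (bag_four.1 hv).2.2.2.2 hy.2.1
  exact key (BPerfect.rot c j) (i - j) (ear_rot_zero.2 hy) (bag_rot.2 (by simpa using hv))

/-- The adjacencies in the presence of ears at `c 0` and at `c 1`. -/
structure AdjacentEars (G : SimpleGraph V) (c : Fin 5 → V) : Prop where
  e2 : ∀ v, ¬ Ear G c 2 v
  e3 : ∀ v, ¬ Ear G c 3 v
  e4 : ∀ v, ¬ Ear G c 4 v
  y3 : ∀ y v, Ear G c 0 y → Bag G c 3 v → G.Adj y v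
  z1 : ∀ y v, Ear G c 1 y → Bag G c 1 v → G.Adj y v
  z3 : ∀ y v, Ear G c 1 y → Bag G c 3 v → G.Adj y v
  yz : ∀ y z, Ear G c 0 y → Ear G c 1 z → G.Adj y z
  y2 : ∀ y, Ear G c 0 y → G.Adj y (c 2)
  z4 : ∀ y, Ear G c 1 y → G.Adj y (c 4)
  nbZ : ∀ v w, Ear G c 1 v → G.Adj v w →
    Bag G c 1 w ∨ Bag G c 3 w ∨ Bag G c 4 w ∨ Hub G c w ∨ Far G c w ∨ Ear G c 1 w ∨ Ear G c 0 w
  farY : ∀ y o, Ear G c 0 y → Far G c o → G.Adj y o → ∀ t, Bag G c 2 t → G.Adj y t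
  farZ : ∀ y o, Ear G c 1 y → Far G c o → G.Adj y o → ∀ t, Bag G c 4 t → G.Adj y t
  adjY : ∀ y z, Ear G c 0 y → Ear G c 0 z → G.Adj y z → ∀ t, Bag G c 2 t → G.Adj y t
  adjZ : ∀ y z, Ear G c 1 y → Ear G c 1 z → G.Adj y z → ∀ t, Bag G c 4 t → G.Adj y t

theorem adjacentEars (hF : Frame G c) (hy : Ear G c 0 y) (hz : Ear G c 1 z) :
    AdjacentEars G c where
  e2 v hv := (hF.not_three_ears hy hz).1 ⟨v, hv⟩
  e3 v hv := (hF.not_three_ears hy hz).2 ⟨v, hv⟩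
  e4 _ hv := (hF.not_three_ears hv hy).1 ⟨z, hz⟩
  y3 _ _ hy := hF.ear_zero_bag_three hy hz
  z1 _ _ := hF.ear_bag
  z3 _ _ hz ht := (hF.mirror 1).ear_zero_bag_three (ear_mirror_zero.2 hz) (ear_mirror.2 hy)
    (bag_mirror_three.2 ht)
  yz _ _ := hF.ear_succ
  y2 _ h := h.2.1
  z4 _ h := h.2.2.1
  nbZ v w hv hw := by
    rcases hF.nbr_ear hv hw with h | h | h | h | h | h | h | h
    · exact .inl h
    · exact .inr (.inl h)
    · exact .inr (.inr (.inl h))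
    · exact .inr (.inr (.inr (.inl h)))
    · exact .inr (.inr (.inr (.inr (.inl h))))
    · exact .inr (.inr (.inr (.inr (.inr (.inl h)))))
    · exact absurd ⟨w, h⟩ (hF.not_three_ears hy hz).1
    · exact .inr (.inr (.inr (.inr (.inr (.inr h)))))
  farY _ _ h ho hyo := (hF.ear_bag_of_far h ho hyo).1
  farZ _ _ h ho hyo := (hF.ear_bag_of_far h ho hyo).2
  adjY _ _ h ho hyo := (hF.ear_bag_of_adj h ho hyo).1
  adjZ _ _ h ho hyo := (hF.ear_bag_of_adj h ho hyo).2

theorem _root_.BPerfect.IsC5.outer_union_three_ne_univ (hc : IsC5 G c) :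
    outer G c ∪ {c 3} ≠ Set.univ := by
  intro h
  have h0 : c 0 ∈ outer G c ∪ {c 3} := h ▸ Set.mem_univ _
  rcases h0 with h0 | h0
  · exact hc.zero_notMem_outer h0
  · rw [Set.mem_singleton_iff] at h0
    have h1 := hc.lits.1
    rw [h0] at h1
    exact hc.lits.2.2.2.2.2.2.1 h1.symm

/-- An ear at `c 0` complete to the bag of `c 2` and an ear at `c 1` complete to the bag of
`c 4`. -/
theorem false_of_adjacent_complete [Finite V] (hF : Frame G c) (hK : Critical G col)
    (hy : Ear G c 0 y) (hz : Ear G c 1 z) (hy2 : ∀ t, Bag G c 2 t → G.Adj y t)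
    (hz4 : ∀ t, Bag G c 4 t → G.Adj z t) : False := by
  have hP := hK.proper
  have hS : ∀ u v, G.Adj u v → G.Adj v u := fun _ _ h => h.symm
  have b3 := hF.cyc.bag_self 3
  obtain ⟨a01, a12, a23, a34, a40, y0, dB, dY, nb0, nb1, nb2, nb3, nb4, nbY⟩ := hF.table
  obtain ⟨e2, e3, e4, y3, z1, z3, yz, y2, z4, nbZ, farY, farZ, adjY, adjZ⟩ :=
    hF.adjacentEars hy hz
  have dom := fun u v => @Critical.ne_and_not_seesAll _ _ _ _ u v hK
  -- `z` dominates the bags of `c 0` and `c 2`, and `y` those of `c 1` and `c 4`. Only the bag of `c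
  -- 3` can contain b-vertices, and it then is a singleton.
  have n0 : ∀ v, Bag G c 0 v → ¬ SeesAll G col Set.univ v := by
    intro v hv
    refine (dom v z ?_ (fun h => hF.ear_bag_pred hz hv h.symm) (by grind)).2
    exact bag_ne_ear hv ‹_›
  have n1 : ∀ v, Bag G c 1 v → ¬ SeesAll G col Set.univ v := by
    intro v hv
    refine (dom v y ?_ (fun h => hF.ear_bag_succ hy hv h.symm) (by grind)).2
    exact bag_ne_ear hv ‹_›
  have n2 : ∀ v, Bag G c 2 v → ¬ SeesAll G col Set.univ v := by
    intro v hv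
    refine (dom v z ?_ (fun h => hF.ear_bag_succ hz hv h.symm) (by grind)).2
    exact bag_ne_ear hv ‹_›
  have n4 : ∀ v, Bag G c 4 v → ¬ SeesAll G col Set.univ v := by
    intro v hv
    refine (dom v y ?_ (fun h => hF.ear_bag_pred hy hv h.symm) (by grind)).2
    exact bag_ne_ear hv ‹_›
  have u3 : ∀ u v, Bag G c 3 v → SeesAll G col Set.univ v → Bag G c 3 u → u = v := by
    intro u v hv hb hu
    by_contra hne
    exact (dom v u (Ne.symm hne) (hF.bag_bag hv hu) (by grind)).2 hb
  have nY : ∀ v, Ear G c 0 v → SeesAll G col Set.univ v → ∀ t, Bag G c 2 t → G.Adj v t := by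
    intro v hv hb t ht
    by_contra hvt
    refine (dom v y ?_ (by grind) (by grind)).2 hb
    rintro rfl
    exact hvt (hy2 t ht)
  have nZ : ∀ v, Ear G c 1 v → SeesAll G col Set.univ v → ∀ t, Bag G c 4 t → G.Adj v t := by
    intro v hv hb t ht
    by_contra hvt
    refine (dom v z ?_ (by grind) (by grind)).2 hb
    rintro rfl
    exact hvt (hz4 t ht)
  have far : ∀ o a, Far G c o → SeesAll G col Set.univ o → Bag G c 3 a → col a = col o := by
    intro o a ho hb ha
    have hfar := (hF.far_of_seesAll hK ho hb).1
    by_contra hne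
    obtain ⟨w, -, hw, hwl⟩ := hb _ hne
    rcases hF.nbr_far ho hw with h | h | ⟨j, h⟩
    · exact hfar w h hw
    · exact hP (dB _ _ _ h ha) hwl
    · fin_cases j
      · exact hP (y3 _ _ h ha) hwl
      · exact hP (z3 _ _ h ha) hwl
      · exact e2 _ h
      · exact e3 _ h
      · exact e4 _ h
  have loc : ∀ v, SeesAll G col Set.univ v → (∀ a, Bag G c 3 a → col a = col v) ∨
      (Ear G c 0 v ∧ ∀ t, Bag G c 2 t → G.Adj v t) ∨
      (Ear G c 1 v ∧ ∀ t, Bag G c 4 t → G.Adj v t) ∨ Hub G c v := by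
    intro v hb
    rcases hF.cases v with ⟨i, h⟩ | ⟨i, h⟩ | h | h
    · fin_cases i
      · exact absurd hb (n0 v h)
      · exact absurd hb (n1 v h)
      · exact absurd hb (n2 v h)
      · exact .inl fun a ha => congrArg col (u3 a v h hb ha)
      · exact absurd hb (n4 v h)
    · fin_cases i
      · exact .inr (.inl ⟨h, nY v h hb⟩)
      · exact .inr (.inr (.inl ⟨h, nZ v h hb⟩))
      · exact absurd h (e2 _)
      · exact absurd h (e3 _)
      · exact absurd h (e4 _)
    · exact .inr (.inr (.inr h))
    · exact .inl fun a ha => far v a h hb ha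
  have hQ : ∀ a, Bag G c 3 a → col a = col (c 3) := by
    obtain ⟨v, hv, hvb⟩ := hK.exists_seesAll (col (c 3))
    rcases loc v hvb with h | h | h | h
    · exact fun a ha => (h a ha).trans hv
    · exact absurd hv (hP (y3 _ _ h.1 b3))
    · exact absurd hv (hP (z3 _ _ h.1 b3))
    · exact absurd hv (hP (dB _ _ _ h b3))
  have hR : ∀ j, j ≠ col (c 3) → ∃ z, col z = j ∧ SeesAll G col Set.univ z ∧
      ((Ear G c 0 z ∧ ∀ t, Bag G c 2 t → G.Adj z t) ∨
        (Ear G c 1 z ∧ ∀ t, Bag G c 4 t → G.Adj z t) ∨ Hub G c z) := by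
    intro j hj
    obtain ⟨v, hv, hvb⟩ := hK.exists_seesAll j
    exact ⟨v, hv, hvb, (loc v hvb).resolve_left fun h => hj (hv.symm.trans (h _ b3).symm)⟩
  have hmem : ∀ z, ((Ear G c 0 z ∧ ∀ t, Bag G c 2 t → G.Adj z t) ∨
        (Ear G c 1 z ∧ ∀ t, Bag G c 4 t → G.Adj z t) ∨ Hub G c z) →
      z ∈ outer G c ∪ {c 3} ∧ G.Adj z (c 3) := by
    rintro z (h | h | h)
    · exact ⟨.inl (.inr (.inl ⟨0, h.1⟩)), y3 _ _ h.1 b3⟩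
    · exact ⟨.inl (.inr (.inl ⟨1, h.1⟩)), z3 _ _ h.1 b3⟩
    · exact ⟨.inl (.inl h), h 3⟩
  have m3 : c 3 ∈ outer G c ∪ {c 3} := .inr rfl
  -- All bags are deleted except for `c 3`, which sees every b-vertex of another color. The bag of
  -- `c 3` is monochromatic, so its deletion loses no color.
  refine hK.critical _ hF.cyc.outer_union_three_ne_univ fun j => ?_
  by_cases hj3 : j = col (c 3)
  · refine ⟨c 3, m3, hj3.symm, fun l hl => ?_⟩
    obtain ⟨z, hz, -, hzl⟩ := hR l hl
    exact ⟨z, (hmem z hzl).1, (hmem z hzl).2.symm, hz⟩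
  obtain ⟨v, hv, hvb, hvl⟩ := hR j hj3
  refine ⟨v, (hmem v hvl).1, hv, fun l hl => ?_⟩
  by_cases hl3 : l = col (c 3)
  · exact ⟨c 3, m3, (hmem v hvl).2, hl3.symm⟩
  obtain ⟨z, hz, -, hzl⟩ := hR l hl3
  obtain ⟨x, -, hx, hxl⟩ := hvb l hl
  by_cases hxo : x ∈ outer G c
  · exact ⟨x, .inl hxo, hx, hxl⟩
  have hbag : ∃ i, Bag G c i x := by
    rcases hF.cases x with h | h | h | h
    · exact h
    all_goals exact absurd (by simp [outer, h]) hxo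
  obtain ⟨i, hi⟩ := hbag
  have hzx : ¬ G.Adj z x := fun h => hP h (hz.trans hxl.symm)
  have hx3 : ¬ Bag G c 3 x := fun h => hl3 (hxl.symm.trans (hQ x h))
  have hzH : ¬ Hub G c z := fun h => hzx (dB _ _ _ h hi)
  -- The color of the deleted `x` is recovered on its b-vertex `z`. As `z` misses `x`, it is not a
  -- hub, and if `v` is an ear then `z` is an ear at the other position; in every case `v` sees `z`.
  refine ⟨z, (hmem z hzl).1, ?_, hz⟩
  rcases hvl with h | h | h
  · have : Bag G c 0 x ∨ Bag G c 2 x := by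
      rcases nbY _ _ h.1 hx with h | h | h | h | h | h | h | h
      · exact .inl h
      · exact .inr h
      · exact absurd h hx3
      · exact absurd (.inl h) hxo
      · exact absurd (.inr (.inr h)) hxo
      all_goals exact absurd (.inr (.inl ⟨_, h⟩)) hxo
    rcases hzl with h' | h' | h'
    · exact absurd (this.elim (y0 _ _ h'.1) (h'.2 _)) hzx
    · exact yz _ _ h.1 h'.1
    · exact absurd h' hzH
  · have : Bag G c 1 x ∨ Bag G c 4 x := by
      rcases nbZ _ _ h.1 hx with h | h | h | h | h | h | h
      · exact .inl h
      · exact absurd h hx3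
      · exact .inr h
      · exact absurd (.inl h) hxo
      · exact absurd (.inr (.inr h)) hxo
      all_goals exact absurd (.inr (.inl ⟨_, h⟩)) hxo
    rcases hzl with h' | h' | h'
    · exact (yz _ _ h'.1 h.1).symm
    · exact absurd (this.elim (z1 _ _ h'.1) (h'.2 _)) hzx
    · exact absurd h' hzH
  · rcases hzl with h' | h' | h'
    · exact dY _ _ _ h h'.1
    · exact dY _ _ _ h h'.1
    · exact absurd h' hzH

/-- An ear at `c 1` complete to the bag of `c 4`, but no ear at `c 0` complete to the bag of
`c 2`. -/
theorem false_of_adjacent_half_complete [Finite V] (hF : Frame G c) (hK : Critical G col)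
    (hy : Ear G c 0 y) (hz : Ear G c 1 z)
    (hplus : ∀ y, Ear G c 0 y → ∃ t, Bag G c 2 t ∧ ¬ G.Adj y t)
    (hz4 : ∀ t, Bag G c 4 t → G.Adj z t) : False := by
  have hP := hK.proper
  have hS : ∀ u v, G.Adj u v → G.Adj v u := fun _ _ h => h.symm
  have b1 := hF.cyc.bag_self 1
  have b3 := hF.cyc.bag_self 3
  obtain ⟨a01, a12, a23, a34, a40, y0, dB, dY, nb0, nb1, nb2, nb3, nb4, nbY⟩ := hF.table
  obtain ⟨e2, e3, e4, y3, z1, z3, yz, y2, z4, nbZ, farY, farZ, adjY, adjZ⟩ :=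
    hF.adjacentEars hy hz
  have s3 : ∀ t, Bag G c 3 t → t = c 3 := by
    intro t ht
    obtain ⟨s, hs, hys⟩ := hplus y hy
    exact hF.bag_three_eq hy hs ht hys
  have yo : ∀ y o, Ear G c 0 y → Far G c o → ¬ G.Adj y o := by
    intro y o hy ho h
    obtain ⟨t, ht, hyt⟩ := hplus y hy
    exact hyt (farY y o hy ho h t ht)
  have stable : ∀ y z, Ear G c 0 y → Ear G c 0 z → ¬ G.Adj y z := by
    intro y z hy hz h
    obtain ⟨t, ht, hyt⟩ := hplus y hy
    exact hyt (adjY y z hy hz h t ht)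
  have nbY' : ∀ v w, Ear G c 0 v → G.Adj v w →
      Bag G c 0 w ∨ Bag G c 2 w ∨ w = c 3 ∨ Hub G c w ∨ Ear G c 1 w := by
    intro v w hv hw
    have := nbY v w hv hw
    have := yo v w hv
    have := stable v w hv
    have := s3 w
    have := e4 w
    tauto
  have dom := fun u v => @Critical.ne_and_not_seesAll _ _ _ _ u v hK
  have n0 : ∀ v, Bag G c 0 v → ¬ SeesAll G col Set.univ v := by
    intro v hv
    refine (dom v z ?_ (fun h => hF.ear_bag_pred hz hv h.symm) (by grind)).2
    exact bag_ne_ear hv ‹_›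
  have n2 : ∀ v, Bag G c 2 v → ¬ SeesAll G col Set.univ v := by
    intro v hv
    refine (dom v z ?_ (fun h => hF.ear_bag_succ hz hv h.symm) (by grind)).2
    exact bag_ne_ear hv ‹_›
  have n4 : ∀ v, Bag G c 4 v → ¬ SeesAll G col Set.univ v := by
    intro v hv
    refine (dom v y ?_ (fun h => hF.ear_bag_pred hy hv h.symm) (by grind)).2
    exact bag_ne_ear hv ‹_›
  have u1 : ∀ v, Bag G c 1 v → SeesAll G col Set.univ v → v = c 1 := by
    intro v hv hb
    by_contra hne
    exact (dom v (c 1) hne (hF.bag_bag hv b1) (by grind)).2 hb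
  have nZ : ∀ v, Ear G c 1 v → SeesAll G col Set.univ v → ∀ t, Bag G c 4 t → G.Adj v t := by
    intro v hv hb t ht
    by_contra hvt
    refine (dom v z ?_ (by grind) (by grind)).2 hb
    rintro rfl
    exact hvt (hz4 t ht)
  -- All neighbors of a far b-vertex are hubs and ears at `c 1`, which see both `c 3` and `y`. So it
  -- would have the color of both, although these are adjacent.
  have far : ∀ o, Far G c o → ¬ SeesAll G col Set.univ o := by
    intro o ho hb
    have hfar := (hF.far_of_seesAll hK ho hb).1
    have nbo : ∀ w, G.Adj o w → Hub G c w ∨ Ear G c 1 w := by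
      intro w hw
      rcases hF.nbr_far ho hw with h | h | ⟨j, h⟩
      · exact absurd hw (hfar w h)
      · exact .inl h
      · fin_cases j
        · exact absurd hw.symm (yo _ _ h ho)
        · exact .inr h
        · exact absurd h (e2 _)
        · exact absurd h (e3 _)
        · exact absurd h (e4 _)
    have h3 : col (c 3) = col o := by
      by_contra hne
      obtain ⟨w, -, hw, hwl⟩ := hb _ hne
      rcases nbo w hw with h | h
      · exact hP (h 3) hwl
      · exact hP (z3 _ _ h b3) hwl
    obtain ⟨w, -, hw, hwl⟩ := hb (col y) (h3 ▸ hP (y3 _ _ hy b3))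
    rcases nbo w hw with h | h
    · exact hP (dY _ _ _ h hy) hwl
    · exact hP (yz _ _ hy h) hwl.symm
  have uY : ∀ y z, Ear G c 0 y → Ear G c 0 z → SeesAll G col Set.univ y →
      SeesAll G col Set.univ z → col y = col z := by
    intro y z hy hz hyb hzb
    by_contra hne
    obtain ⟨s, -, hs, hsl⟩ := hyb _ (Ne.symm hne)
    obtain ⟨t, -, ht, htl⟩ := hzb _ hne
    have hys : Bag G c 2 s := by
      have := nbY' _ _ hy hs
      grind
    have hzt : Bag G c 2 t := by
      have := nbY' _ _ hz ht
      grind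
    exact hP (hF.ear_matching hy hz hys hzt hs ht fun h => hP h htl.symm) hsl.symm
  have h1y : ∀ y, Ear G c 0 y → SeesAll G col Set.univ y →
      col (c 1) = col y ∨ col (c 1) = col (c 3) := by
    intro y hy hb
    by_contra! hne
    obtain ⟨x, -, hx, hxl⟩ := hb _ hne.1
    have := nbY' _ _ hy hx
    grind
  have loc : ∀ v, SeesAll G col Set.univ v → v = c 3 ∨ (v = c 1 ∨ Ear G c 0 v) ∨
      (Ear G c 1 v ∧ ∀ t, Bag G c 4 t → G.Adj v t) ∨ Hub G c v := by
    intro v hb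
    rcases hF.cases v with ⟨i, h⟩ | ⟨i, h⟩ | h | h
    · fin_cases i
      · exact absurd hb (n0 v h)
      · exact .inr (.inl (.inl (u1 v h hb)))
      · exact absurd hb (n2 v h)
      · exact .inl (s3 v h)
      · exact absurd hb (n4 v h)
    · fin_cases i
      · exact .inr (.inl (.inr h))
      · exact .inr (.inr (.inl ⟨h, nZ v h hb⟩))
      · exact absurd h (e2 _)
      · exact absurd h (e3 _)
      · exact absurd h (e4 _)
    · exact .inr (.inr (.inr h))
    · exact absurd hb (far v h)
  obtain ⟨β, hβ⟩ : ∃ β, ∀ v, (v = c 1 ∨ Ear G c 0 v) → SeesAll G col Set.univ v →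
      col v = β ∨ col v = col (c 3) := by
    by_cases hb : ∃ y, Ear G c 0 y ∧ SeesAll G col Set.univ y
    · obtain ⟨y, hy, hyb⟩ := hb
      exact ⟨col y, by grind⟩
    · exact ⟨col (c 1), by grind⟩
  have hy3 := hP (y3 _ _ hy b3)
  -- The ears at `c 1` and the hubs see `y`, so the b-vertex of its color is `c 1` or an ear at `c
  -- 0`. Thus `y` can represent this color after the deletion, whether or not it was a b-vertex.
  have hyβ : col y = β := by
    obtain ⟨v, hv, hvb⟩ := hK.exists_seesAll (col y)
    rcases loc v hvb with h | h | h | h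
    · exact absurd (hv.symm.trans (congrArg col h)) hy3
    · exact (hβ v h hvb).elim (fun e => hv.symm.trans e) fun e => absurd (hv.symm.trans e) hy3
    · exact absurd hv.symm (hP (yz _ _ hy h.1))
    · exact absurd hv (hP (dY _ _ _ h hy))
  have hR : ∀ j, j ≠ col (c 3) → j ≠ col y → ∃ z, col z = j ∧ SeesAll G col Set.univ z ∧
      ((Ear G c 1 z ∧ ∀ t, Bag G c 4 t → G.Adj z t) ∨ Hub G c z) := by
    intro j hj hjy
    obtain ⟨v, rfl, hvb⟩ := hK.exists_seesAll j
    refine ⟨v, rfl, hvb, ?_⟩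
    rcases loc v hvb with h | h | h
    · exact absurd (congrArg col h) hj
    · exact ((hβ v h hvb).elim (fun e => hjy (e.trans hyβ.symm)) hj).elim
    · exact h
  have hmem : ∀ z, ((Ear G c 1 z ∧ ∀ t, Bag G c 4 t → G.Adj z t) ∨ Hub G c z) →
      z ∈ outer G c ∪ {c 3} ∧ G.Adj z (c 3) ∧ G.Adj z y := by
    rintro z (h | h)
    · exact ⟨.inl (.inr (.inl ⟨1, h.1⟩)), z3 _ _ h.1 b3, (yz _ _ hy h.1).symm⟩
    · exact ⟨.inl (.inl h), h 3, dY _ _ _ h hy⟩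
  have m3 : c 3 ∈ outer G c ∪ {c 3} := .inr rfl
  have my : y ∈ outer G c ∪ {c 3} := .inl (.inr (.inl ⟨0, hy⟩))
  refine hK.critical _ hF.cyc.outer_union_three_ne_univ fun j => ?_
  by_cases hj3 : j = col (c 3)
  · refine ⟨c 3, m3, hj3.symm, fun l hl => ?_⟩
    by_cases hly : l = col y
    · exact ⟨y, my, (y3 _ _ hy b3).symm, hly.symm⟩
    obtain ⟨z, hz, -, hzl⟩ := hR l hl hly
    exact ⟨z, (hmem z hzl).1, (hmem z hzl).2.1.symm, hz⟩
  by_cases hjy : j = col y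
  · refine ⟨y, my, hjy.symm, fun l hl => ?_⟩
    by_cases hl3 : l = col (c 3)
    · exact ⟨c 3, m3, y3 _ _ hy b3, hl3.symm⟩
    obtain ⟨z, hz, -, hzl⟩ := hR l hl3 hl
    exact ⟨z, (hmem z hzl).1, (hmem z hzl).2.2.symm, hz⟩
  obtain ⟨v, hv, hvb, hvl⟩ := hR j hj3 hjy
  refine ⟨v, (hmem v hvl).1, hv, fun l hl => ?_⟩
  by_cases hl3 : l = col (c 3)
  · exact ⟨c 3, m3, (hmem v hvl).2.1, hl3.symm⟩
  by_cases hly : l = col y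
  · exact ⟨y, my, (hmem v hvl).2.2, hly.symm⟩
  obtain ⟨z, hz, -, hzl⟩ := hR l hl3 hly
  obtain ⟨x, -, hx, hxl⟩ := hvb l hl
  by_cases hxo : x ∈ outer G c
  · exact ⟨x, .inl hxo, hx, hxl⟩
  have hbag : ∃ i, Bag G c i x := by
    rcases hF.cases x with h | h | h | h
    · exact h
    all_goals exact absurd (by simp [outer, h]) hxo
  obtain ⟨i, hi⟩ := hbag
  have hzx : ¬ G.Adj z x := fun h => hP h (hz.trans hxl.symm)
  have hx3 : ¬ Bag G c 3 x := fun h => hl3 (hxl.symm.trans (congrArg col (s3 x h)))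
  have hz' := hzl.resolve_right fun h => hzx (dB _ _ _ h hi)
  refine ⟨z, (hmem z hzl).1, ?_, hz⟩
  rcases hvl with h | h
  · exfalso
    have : Bag G c 1 x ∨ Bag G c 4 x := by
      rcases nbZ _ _ h.1 hx with h | h | h | h | h | h | h
      · exact .inl h
      · exact absurd h hx3
      · exact .inr h
      · exact absurd (.inl h) hxo
      · exact absurd (.inr (.inr h)) hxo
      all_goals exact absurd (.inr (.inl ⟨_, h⟩)) hxo
    exact hzx (this.elim (z1 _ _ hz'.1) (hz'.2 _))
  · exact dY _ _ _ h hz'.1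

/-- No ear at `c 0` is complete to the bag of `c 2`, and no ear at `c 1` to the bag of `c 4`. -/
theorem false_of_adjacent_incomplete [Finite V] (hF : Frame G c) (hK : Critical G col)
    (hmod : (∀ i y o, Ear G c i y → Far G c o → ¬ G.Adj y o) →
      ∀ v, (∃ i, Bag G c i v) ∨ ∃ i, Ear G c i v)
    (hy : Ear G c 0 y) (hz : Ear G c 1 z)
    (hplus : ∀ y, Ear G c 0 y → ∃ t, Bag G c 2 t ∧ ¬ G.Adj y t)
    (hplus' : ∀ y, Ear G c 1 y → ∃ t, Bag G c 4 t ∧ ¬ G.Adj y t) : False := by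
  have hP := hK.proper
  have hS : ∀ u v, G.Adj u v → G.Adj v u := fun _ _ h => h.symm
  have b0 := hF.cyc.bag_self 0
  have b1 := hF.cyc.bag_self 1
  have b3 := hF.cyc.bag_self 3
  obtain ⟨a01, a12, a23, a34, a40, y0, dB, dY, nb0, nb1, nb2, nb3, nb4, nbY⟩ := hF.table
  obtain ⟨e2, e3, e4, y3, z1, z3, yz, y2, z4, nbZ, farY, farZ, adjY, adjZ⟩ :=
    hF.adjacentEars hy hz
  have s3 : ∀ t, Bag G c 3 t → t = c 3 := by
    intro t ht
    obtain ⟨s, hs, hys⟩ := hplus y hy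
    exact hF.bag_three_eq hy hs ht hys
  have hcov : ∀ v, (∃ i, Bag G c i v) ∨ ∃ i, Ear G c i v := by
    refine hmod fun i y o hy ho h => ?_
    fin_cases i
    · obtain ⟨t, ht, hyt⟩ := hplus y hy
      exact hyt (farY y o hy ho h t ht)
    · obtain ⟨t, ht, hyt⟩ := hplus' y hy
      exact hyt (farZ y o hy ho h t ht)
    · exact e2 _ hy
    · exact e3 _ hy
    · exact e4 _ hy
  have hub : ∀ v, ¬ Hub G c v := by
    intro v hv
    rcases hcov v with ⟨i, h⟩ | ⟨i, h⟩
    · exact G.irrefl (dB v i v hv h)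
    · exact G.irrefl (dY v i v hv h)
  have far : ∀ v, ¬ Far G c v := by
    intro v hv
    rcases hcov v with ⟨i, h⟩ | ⟨i, h⟩
    · exact hv _ h.1
    · exact hv _ h.1
  have nbY' : ∀ v w, Ear G c 0 v → G.Adj v w →
      Bag G c 0 w ∨ Bag G c 2 w ∨ w = c 3 ∨ Ear G c 1 w := by
    intro v w hv hw
    have := nbY v w hv hw
    have : ¬ Ear G c 0 w := fun h => by
      obtain ⟨t, ht, hyt⟩ := hplus v hv
      exact hyt (adjY v w hv h hw t ht)
    have := far w
    have := hub w
    have := s3 w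
    have := e4 w
    tauto
  have nbZ' : ∀ v w, Ear G c 1 v → G.Adj v w →
      Bag G c 1 w ∨ Bag G c 4 w ∨ w = c 3 ∨ Ear G c 0 w := by
    intro v w hv hw
    have := nbZ v w hv hw
    have : ¬ Ear G c 1 w := fun h => by
      obtain ⟨t, ht, hyt⟩ := hplus' v hv
      exact hyt (adjZ v w hv h hw t ht)
    have := far w
    have := hub w
    have := s3 w
    tauto
  have dom := fun u v => @Critical.ne_and_not_seesAll _ _ _ _ u v hK
  have n2 : ∀ v, Bag G c 2 v → ¬ SeesAll G col Set.univ v := by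
    intro v hv
    refine (dom v z ?_ (fun h => hF.ear_bag_succ hz hv h.symm) (by grind)).2
    exact bag_ne_ear hv ‹_›
  have n4 : ∀ v, Bag G c 4 v → ¬ SeesAll G col Set.univ v := by
    intro v hv
    refine (dom v y ?_ (fun h => hF.ear_bag_pred hy hv h.symm) (by grind)).2
    exact bag_ne_ear hv ‹_›
  have u0 : ∀ v, Bag G c 0 v → SeesAll G col Set.univ v → v = c 0 := by
    intro v hv hb
    by_contra hne
    exact (dom v (c 0) hne (hF.bag_bag hv b0) (by grind)).2 hb
  have u1 : ∀ v, Bag G c 1 v → SeesAll G col Set.univ v → v = c 1 := by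
    intro v hv hb
    by_contra hne
    exact (dom v (c 1) hne (hF.bag_bag hv b1) (by grind)).2 hb
  have uY : ∀ y z, Ear G c 0 y → Ear G c 0 z → SeesAll G col Set.univ y →
      SeesAll G col Set.univ z → col y = col z := by
    intro y z hy hz hyb hzb
    by_contra hne
    obtain ⟨s, -, hs, hsl⟩ := hyb _ (Ne.symm hne)
    obtain ⟨t, -, ht, htl⟩ := hzb _ hne
    have hys : Bag G c 2 s := by
      have := nbY' _ _ hy hs
      grind
    have hzt : Bag G c 2 t := by
      have := nbY' _ _ hz ht
      grind
    exact hP (hF.ear_matching hy hz hys hzt hs ht fun h => hP h htl.symm) hsl.symm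
  have uZ : ∀ y z, Ear G c 1 y → Ear G c 1 z → SeesAll G col Set.univ y →
      SeesAll G col Set.univ z → col y = col z := by
    intro y z hy hz hyb hzb
    by_contra hne
    obtain ⟨s, -, hs, hsl⟩ := hyb _ (Ne.symm hne)
    obtain ⟨t, -, ht, htl⟩ := hzb _ hne
    have hys : Bag G c 4 s := by
      have := nbZ' _ _ hy hs
      grind
    have hzt : Bag G c 4 t := by
      have := nbZ' _ _ hz ht
      grind
    exact hP ((hF.mirror 1).ear_matching (ear_mirror_zero.2 hy) (ear_mirror_zero.2 hz)
      (bag_mirror_two.2 hys) (bag_mirror_two.2 hzt) hs ht fun h => hP h htl.symm) hsl.symm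
  have h1y : ∀ y, Ear G c 0 y → SeesAll G col Set.univ y →
      col (c 1) = col y ∨ col (c 1) = col (c 3) := by
    intro y hy hb
    by_contra! hne
    obtain ⟨x, -, hx, hxl⟩ := hb _ hne.1
    have := nbY' _ _ hy hx
    grind
  have h0z : ∀ y, Ear G c 1 y → SeesAll G col Set.univ y →
      col (c 0) = col y ∨ col (c 0) = col (c 3) := by
    intro y hy hb
    by_contra! hne
    obtain ⟨x, -, hx, hxl⟩ := hb _ hne.1
    have := nbZ' _ _ hy hx
    grind
  -- Three colors again: `α` for `c 0` and the ears at `c 1`, `β` for `c 1` and the ears at `c 0`,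
  -- and the color of `c 3`.
  obtain ⟨α, hα⟩ : ∃ α, ∀ v, (v = c 0 ∨ Ear G c 1 v) → SeesAll G col Set.univ v →
      col v = α ∨ col v = col (c 3) := by
    by_cases hb : ∃ y, Ear G c 1 y ∧ SeesAll G col Set.univ y
    · obtain ⟨y, hy, hyb⟩ := hb
      exact ⟨col y, by grind⟩
    · exact ⟨col (c 0), by grind⟩
  obtain ⟨β, hβ⟩ : ∃ β, ∀ v, (v = c 1 ∨ Ear G c 0 v) → SeesAll G col Set.univ v →
      col v = β ∨ col v = col (c 3) := by
    by_cases hb : ∃ y, Ear G c 0 y ∧ SeesAll G col Set.univ y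
    · obtain ⟨y, hy, hyb⟩ := hb
      exact ⟨col y, by grind⟩
    · exact ⟨col (c 1), by grind⟩
  obtain ⟨m, hmα, hmβ, hm3⟩ := hK.four α β (col (c 3))
  obtain ⟨v, rfl, hvb⟩ := hK.exists_seesAll m
  rcases hcov v with ⟨i, h⟩ | ⟨i, h⟩
  · fin_cases i
    · exact (hα v (.inl (u0 v h hvb)) hvb).elim hmα hm3
    · exact (hβ v (.inl (u1 v h hvb)) hvb).elim hmβ hm3
    · exact n2 v h hvb
    · exact hm3 (s3 v h ▸ rfl)
    · exact n4 v h hvb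
  · fin_cases i
    · exact (hβ v (.inr h) hvb).elim hmβ hm3
    · exact (hα v (.inr h) hvb).elim hmα hm3
    · exact e2 _ h
    · exact e3 _ h
    · exact e4 _ h

theorem false_of_ear_zero_ear_one [Finite V] (hF : Frame G c) (hK : Critical G col)
    (hmod : (∀ i y o, Ear G c i y → Far G c o → ¬ G.Adj y o) →
      ∀ v, (∃ i, Bag G c i v) ∨ ∃ i, Ear G c i v)
    (hy : Ear G c 0 y) (hz : Ear G c 1 z) : False := by
  by_cases hY : ∃ y, Ear G c 0 y ∧ ∀ t, Bag G c 2 t → G.Adj y t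
  · obtain ⟨y, hy, hy2⟩ := hY
    by_cases hZ : ∃ z, Ear G c 1 z ∧ ∀ t, Bag G c 4 t → G.Adj z t
    · obtain ⟨z, hz, hz4⟩ := hZ
      exact hF.false_of_adjacent_complete hK hy hz hy2 hz4
    · push Not at hZ
      refine (hF.mirror 1).false_of_adjacent_half_complete (y := z) (z := y) hK
        (ear_mirror_zero.2 hz) (ear_mirror.2 hy) (fun z hz => ?_) fun t ht =>
          hy2 t (bag_mirror.1 ht)
      obtain ⟨t, ht, hzt⟩ := hZ z (ear_mirror_zero.1 hz)
      exact ⟨t, bag_mirror_two.2 ht, hzt⟩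
  · push Not at hY
    by_cases hZ : ∃ z, Ear G c 1 z ∧ ∀ t, Bag G c 4 t → G.Adj z t
    · obtain ⟨z, hz, hz4⟩ := hZ
      exact hF.false_of_adjacent_half_complete hK hy hz hY hz4
    · push Not at hZ
      exact hF.false_of_adjacent_incomplete hK hmod hy hz hY hZ

end Frame

end BPerfect

/-! ### Ears at two positions at distance two. -/

namespace BPerfect

universe u

variable {V : Type u} {G : SimpleGraph V} {κ : Type*} {col : V → κ}
variable {c : Fin 5 → V} {i j : Fin 5} {a b u v w x y z o p q d s t : V}

namespace Frame

theorem no_other_ear_of_ear_zero_ear_two (hF : Frame G c) (hy : Ear G c 0 y) (hz : Ear G c 2 z) :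
    (∀ v, ¬ Ear G c 1 v) ∧ (∀ v, ¬ Ear G c 3 v) ∧ ∀ v, ¬ Ear G c 4 v :=
  ⟨fun _ hv => (hF.not_three_ears hy hv).1 ⟨z, hz⟩, fun _ hv => (hF.not_three_ears hz hv).2 ⟨y, hy⟩,
    fun _ hv => (hF.not_three_ears hv hy).2 ⟨z, hz⟩⟩

/-- The vertex `c 1` can be deleted. Its color is still represented by `c 3`, and `c 2` takes over
the color it shares with `c 0`. The other b-vertices are `c 4` and ears at `c 0`, none adjacent to
`c 1`. -/
theorem false_of_seesAll_three [Finite V] (hF : Frame G c) (hK : Critical G col)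
    (hcov : ∀ v, (∃ i, Bag G c i v) ∨ ∃ i, Ear G c i v)
    (hy : Ear G c 0 y) (hz : Ear G c 2 z)
        (h1 : ∀ v, (Ear G c 0 v ∨ Ear G c 2 v) → col (c 1) ≠ col v)
    (n1 : ∀ v, Bag G c 1 v → ¬ SeesAll G col Set.univ v) (h3 : col (c 3) = col (c 1))
    (h3b : SeesAll G col Set.univ (c 3)) : False := by
  have hP := hK.proper
  have hS : ∀ u v, G.Adj u v → G.Adj v u := fun _ _ h => h.symm
  have b0 := hF.cyc.bag_self 0
  have b1 := hF.cyc.bag_self 1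
  have b2 := hF.cyc.bag_self 2
  have b3 := hF.cyc.bag_self 3
  have b4 := hF.cyc.bag_self 4
  obtain ⟨a01, a12, a23, a34, a40, y0, dB, dY, nb0, nb1, nb2, nb3, nb4, nbY⟩ := hF.table
  obtain ⟨e1, e3, e4⟩ := hF.no_other_ear_of_ear_zero_ear_two hy hz
  have s0 : ∀ t, Bag G c 0 t → t = c 0 := fun t ht => hF.bag_eq_of_ear_two hy hz ht
  have s2 : ∀ t, Bag G c 2 t → t = c 2 := fun t ht =>
    (hF.mirror 2).bag_eq_of_ear_two (i := 0) (ear_mirror_zero.2 hz) (ear_mirror.2 hy)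
      (bag_mirror_zero.2 ht)
  have hub : ∀ v, ¬ Hub G c v := by
    intro v hv
    rcases hcov v with ⟨i, h⟩ | ⟨i, h⟩
    · exact G.irrefl (dB v i v hv h)
    · exact G.irrefl (dY v i v hv h)
  have far : ∀ v, ¬ Far G c v := by
    intro v hv
    rcases hcov v with ⟨i, h⟩ | ⟨i, h⟩
    · exact hv _ h.1
    · exact hv _ h.1
  have yc : ∀ v, (Ear G c 0 v ∨ Ear G c 2 v) → G.Adj v (c 0) ∧ G.Adj v (c 2) := by
    rintro v (h | h)
    · exact ⟨h.1, h.2.1⟩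
    · exact ⟨h.2.2.1, h.1⟩
  have y3 : ∀ v, Ear G c 0 v → G.Adj v (c 3) := fun v h => h.2.2.1
  have z4 : ∀ v, Ear G c 2 v → G.Adj v (c 4) := fun v h => h.2.1
  have nbZ : ∀ v w, Ear G c 2 v → G.Adj v w →
      w = c 0 ∨ w = c 2 ∨ Bag G c 4 w ∨ Ear G c 2 w := by
    intro v w hv hw
    rcases hF.nbr_ear hv hw with h | h | h | h | h | h | h | h
    · exact .inr (.inl (s2 w h))
    · exact .inr (.inr (.inl h))
    · exact .inl (s0 w h)
    · exact absurd h (hub w)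
    · exact absurd h (far w)
    · exact .inr (.inr (.inr h))
    · exact absurd h (e3 w)
    · exact absurd h (e1 w)
  have nbY' : ∀ v w, Ear G c 0 v → G.Adj v w →
      w = c 0 ∨ w = c 2 ∨ Bag G c 3 w ∨ Ear G c 0 w := by
    intro v w hv hw
    rcases nbY _ _ hv hw with h | h | h | h | h | h | h | h
    · exact .inl (s0 w h)
    · exact .inr (.inl (s2 w h))
    · exact .inr (.inr (.inl h))
    · exact absurd h (hub w)
    · exact absurd h (far w)
    · exact .inr (.inr (.inr h))
    · exact absurd h (e1 w)
    · exact absurd h (e4 w)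
  have dom := fun u v => @Critical.ne_and_not_seesAll _ _ _ _ u v hK
  have u3 : ∀ v, Bag G c 3 v → SeesAll G col Set.univ v → v = c 3 := by
    intro v hv hb
    by_contra hne
    exact (dom v (c 3) hne (hF.bag_bag hv b3) (by grind)).2 hb
  have u4 : ∀ v, Bag G c 4 v → SeesAll G col Set.univ v → v = c 4 := by
    intro v hv hb
    by_contra hne
    exact (dom v (c 4) hne (hF.bag_bag hv b4) (by grind)).2 hb
  have h01 := hP (a01 _ _ b0 b1)
  have h12 := hP (a12 _ _ b1 b2)
  -- `c 3` must see the color of `c 0`, and all its neighbors other than `c 2` are adjacent to `c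
  -- 0`.
  have h02 : col (c 2) = col (c 0) := by
    obtain ⟨w, -, hw, hwl⟩ := h3b (col (c 0)) (h3 ▸ h01)
    rcases nb3 _ _ b3 hw with h | h | h | h | h | h
    · exact absurd hwl (hP (a40 _ _ h b0))
    · exact s2 w h ▸ hwl
    · exact absurd h (hub w)
    · exact absurd h (e3 w)
    · exact absurd hwl (hP (y0 _ _ h b0))
    · exact absurd h (e1 w)
  have n2 : ∀ v, Ear G c 2 v → ¬ SeesAll G col Set.univ v := by
    intro v hv hb
    obtain ⟨w, -, hw, hwl⟩ := hb _ (h1 v (.inr hv))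
    rcases nbZ v w hv hw with rfl | rfl | h | h
    · exact h01 hwl
    · exact h12 hwl.symm
    · exact hP (a34 _ _ b3 h) (h3.trans hwl.symm)
    · exact h1 w (.inr h) hwl.symm
  have loc : ∀ v, SeesAll G col Set.univ v →
      (v = c 0 ∨ v = c 2) ∨ v = c 3 ∨ v = c 4 ∨ Ear G c 0 v := by
    intro v hb
    rcases hcov v with ⟨i, h⟩ | ⟨i, h⟩
    · fin_cases i
      · exact .inl (.inl (s0 v h))
      · exact absurd hb (n1 v h)
      · exact .inl (.inr (s2 v h))
      · exact .inr (.inl (u3 v h hb))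
      · exact .inr (.inr (.inl (u4 v h hb)))
    · fin_cases i
      · exact .inr (.inr (.inr h))
      · exact absurd h (e1 v)
      · exact absurd hb (n2 v h)
      · exact absurd h (e3 v)
      · exact absurd h (e4 v)
  -- A color different from those of `c 0`, `c 1` and `c 4` has its b-vertex among the ears at `c
  -- 0`. That ear is anticomplete to the bag of `c 4`, so it must have the color of `t` itself or
  -- see it on another such ear.
  have h4 : ∀ t, Bag G c 4 t → ∃ y, Ear G c 0 y ∧ col y = col t := by
    intro t ht
    by_contra! hcon
    obtain ⟨m, hm0, hm1, hm4⟩ := hK.four (col (c 0)) (col (c 1)) (col (c 4))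
    obtain ⟨v, rfl, hvb⟩ := hK.exists_seesAll m
    rcases loc v hvb with (rfl | rfl) | rfl | rfl | h
    · exact hm0 rfl
    · exact hm0 h02
    · exact hm1 h3
    · exact hm4 rfl
    obtain ⟨w, -, hw, hwl⟩ := hvb (col t) (hcon v h).symm
    rcases nbY' v w h hw with rfl | rfl | h | h
    · exact hP (a40 _ _ ht b0) hwl.symm
    · exact hP (a40 _ _ ht b0) (hwl.symm.trans h02)
    · exact hP (a34 _ _ h ht) hwl
    · exact hcon w h hwl
  have hl := hF.cyc.lits
  have hne : ({c 1}ᶜ : Set V) ≠ Set.univ := fun h =>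
    (h.symm ▸ Set.mem_univ (c 1) : c 1 ∈ ({c 1}ᶜ : Set V)) rfl
  have hmem : ∀ v, ¬ G.Adj v (c 1) → ∀ w, G.Adj v w → w ∈ ({c 1}ᶜ : Set V) := by
    rintro v hv w hw rfl
    exact hv hw
  refine hK.critical _ hne fun j => ?_
  by_cases hj : j = col (c 0)
  · refine ⟨c 2, hl.2.1.ne', h02.trans hj.symm, fun l hl' => ?_⟩
    by_cases hlm : l = col (c 1)
    · exact ⟨c 3, fun h => hl.2.2.2.2.2.2.2.2.2 (h ▸ hl.2.2.2.1.symm),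
        hl.2.2.1, h3.trans hlm.symm⟩
    have hw1 : ∀ w, col w = l → w ∈ ({c 1}ᶜ : Set V) := by
      rintro w hw rfl
      exact hlm hw.symm
    obtain ⟨v, hv, hvb⟩ := hK.exists_seesAll j
    obtain ⟨w, -, hw, hwl⟩ := hvb l (fun h => hl' (h.trans (hv.trans (hj.trans h02.symm))))
    -- If only `c 0` was known as b-vertex, `c 2` sees the same colors: those in the bag of `c 4`,
    -- which `c 2` misses, recur on ears by `h4`.
    rcases loc v hvb with (rfl | rfl) | rfl | rfl | h
    · rcases nb0 _ _ b0 hw with h | h | h | h | h | h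
      · exact ⟨w, hw1 w hwl, (a12 _ _ h b2).symm, hwl⟩
      · obtain ⟨x, hx, hxw⟩ := h4 w h
        exact ⟨x, hw1 x (hxw.trans hwl), (yc x (.inl hx)).2.symm, hxw.trans hwl⟩
      · exact absurd h (hub w)
      · exact ⟨w, hw1 w hwl, (yc w (.inl h)).2.symm, hwl⟩
      · exact ⟨w, hw1 w hwl, (yc w (.inr h)).2.symm, hwl⟩
      · exact absurd h (e3 w)
    · exact ⟨w, hw1 w hwl, hw, hwl⟩
    · exact absurd (h3.symm.trans (hv.trans hj)) h01.symm
    · exact absurd (hv.trans hj) (hP (a40 _ _ b4 b0))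
    · exact absurd (hv.trans hj) (hP (yc _ (.inl h)).1)
  · obtain ⟨v, hv, hvb⟩ := hK.exists_seesAll j
    have hv1 : v ≠ c 1 ∧ ¬ G.Adj v (c 1) := by
      rcases loc v hvb with (rfl | rfl) | rfl | rfl | h
      · exact absurd hv.symm hj
      · exact absurd (hv.symm.trans h02) hj
      · refine ⟨fun h => hl.2.2.2.2.2.2.2.2.1
        (h.symm ▸ hl.1.symm), fun h => hl.2.2.2.2.2.2.1 h.symm⟩
      · refine ⟨fun h => hl.2.2.2.2.2.2.2.1 (h.symm ▸ hl.2.1).symm, hl.2.2.2.2.2.2.2.2.2⟩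
      · exact ⟨(bag_ne_ear b1 h).symm, hF.ear_bag_succ h b1⟩
    refine ⟨v, hv1.1, hv, fun l hl => ?_⟩
    obtain ⟨w, -, hw, hwl⟩ := hvb l hl
    exact ⟨w, hmem v hv1.2 w hw, hw, hwl⟩

/-- The bags of `c 0` and `c 2` are singletons and no ear has a far neighbor, so bags and ears cover
everything. Every ear dominates the bag of `c 1`; hence the color of `c 1` has its b-vertex at `c 3`
or `c 4`, which are symmetric. -/
theorem false_of_ear_zero_ear_two [Finite V] (hF : Frame G c) (hK : Critical G col)
    (hmod : (∀ i y o, Ear G c i y → Far G c o → ¬ G.Adj y o) →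
      ∀ v, (∃ i, Bag G c i v) ∨ ∃ i, Ear G c i v)
    (hy : Ear G c 0 y) (hz : Ear G c 2 z) : False := by
  obtain ⟨e1, e3, e4⟩ := hF.no_other_ear_of_ear_zero_ear_two hy hz
  have hcov := hmod fun i v o hv ho => by
    fin_cases i
    · exact (hF.ear_two_far hv hz ho).1
    · exact absurd hv (e1 v)
    · exact (hF.ear_two_far hy hv ho).2
    · exact absurd hv (e3 v)
    · exact absurd hv (e4 v)
  have hP := hK.proper
  obtain ⟨a01, a12, a23, a34, a40, y0, dB, dY, nb0, nb1, nb2, nb3, nb4, nbY⟩ := hF.table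
  have b0 := hF.cyc.bag_self 0
  have b1 := hF.cyc.bag_self 1
  have b2 := hF.cyc.bag_self 2
  have b3 := hF.cyc.bag_self 3
  have b4 := hF.cyc.bag_self 4
  have s0 : ∀ t, Bag G c 0 t → t = c 0 := fun t ht => hF.bag_eq_of_ear_two hy hz ht
  have s2 : ∀ t, Bag G c 2 t → t = c 2 := fun t ht =>
    (hF.mirror 2).bag_eq_of_ear_two (i := 0) (ear_mirror_zero.2 hz) (ear_mirror.2 hy)
      (bag_mirror_zero.2 ht)
  have hub : ∀ v, ¬ Hub G c v := by
    intro v hv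
    rcases hcov v with ⟨i, h⟩ | ⟨i, h⟩
    · exact G.irrefl (dB v i v hv h)
    · exact G.irrefl (dY v i v hv h)
  have yc : ∀ v, (Ear G c 0 v ∨ Ear G c 2 v) → G.Adj v (c 0) ∧ G.Adj v (c 2) := by
    rintro v (h | h)
    · exact ⟨h.1, h.2.1⟩
    · exact ⟨h.2.2.1, h.1⟩
  have dom1 : ∀ u v, Bag G c 1 u → (Ear G c 0 v ∨ Ear G c 2 v) →
      col u ≠ col v ∧ ¬ SeesAll G col Set.univ u := by
    intro u v hu hv
    refine hK.ne_and_not_seesAll ?_ ?_ fun w hw => ?_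
    · exact hv.elim (bag_ne_ear hu) (bag_ne_ear hu)
    · exact fun h => hv.elim (fun hv => hF.ear_bag_succ hv hu h.symm)
        fun hv => hF.ear_bag_pred hv hu h.symm
    · rcases nb1 u w hu hw with h | h | h | h | h | h
      · exact s2 w h ▸ (yc v hv).2
      · exact s0 w h ▸ (yc v hv).1
      · exact absurd h (hub w)
      · exact absurd h (e1 w)
      · exact absurd h (e3 w)
      · exact absurd h (e4 w)
  have n1 : ∀ v, Bag G c 1 v → ¬ SeesAll G col Set.univ v := fun v hv => (dom1 v y hv (.inl hy)).2
  have h1 : ∀ v, (Ear G c 0 v ∨ Ear G c 2 v) → col (c 1) ≠ col v := fun v hv => (dom1 _ v b1 hv).1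
  have dom := fun u v => @Critical.ne_and_not_seesAll _ _ _ _ u v hK
  obtain ⟨v, hv, hvb⟩ := hK.exists_seesAll (col (c 1))
  rcases hcov v with ⟨i, h⟩ | ⟨i, h⟩
  · fin_cases i
    · exact hP (a01 _ _ h b1) hv
    · exact n1 v h hvb
    · exact hP (a12 _ _ b1 h) hv.symm
    · have : v = c 3 := by
        by_contra hne
        refine (dom v (c 3) hne (hF.bag_bag h b3) fun w hw => ?_).2 hvb
        rcases nb3 v w h hw with h | h | h | h | h | h
        · exact a34 _ _ b3 h
        · exact (a23 _ _ h b3).symm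
        · exact absurd h (hub w)
        · exact absurd h (e3 w)
        · exact h.2.2.1.symm
        · exact absurd h (e1 w)
      subst this
      exact hF.false_of_seesAll_three hK hcov hy hz h1 n1 hv hvb
    · have : v = c 4 := by
        by_contra hne
        refine (dom v (c 4) hne (hF.bag_bag h b4) fun w hw => ?_).2 hvb
        rcases nb4 v w h hw with h | h | h | h | h | h
        · exact a40 _ _ b4 h
        · exact (a34 _ _ h b4).symm
        · exact absurd h (hub w)
        · exact absurd h (e4 w)
        · exact absurd h (e1 w)
        · exact h.2.1.symm
      subst this
      refine (hF.mirror 2).false_of_seesAll_three (y := z) (z := y) hK (fun v => ?_)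
        (ear_mirror_zero.2 hz) (ear_mirror.2 hy) (fun v hv => h1 v ?_)
        (fun v hv => n1 v (bag_mirror.1 hv)) hv hvb
      · rcases hcov v with ⟨i, h⟩ | ⟨i, h⟩
        · exact .inl ⟨2 - i, bag_mirror.2 (by simpa using h)⟩
        · exact .inr ⟨2 - i, ear_mirror.2 (by simpa using h)⟩
      · exact hv.elim (fun h => .inr (ear_mirror_zero.1 h)) fun h => .inl (ear_mirror.1 h)
  · fin_cases i
    · exact h1 v (.inl h) hv.symm
    · exact e1 v h
    · exact h1 v (.inr h) hv.symm
    · exact e3 v h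
    · exact e4 v h

end Frame

end BPerfect

/-! ### b-colorings and minimal counterexamples. -/

namespace BPerfect

universe u

variable {V : Type u} {G : SimpleGraph V}

section BColoring

theorem hasBColoring_of_proper {κ : Type*} [Fintype κ] (col : V → κ)
    (hcol : ∀ u v, G.Adj u v → col u ≠ col v)
    (hb : ∀ j, ∃ v, col v = j ∧ ∀ l, l ≠ j → ∃ w, G.Adj v w ∧ col w = l) :
    HasBColoring G (Fintype.card κ) := by
  let e := Fintype.equivFin κ
  refine ⟨SimpleGraph.Coloring.mk (fun v => e (col v)) fun {u v} h he =>
    hcol u v h (e.injective he), fun i => ?_⟩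
  obtain ⟨v, hv, hvb⟩ := hb (e.symm i)
  refine ⟨v, (by simp [hv] : e (col v) = i), fun j hj => ?_⟩
  have hj' : e.symm j ≠ e.symm i := fun h => hj <|
    (by simpa [hv] using h : j = e (col v))
  obtain ⟨w, hw, hwj⟩ := hvb (e.symm j) hj'
  exact ⟨w, hw, (by simp [hwj] : e (col w) = j)⟩

theorem HasBColoring.of_iso {W : Type*} {H : SimpleGraph W} {k : ℕ} (e : G ≃g H)
    (h : HasBColoring G k) : HasBColoring H k := by
  obtain ⟨C, hC⟩ := h
  refine ⟨C.comp e.symm.toHom, fun i => ?_⟩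
  obtain ⟨v, hv, hvb⟩ := hC i
  refine ⟨e v, by simpa using hv, fun j hj => ?_⟩
  obtain ⟨w, hw, hwj⟩ := hvb j (by simpa using hj)
  exact ⟨e w, e.map_adj_iff.2 hw, by simpa using hwj⟩

/-- In an optimal coloring a color class without a b-vertex could be dissolved, each of its vertices
moving to a color missing from its neighborhood. -/
theorem HasBColoring.of_colorable [Finite V] {m : ℕ} (hm : G.Colorable m)
    (hmin : ∀ n, G.Colorable n → m ≤ n) : HasBColoring G m := by
  classical
  obtain ⟨C⟩ := hm
  refine ⟨C, fun i => ?_⟩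
  by_contra! hno
  have : ∀ v, C v = i → ∃ j, j ≠ i ∧ ∀ w, G.Adj v w → C w ≠ j := by
    intro v hv
    have := hno v hv
    simp only [IsBVertex, not_forall, not_exists, not_and] at this
    obtain ⟨j, hj, h⟩ := this
    exact ⟨j, hv ▸ hj, h⟩
  choose r hr hrw using this
  let D : G.Coloring {j : Fin m // j ≠ i} := SimpleGraph.Coloring.mk
    (fun v => if h : C v = i then ⟨r v h, hr v h⟩ else ⟨C v, h⟩) (by
      intro u v huv
      have := C.valid huv
      split_ifs with h1 h2 h2
      · exact absurd (h1.trans h2.symm) this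
      · exact fun h => hrw u h1 v huv (Subtype.ext_iff.1 h).symm
      · exact fun h => hrw v h2 u huv.symm (Subtype.ext_iff.1 h)
      · exact fun h => this (Subtype.ext_iff.1 h))
  have hc := hmin _ D.colorable
  rw [Fintype.card_subtype_compl, Fintype.card_subtype_eq, Fintype.card_fin] at hc
  have := i.2
  omega

/-- Since the chromatic number is always attained by a b-coloring, equality amounts to an upper
bound, which avoids suprema in `ℕ∞`. -/
theorem isBPerfect_iff [Finite V] : IsBPerfect G ↔ ∀ (s : Set V) (k m : ℕ),
    (G.induce s).Colorable m → HasBColoring (G.induce s) k → k ≤ m := by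
  constructor
  · intro h s k m hm hk
    have h1 : (k : ℕ∞) ≤ bChromaticNumber (G.induce s) :=
      le_iSup₂_of_le (f := fun (k : ℕ) (_ : k ∈ {k | HasBColoring (G.induce s) k}) => (k : ℕ∞))
        k hk le_rfl
    rw [← h s] at h1
    exact_mod_cast h1.trans hm.chromaticNumber_le
  · intro h s
    have hcol : (G.induce s).Colorable (Nat.card s) := by
      have := Fintype.ofFinite s
      rw [Nat.card_eq_fintype_card]
      exact (G.induce s).colorable_of_fintype
    classical
    have hex : ∃ m, (G.induce s).Colorable m := ⟨_, hcol⟩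
    have hm := Nat.find_spec hex
    have hmin : ∀ n, (G.induce s).Colorable n → Nat.find hex ≤ n := fun n hn => Nat.find_min' hex hn
    apply le_antisymm
    · exact hm.chromaticNumber_le.trans
        (le_iSup₂_of_le (f := fun (k : ℕ) (_ : k ∈ {k | HasBColoring (G.induce s) k}) => (k : ℕ∞))
          _ (HasBColoring.of_colorable hm hmin) le_rfl)
    · refine iSup₂_le fun k hk => ?_
      refine SimpleGraph.le_chromaticNumber_iff_colorable.2 fun n hn => h s k n hn hk

end BColoring

theorem IsFamilyFree.induce (h : IsFamilyFree G) (s : Set V) : IsFamilyFree (G.induce s) :=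
  fun F hF hc => h F hF (hc.trans ⟨SimpleGraph.Embedding.induce s⟩)

/-- `𝓕`-free graphs with fewer vertices than `G` have no b-coloring with more colors than some
proper coloring. -/
theorem IsMinimalCounterexample.le_of_card_lt (hG : IsMinimalCounterexample G) {W : Type u}
    [Finite W] {H : SimpleGraph W} (hW : Nat.card W < Nat.card V) (hH : IsFamilyFree H) {k m : ℕ}
    (hm : H.Colorable m) (hk : HasBColoring H k) : k ≤ m := by
  by_contra hlt
  have : ¬ IsBPerfect H := fun h => hlt <|
    isBPerfect_iff.1 h Set.univ k m (hm.of_hom H.induceUnivIso.toHom)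
      (hk.of_iso H.induceUnivIso.symm)
  rcases hG.2 W H ⟨hH, this⟩ with h | h
  · omega
  · omega

/-- A proper induced subgraph is smaller and still `𝓕`-free, so the failure of b-perfection occurs
at the whole graph. -/
theorem IsMinimalCounterexample.exists_lt [Finite V] (hG : IsMinimalCounterexample G) :
    ∃ k m, m < k ∧ G.Colorable m ∧ HasBColoring G k := by
  have := hG.1.2
  rw [isBPerfect_iff] at this
  push Not at this
  obtain ⟨s, k, m, hm, hk, hlt⟩ := this
  by_cases hs : s = Set.univ
  · subst hs
    exact ⟨k, m, hlt, hm.of_hom G.induceUnivIso.symm.toHom, hk.of_iso G.induceUnivIso⟩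
  · exfalso
    have hcard : Nat.card s < Nat.card V := by
      rw [Nat.card_coe_set_eq]
      exact (Set.ncard_lt_ncard (Set.ssubset_univ_iff.2 hs)).trans_eq (Set.ncard_univ V)
    exact absurd (hG.le_of_card_lt hcard (hG.1.1.induce s) hm hk) (not_le.2 hlt)

/-- No forbidden graph has three pairwise adjacent twins. -/
theorem family_no_three_twins : ∀ F ∈ family, ∀ a b c : Fin F.1, a ≠ b → a ≠ c → b ≠ c →
    F.2.Adj a b → F.2.Adj a c → F.2.Adj b c →
    ∃ d, d ≠ a ∧ d ≠ b ∧ d ≠ c ∧ ¬ ((F.2.Adj d a ↔ F.2.Adj d b) ∧ (F.2.Adj d a ↔ F.2.Adj d c)) := by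
  simp only [family, List.forall_mem_cons]
  refine ⟨?_, ?_, ?_, ?_, ?_, ?_, ?_, ?_, ?_, ?_, ?_, ?_, ?_, ?_, ?_, ?_, ?_, ?_, ?_, ?_, ?_, ?_,
    by simp⟩ <;> decide +kernel

end BPerfect

/-! ### Replacing a module by a clique, and the conclusion. -/

namespace BPerfect

universe u

variable {V : Type u} {G : SimpleGraph V}

/-- The graph obtained from `G` by making `S` a clique. -/
def addClique (G : SimpleGraph V) (S : Set V) : SimpleGraph V where
  Adj u v := G.Adj u v ∨ (u ∈ S ∧ v ∈ S ∧ u ≠ v)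
  symm := ⟨fun _ _ h => h.elim (fun h => .inl h.symm) fun h => .inr ⟨h.2.1, h.1, h.2.2.symm⟩⟩
  loopless := ⟨fun _ h => h.elim (fun h => G.irrefl h) fun h => h.2.2 rfl⟩

/-- Replacing a module that contains an edge by a clique on some of its vertices preserves
`𝓕`-freeness. -/
theorem IsFamilyFree.addClique_induce (h : IsFamilyFree G) {N S : Set V} (hSN : S ⊆ N)
    (hmod : ∀ v, v ∉ N → ∀ s ∈ N, ∀ t ∈ N, G.Adj v s → G.Adj v t) {p q : V} (hp : p ∈ N)
    (hq : q ∈ N) (hpq : G.Adj p q) : IsFamilyFree ((addClique G S).induce (Nᶜ ∪ S)) := by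
  classical
  rintro F hF ⟨φ⟩
  have hout : ∀ x, (φ x : V) ∉ S → (φ x : V) ∉ N := fun x hx => (φ x).2.resolve_right hx
  have hadj : ∀ x y, F.2.Adj x y ↔ G.Adj (φ x) (φ y) ∨
      ((φ x : V) ∈ S ∧ (φ y : V) ∈ S ∧ (φ x : V) ≠ φ y) := fun x y => φ.map_adj_iff.symm
  have hadj' : ∀ x y, (φ y : V) ∉ S → (F.2.Adj x y ↔ G.Adj (φ x) (φ y)) := by
    intro x y hy
    rw [hadj]
    tauto
  have hinj : ∀ x y, (φ x : V) = φ y → x = y := fun x y hxy => φ.injective (Subtype.ext hxy)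
  have hmod' : ∀ v, v ∉ N → ∀ s ∈ N, ∀ t ∈ N, (G.Adj v s ↔ G.Adj v t) := fun v hv s hs t ht =>
    ⟨hmod v hv s hs t ht, hmod v hv t ht s hs⟩
  -- The vertices of `F` mapped into `S` are pairwise adjacent twins, so there are at most two.
  have htwo : ∀ x y z, (φ x : V) ∈ S → (φ y : V) ∈ S → (φ z : V) ∈ S → x ≠ y → z = x ∨ z = y := by
    intro x y z hx hy hz hxy
    by_contra! hne
    have key : ∀ {a b}, (φ a : V) ∈ S → (φ b : V) ∈ S → a ≠ b → F.2.Adj a b := fun ha hb hab =>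
      (hadj _ _).2 (.inr ⟨ha, hb, fun h => hab (hinj _ _ h)⟩)
    obtain ⟨d, hdx, hdy, hdz, hd⟩ := family_no_three_twins F hF x y z hxy hne.1.symm hne.2.symm
      (key hx hy hxy) (key hx hz hne.1.symm) (key hy hz hne.2.symm)
    apply hd
    by_cases hdS : (φ d : V) ∈ S
    · exact ⟨iff_of_true (key hdS hx hdx) (key hdS hy hdy),
        iff_of_true (key hdS hx hdx) (key hdS hz hdz)⟩
    · have : ∀ a b, (φ a : V) ∈ S → (φ b : V) ∈ S → (F.2.Adj d a ↔ F.2.Adj d b) := by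
        intro a b ha hb
        rw [F.2.adj_comm d a, F.2.adj_comm d b, hadj' a d hdS, hadj' b d hdS, G.adj_comm,
          G.adj_comm (φ b : V)]
        exact hmod' _ (hout d hdS) _ (hSN ha) _ (hSN hb)
      exact ⟨this x y hx hy, this x z hx hz⟩
  by_cases hT : ∃ a, (φ a : V) ∈ S
  · obtain ⟨a, ha⟩ := hT
    -- The at most two vertices in the clique move to the ends of the edge `p q` of the module,
    -- giving a copy of `F` in `G`.
    let g : Fin F.1 → V := fun x => if (φ x : V) ∈ S then if x = a then p else q else φ x
    have gN : ∀ x, (φ x : V) ∈ S → g x ∈ N := by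
      intro x hx
      simp only [g, if_pos hx]
      split_ifs
      exacts [hp, hq]
    have gout : ∀ x, (φ x : V) ∉ S → g x = φ x := fun x hx => if_neg hx
    have gadj : ∀ x y, x ≠ y → (F.2.Adj x y ↔ G.Adj (g x) (g y)) ∧ g x ≠ g y := by
      intro x y hxy
      by_cases hx : (φ x : V) ∈ S
      · by_cases hy : (φ y : V) ∈ S
        · have hF' : F.2.Adj x y := (hadj _ _).2 (.inr ⟨hx, hy, fun h => hxy (hinj _ _ h)⟩)
          have hg : G.Adj (g x) (g y) := by
            rcases htwo x y a hx hy ha hxy with rfl | rfl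
            · simp only [g, if_pos hx, if_pos hy, if_neg hxy.symm, if_true]
              exact hpq
            · simp only [g, if_pos hx, if_pos hy, if_neg hxy, if_true]
              exact hpq.symm
          exact ⟨iff_of_true hF' hg, hg.ne⟩
        · rw [gout y hy, hadj' x y hy, G.adj_comm, G.adj_comm (g x)]
          refine ⟨hmod' _ (hout y hy) _ (hSN hx) _ (gN x hx), fun h => hout y hy (h ▸ gN x hx)⟩
      · by_cases hy : (φ y : V) ∈ S
        · rw [gout x hx, F.2.adj_comm, hadj' y x hx, G.adj_comm]
          refine ⟨hmod' _ (hout x hx) _ (hSN hy) _ (gN y hy), fun h => hout x hx (h ▸ gN y hy)⟩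
        · rw [gout x hx, gout y hy, hadj' x y hy]
          exact ⟨Iff.rfl, fun h => hxy (hinj _ _ h)⟩
    refine h F hF ⟨⟨⟨g, fun x y hxy => ?_⟩, fun {x y} => ?_⟩⟩
    · by_contra hne
      exact (gadj x y hne).2 hxy
    · change G.Adj (g x) (g y) ↔ F.2.Adj x y
      by_cases hxy : x = y
      · subst hxy
        simp
      · exact (gadj x y hxy).1.symm
  · push Not at hT
    exact h F hF ⟨⟨⟨fun x => φ x, fun x y hxy => hinj x y hxy⟩, fun {x y} =>
      (hadj' x y (hT y)).symm⟩⟩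

/-- In a minimal counterexample, a module that contains an edge and two nonadjacent vertices and
whose colors all have b-vertices inside it is the whole vertex set. -/
theorem IsMinimalCounterexample.eq_univ_of_module [Finite V] (hG : IsMinimalCounterexample G)
    {k m : ℕ} (hmk : m < k) (f : G.Coloring (Fin m)) {col : V → Fin k}
    (hcol : ∀ ⦃u v⦄, G.Adj u v → col u ≠ col v)
    (hb : ∀ j, ∃ v, col v = j ∧ SeesAll G col Set.univ v) {N : Set V}
    (hmod : ∀ v, v ∉ N → ∀ s ∈ N, ∀ t ∈ N, G.Adj v s → G.Adj v t)
    (hbN : ∀ v ∈ N, ∃ w ∈ N, col w = col v ∧ SeesAll G col Set.univ w)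
    {p q r : V} (hp : p ∈ N) (hq : q ∈ N) (hr : r ∈ N) (hpq : G.Adj p q) (hpr : ¬ G.Adj p r)
    (hpr' : p ≠ r) : N = Set.univ := by
  classical
  by_contra hN
  have := Fintype.ofFinite V
  have hcard : ∀ s : Set V, s ≠ Set.univ → Nat.card s < Nat.card V := fun s hs => by
    rw [Nat.card_coe_set_eq]
    exact (Set.ncard_lt_ncard (Set.ssubset_univ_iff.2 hs)).trans_eq (Set.ncard_univ V)
  have hsep : ∀ v ∉ N, ∀ s ∈ N, G.Adj v s → ∀ t ∈ N, col v ≠ col t ∧ f v ≠ f t :=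
    fun v hv s hs h t ht => ⟨hcol (hmod v hv s hs t ht h), f.valid (hmod v hv s hs t ht h)⟩
  -- An outside neighbor of a vertex of `N` sees all of `N`, so its color does not occur in `N`.
  -- Hence `col` restricts to a b-coloring of the smaller graph on `N`, and minimality gives the
  -- bound.
  have hle : Fintype.card (col '' N) ≤ Fintype.card (f '' N) := by
    refine hG.le_of_card_lt (hcard N hN) (hG.1.1.induce N) ?_ ?_
    · exact (SimpleGraph.Coloring.mk (fun v : N => (⟨f v, v, v.2, rfl⟩ : f '' N))
        fun {u v} h he => f.valid h (Subtype.ext_iff.1 he)).colorable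
    · refine hasBColoring_of_proper (fun v : N => (⟨col v, v, v.2, rfl⟩ : col '' N))
        (fun u v h he => hcol h (Subtype.ext_iff.1 he)) ?_
      rintro ⟨_, v, hv, rfl⟩
      obtain ⟨w, hw, hwv, hwb⟩ := hbN v hv
      refine ⟨⟨w, hw⟩, Subtype.ext hwv, ?_⟩
      rintro ⟨_, x, hx, rfl⟩ hxv
      obtain ⟨y, -, hy, hyx⟩ := hwb (col x) fun h => hxv (Subtype.ext (h.trans hwv))
      have hyN : y ∈ N := by
        by_contra hyN
        exact (hsep y hyN w hw hy.symm x hx).1 hyx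
      exact ⟨⟨y, hyN⟩, hy, Subtype.ext hyx⟩
  obtain ⟨ι⟩ := Function.Embedding.nonempty_of_card_le hle
  have hrep : ∀ j : col '' N, ∃ v ∈ N, col v = j := fun j => j.2
  choose rep hrepN hrep using hrep
  let S : Set V := Set.range rep
  have hSN : S ⊆ N := by
    rintro _ ⟨j, rfl⟩
    exact hrepN j
  have hSinj : ∀ u ∈ S, ∀ v ∈ S, col u = col v → u = v := by
    rintro _ ⟨i, rfl⟩ _ ⟨j, rfl⟩ h
    rw [hrep, hrep] at h
    rw [Subtype.ext h]
  -- If nothing were deleted, `col` would be injective on `N`, so `p` would be a b-vertex and would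
  -- have to see `r`.
  have hT : Nᶜ ∪ S ≠ Set.univ := by
    intro hT
    have hNS : ∀ v ∈ N, v ∈ S := fun v hv =>
      ((hT.symm ▸ Set.mem_univ v : v ∈ Nᶜ ∪ S)).resolve_left fun h => h hv
    obtain ⟨w, hw, hwp, hwb⟩ := hbN p hp
    obtain rfl := hSinj w (hNS w hw) p (hNS p hp) hwp
    obtain ⟨x, -, hx, hxr⟩ := hwb (col r) fun h => hpr' (hSinj r (hNS r hr) w (hNS w hw) h).symm
    have hxN : x ∈ N := by
      by_contra hxN
      exact (hsep x hxN w hw hx.symm r hr).1 hxr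
    exact hpr (hSinj x (hNS x hxN) r (hNS r hr) hxr ▸ hx)
  have hfree := hG.1.1.addClique_induce hSN hmod hp hq hpq
  have hrepS : ∀ v ∈ N, ∃ s ∈ S, col s = col v := fun v hv =>
    ⟨rep ⟨col v, v, hv, rfl⟩, ⟨_, rfl⟩, hrep _⟩
  -- The clique is colored through `ι` with colors that `f` uses on `N`, which gives `m` colors in
  -- all. The restriction of `col` still is a b-coloring with all `k` colors: each clique vertex
  -- inherits the outside neighbors of the b-vertex of its color.
  refine absurd (hG.le_of_card_lt (hcard _ hT) hfree (m := m) (k := k) ?_ ?_) (not_le.2 hmk)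
  · refine ⟨SimpleGraph.Coloring.mk (fun v => if h : (v : V) ∈ N then
      (ι ⟨col v, v, h, rfl⟩ : Fin m) else f v) ?_⟩
    have hι : ∀ j, ∃ t ∈ N, f t = ι j := fun j => (ι j).2
    rintro ⟨u, hu⟩ ⟨v, hv⟩ huv he
    have hSmem : ∀ x, x ∈ Nᶜ ∪ S → x ∈ N → x ∈ S := fun x hx hxN => hx.resolve_left fun h => h hxN
    have hv' : ∀ x y, y ∉ N → (addClique G S).Adj x y → G.Adj x y := fun x y hy h =>
      h.resolve_right fun h => hy (hSN h.2.1)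
    by_cases huN : u ∈ N <;> by_cases hvN : v ∈ N
    · simp only [dif_pos huN, dif_pos hvN] at he
      have h1 := Subtype.ext_iff.1 (ι.injective (Subtype.ext he))
      have h2 := hSinj u (hSmem u hu huN) v (hSmem v hv hvN) h1
      subst h2
      exact (addClique G S).irrefl huv
    · simp only [dif_pos huN, dif_neg hvN] at he
      obtain ⟨t, ht, hft⟩ := hι ⟨col u, u, huN, rfl⟩
      exact (hsep v hvN u huN (hv' u v hvN huv).symm t ht).2 (he.symm.trans hft.symm)
    · simp only [dif_neg huN, dif_pos hvN] at he
      obtain ⟨t, ht, hft⟩ := hι ⟨col v, v, hvN, rfl⟩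
      exact (hsep u huN v hvN (hv' v u huN huv.symm).symm t ht).2 (he.trans hft.symm)
    · simp only [dif_neg huN, dif_neg hvN] at he
      exact f.valid (hv' u v hvN huv) he
  · have hk : Fintype.card (Fin k) = k := Fintype.card_fin k
    rw [← hk]
    refine hasBColoring_of_proper (fun v => col v) ?_ fun j => ?_
    · rintro ⟨u, hu⟩ ⟨v, hv⟩ (h | ⟨h1, h2, h3⟩)
      · exact hcol h
      · exact fun he => h3 (hSinj u h1 v h2 he)
    obtain ⟨v, rfl, hvb⟩ := hb j
    by_cases hj : ∃ w ∈ N, col w = col v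
    · obtain ⟨w, hw, hwv⟩ := hj
      obtain ⟨x, hx, hxw, hxb⟩ := hbN w hw
      obtain ⟨s, hs, hsw⟩ := hrepS w hw
      refine ⟨⟨s, .inr hs⟩, hsw.trans hwv, fun l hl => ?_⟩
      obtain ⟨y, -, hy, hyl⟩ := hxb l (by rwa [hxw, hwv])
      by_cases hyN : y ∈ N
      · obtain ⟨t, ht, hty⟩ := hrepS y hyN
        refine ⟨⟨t, .inr ht⟩, .inr ⟨hs, ht, ?_⟩, hty.trans hyl⟩
        rintro h
        have h : s = t := h
        exact hl (by rw [← hyl, ← hty, ← h, hsw, hwv])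
      · exact ⟨⟨y, .inl hyN⟩, .inl (hmod y hyN x hx s (hSN hs) hy.symm).symm, hyl⟩
    · have hvN : v ∉ N := fun h => hj ⟨v, h, rfl⟩
      refine ⟨⟨v, .inl hvN⟩, rfl, fun l hl => ?_⟩
      obtain ⟨y, -, hy, hyl⟩ := hvb l hl
      by_cases hyN : y ∈ N
      · obtain ⟨t, ht, hty⟩ := hrepS y hyN
        exact ⟨⟨t, .inr ht⟩, .inl (hmod v hvN y hyN t (hSN ht) hy), hty.trans hyl⟩
      · exact ⟨⟨y, .inl hyN⟩, .inl hy, hyl⟩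

namespace Frame

variable {κ : Type*} {col : V → κ} {c : Fin 5 → V}

theorem false_of_critical [Finite V] (hF : Frame G c) (hK : Critical G col)
    (hmod : (∀ i y o, Ear G c i y → Far G c o → ¬ G.Adj y o) →
      ∀ v, (∃ i, Bag G c i v) ∨ ∃ i, Ear G c i v) : False := by
  have hmod' : ∀ j, (∀ i y o, Ear G (BPerfect.rot c j) i y → Far G (BPerfect.rot c j) o →
      ¬ G.Adj y o) →
      ∀ v, (∃ i, Bag G (BPerfect.rot c j) i v) ∨ ∃ i, Ear G (BPerfect.rot c j) i v := by
    intro j h v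
    rcases hmod (fun i y o hy ho => h (i - j) y o (ear_rot.2 (by simpa using hy))
      (far_rot.2 ho)) v with ⟨i, h⟩ | ⟨i, h⟩
    · exact .inl ⟨i - j, bag_rot.2 (by simpa using h)⟩
    · exact .inr ⟨i - j, ear_rot.2 (by simpa using h)⟩
  by_cases h1 : ∃ i y z, Ear G c i y ∧ Ear G c (i + 1) z
  · obtain ⟨i, y, z, hy, hz⟩ := h1
    exact (hF.rot i).false_of_ear_zero_ear_one hK (hmod' i) (ear_rot_zero.2 hy) (ear_rot.2 hz)
  by_cases h2 : ∃ i y z, Ear G c i y ∧ Ear G c (i + 2) z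
  · obtain ⟨i, y, z, hy, hz⟩ := h2
    exact (hF.rot i).false_of_ear_zero_ear_two hK (hmod' i) (ear_rot_zero.2 hy) (ear_rot.2 hz)
  push Not at h1 h2
  by_cases h0 : ∃ i y, Ear G c i y
  · obtain ⟨i, y, hy⟩ := h0
    refine (hF.rot i).false_of_ear_zero_only hK (hmod' i) (ear_rot_zero.2 hy) fun l v hl hv => ?_
    have hv := ear_rot.1 hv
    have e3 : ∀ i : Fin 5, i + 3 + 2 = i := by decide
    have e4 : ∀ i : Fin 5, i + 4 + 1 = i := by decide
    fin_cases l
    · exact hl rfl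
    · exact h1 i y v hy hv
    · exact h2 i y v hy hv
    · exact h2 _ v y hv ((e3 i).symm ▸ hy)
    · exact h1 _ v y hv ((e4 i).symm ▸ hy)
  · push Not at h0
    refine hF.false_of_no_ear hK (fun v => ?_) h0
    rcases hmod (fun i y o hy => absurd hy (h0 i y)) v with h | ⟨i, h⟩
    · exact h
    · exact absurd h (h0 i v)

end Frame

theorem IsC5.three_le_of_coloring {c : Fin 5 → V} {m : ℕ} (hc : IsC5 G c) (f : G.Coloring (Fin m)) :
    3 ≤ m := by
  by_contra! hm
  have h0 := (f (c 0)).2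
  have h1 := (f (c 1)).2
  have h2 := (f (c 2)).2
  have h3 := (f (c 3)).2
  have h4 := (f (c 4)).2
  have hl := hc.lits
  have n0 : (f (c 0) : ℕ) ≠ f (c 1) := fun h => f.valid hl.1 (Fin.ext h)
  have n1 : (f (c 1) : ℕ) ≠ f (c 2) := fun h => f.valid hl.2.1 (Fin.ext h)
  have n2 : (f (c 2) : ℕ) ≠ f (c 3) := fun h => f.valid hl.2.2.1 (Fin.ext h)
  have n3 : (f (c 3) : ℕ) ≠ f (c 4) := fun h => f.valid hl.2.2.2.1 (Fin.ext h)
  have n4 : (f (c 4) : ℕ) ≠ f (c 0) := fun h => f.valid hl.2.2.2.2.1 (Fin.ext h)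
  omega

theorem IsC5.exists_frame [Finite V] {c : Fin 5 → V} (h : IsFamilyFree G) (hc : IsC5 G c) :
    ∃ c', Frame G c' := by
  have hne : {c' : Fin 5 → V | IsC5 G c'}.Nonempty := ⟨c, hc⟩
  obtain ⟨c', hc', hmax⟩ := Set.exists_max_image {c' : Fin 5 → V | IsC5 G c'}
    (fun c' => (earSet G c').ncard) (Set.toFinite _) hne
  exact ⟨c', h, hc', hmax⟩

/-- Two tasks remain: deriving `Critical` from minimality, and checking the hypotheses of
`eq_univ_of_module` for the union of bags and ears when no ear has a far neighbor. -/
theorem IsMinimalCounterexample.not_isC5 [Finite V] (hG : IsMinimalCounterexample G)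
    {c : Fin 5 → V} : ¬ IsC5 G c := by
  intro hc
  obtain ⟨c, hF⟩ := hc.exists_frame hG.1.1
  obtain ⟨k, m, hmk, ⟨f⟩, C, hC⟩ := hG.exists_lt
  have h3 := hF.cyc.three_le_of_coloring f
  have hb : ∀ j, ∃ v, C v = j ∧ SeesAll G C Set.univ v := by
    intro j
    obtain ⟨v, hv, hvb⟩ := hC j
    refine ⟨v, hv, fun l hl => ?_⟩
    obtain ⟨w, hw, hwl⟩ := hvb l hl
    exact ⟨w, Set.mem_univ _, hw, hwl⟩
  have hK : Critical G C := by
    refine ⟨fun u v h => C.valid h, hb, fun S hS hall => ?_, fun i j l => ?_⟩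
    · have hcard : Nat.card S < Nat.card V := by
        rw [Nat.card_coe_set_eq]
        exact (Set.ncard_lt_ncard (Set.ssubset_univ_iff.2 hS)).trans_eq (Set.ncard_univ V)
      refine absurd (hG.le_of_card_lt hcard (hG.1.1.induce S) (m := m) (k := k)
        ⟨f.comp (SimpleGraph.Embedding.induce S).toHom⟩ ?_) (not_le.2 hmk)
      rw [← Fintype.card_fin k]
      refine hasBColoring_of_proper (fun v => C v) (fun u v h => C.valid h) fun j => ?_
      obtain ⟨v, hvS, hv, hvb⟩ := hall j
      refine ⟨⟨v, hvS⟩, hv, fun l hl => ?_⟩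
      obtain ⟨w, hwS, hw, hwl⟩ := hvb l (hv.symm ▸ hl)
      exact ⟨⟨w, hwS⟩, hw, hwl⟩
    · by_contra! hcon
      have hsub : (Finset.univ : Finset (Fin k)) ⊆ {i, j, l} := by
        intro x _
        simp only [Finset.mem_insert, Finset.mem_singleton]
        by_contra! hx
        exact hx.2.2 (hcon x hx.1 hx.2.1)
      have h1 := Finset.card_le_card hsub
      have h2 := Finset.card_le_three (a := i) (b := j) (c := l)
      rw [Finset.card_univ, Fintype.card_fin] at h1
      omega
  refine hF.false_of_critical hK fun hEF => ?_
  let N : Set V := {v | (∃ i, Bag G c i v) ∨ ∃ i, Ear G c i v}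
  have hout : ∀ v, v ∉ N → Hub G c v ∨ Far G c v := fun v hv => by
    rcases hF.cases v with h | h | h | h
    · exact absurd (.inl h) hv
    · exact absurd (.inr h) hv
    · exact .inl h
    · exact .inr h
  have hhub : ∀ v, Hub G c v → ∀ s ∈ N, G.Adj v s := by
    rintro v hv s (⟨i, hs⟩ | ⟨i, hs⟩)
    · exact hF.hub_bag hv hs
    · exact hF.hub_ear hv hs
  have hfar : ∀ v, Far G c v → ∀ s ∈ N, ¬ G.Adj v s := by
    rintro v hv s (⟨i, hs⟩ | ⟨i, hs⟩)
    · exact hF.far_bag hv hs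
    · exact fun h => hEF i s v hs hv h.symm
  have hmod : ∀ v, v ∉ N → ∀ s ∈ N, ∀ t ∈ N, G.Adj v s → G.Adj v t := by
    intro v hv s hs t ht h
    rcases hout v hv with hv | hv
    · exact hhub v hv t ht
    · exact absurd h (hfar v hv s hs)
  -- A b-vertex colored like a vertex of `N` is not a hub, as hubs see all of `N`; and a far
  -- b-vertex would have an ear as neighbor.
  have hbN : ∀ v ∈ N, ∃ w ∈ N, C w = C v ∧ SeesAll G C Set.univ w := by
    intro v hv
    obtain ⟨w, hw, hwb⟩ := hb (C v)
    refine ⟨w, ?_, hw, hwb⟩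
    by_contra hwN
    rcases hout w hwN with h | h
    · exact C.valid (hhub w h v hv) hw
    · obtain ⟨i, y, hy, hyw⟩ := (hF.far_of_seesAll hK h hwb).2
      exact hEF i y w hy h hyw
  have hmem : ∀ i, c i ∈ N := fun i => .inl ⟨i, hF.cyc.bag_self i⟩
  have hN := hG.eq_univ_of_module hmk f (fun u v h => C.valid h) hb hmod hbN (hmem 0) (hmem 1)
    (hmem 2) hF.cyc.lits.1 hF.cyc.lits.2.2.2.2.2.1 hF.cyc.ne_zero_two
  exact fun v => (hN.symm ▸ Set.mem_univ v : v ∈ N)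

end BPerfect

theorem theorem2 {V : Type*} [Finite V] (G : SimpleGraph V)
    (hG : BPerfect.IsMinimalCounterexample G) :
    ¬ (SimpleGraph.cycleGraph 5).IsIndContained G := by
  rintro ⟨φ⟩
  refine hG.not_isC5 (c := fun i => φ i) fun i => ?_
  rw [φ.map_adj_iff, φ.map_adj_iff]
  revert i
  decide
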